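/- Let $q\ge 0$ be an integer. Let $G=\mathrm{SOSp}^+_{cs}(1,1|2q)$ be the cs form of the complex supergroup of even supermatrices $g$ of size $2|2q$ with $g^{st}Jg=J$, $J=\mathrm{diag}(-1,1\,|\,J_q)$ (where $J_q$ is block diagonal with $q$ blocks $\begin{pmatrix}0&1\\-1&0\end{pmatrix}$), with underlying Lie group $G_0=\mathrm{SO}^+(1,1)\times \mathrm{USp}(2q)$, $\mathrm{SO}^+$ being the identity component. Let $K=\mathrm{SOSp}_{cs}(1|2q)$ be the fixed subsupergroup of $\theta(g)=\sigma g\sigma$, $\sigma=\mathrm{diag}(-1,1\,|\,1)$. Let $\mathfrak a=\mathbb C h_0$, where $h_0$ has entries $1$ in the positions $(1,2)$ and $(2,1)$ and zeros elsewhere, let $\alpha\in\mathfrak a^*$ with $\alpha(h_0)=1$, identify $\mathfrak a^*$ with $\mathbb C$ via $\lambda\mapsto\lambda(h_0)$, and put $\mathfrak n=\mathfrak g^\alpha=\{x\in\mathfrak g: [h_0,x]=x\}$ and $\varrho=\frac12m_\alpha=\frac12(\dim\mathfrak g^\alpha_{\bar 0}-\dim\mathfrak g^\alpha_{\bar 1})$.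 Let $M$ be the centraliser of $\mathfrak a$ in $K$, let $A$ and $N$ be the analytic subsupergroups with Lie superalgebras $\mathfrak a$ and $\mathfrak n$, and let $H$ be the Iwasawa projection, defined by $g=k\,e^{H(g)h_0}\,n$ with $k\in K$ and $n\in N$. Then: (a) $\varrho=-q$, and $K/M$, a superspace of dimension $0|2q$ over a point, carries a non-zero $K$-invariant Berezinian density. (b) Fix any non-zero $K$-invariant Berezinian density $|D\dot k|$ on $K/M$, and let $\phi_\lambda(g)=\int_{K/M}|D\dot k|\,e^{(\lambda-\varrho)H(gk)}$ be the spherical superfunction. There is a non-zero constant $c_1$ such that for all $\lambda\in\mathbb C$ and $t\in\mathbb R$ $$\phi_\lambda(e^{th_0})=c_1e^{\lambda t}\sum_{k=0}^{-\varrho}\binom{\lambda-\varrho}{k}\binom{-\lambda-\varrho}{-\varrho-k}e^{(-\varrho-2k)t}.$$ (c) There is a non-zero constant $c_0'$, depending only on $\varrho$ (and on the normalisation of $|D\dot k|$), such that for all $\lambda$ with $\Re\lambda>0$ the limit $c(\lambda)=\lim_{t\to\infty}e^{-(\lambda-\varrho)t}\phi_\lambda(e^{th_0})$ exists and $$c(\lambda)=c_0'\,\frac{\Gamma(\lambda)}{\Gamma(\lambda+\varrho)},$$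 where $1/\Gamma$ is understood to be $0$ at the poles of $\Gamma$. -/

import Mathlib

noncomputable section

namespace OrthoSymplectic

/-! ### Superpoints

The superpoint with odd coordinate space `V*` has the Grassmann algebra `⋀ V` as its algebra of
superfunctions.  Supergroups are described by their functors of points on superpoints; a morphism
from the superpoint of `W` to that of `V` is a unital parity preserving algebra homomorphism
`⋀ V → ⋀ W`. -/

/-- The algebra of superfunctions on a superpoint. -/
abbrev Gr (V : Type) [AddCommGroup V] [Module ℂ V] : Type := ExteriorAlgebra ℂ V

/-- The even (`i = 0`) and odd (`i = 1`) superfunctions. -/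
def parity (V : Type) [AddCommGroup V] [Module ℂ V] (i : ZMod 2) : Submodule ℂ (Gr V) :=
  CliffordAlgebra.evenOdd (0 : QuadraticForm ℂ V) i

/-- The value of a superfunction at the unique point of the underlying space. -/
def body {V : Type} [AddCommGroup V] [Module ℂ V] : Gr V →ₐ[ℂ] ℂ :=
  ExteriorAlgebra.algebraMapInv

/-- Parity preserving algebra homomorphisms, i.e. morphisms of superpoints. -/
def IsSuperHom {V W : Type} [AddCommGroup V] [Module ℂ V] [AddCommGroup W] [Module ℂ W]
    (φ : Gr V →ₐ[ℂ] Gr W) : Prop :=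
  ∀ i : ZMod 2, ∀ a ∈ parity V i, φ a ∈ parity W i

/-- Pullback of superfunctions along the projection of a product of superpoints onto the first
factor. -/
def pullFst (V W : Type) [AddCommGroup V] [Module ℂ V] [AddCommGroup W] [Module ℂ W] :
    Gr V →ₐ[ℂ] Gr (V × W) :=
  ExteriorAlgebra.map (LinearMap.inl ℂ V W)

/-- Pullback of superfunctions along the projection onto the second factor. -/
def pullSnd (V W : Type) [AddCommGroup V] [Module ℂ V] [AddCommGroup W] [Module ℂ W] :
    Gr W →ₐ[ℂ] Gr (V × W) :=
  ExteriorAlgebra.map (LinearMap.inr ℂ V W)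

/-- The (finite) exponential series of a nilpotent element of a complex algebra. -/
def nilExp {A : Type} [Ring A] [Algebra ℂ A] (a : A) : A :=
  letI : Module ℚ A := Module.compHom A (algebraMap ℚ ℂ)
  IsNilpotent.exp a

/-- The exponential in a Grassmann algebra: `a` is the sum of its value and a nilpotent. -/
def grExp {V : Type} [AddCommGroup V] [Module ℂ V] (a : Gr V) : Gr V :=
  Complex.exp (body a) • nilExp (a - algebraMap ℂ (Gr V) (body a))

/-! ### Supermatrices of size `2|2q` -/

/-- Square supermatrices of size `2|2q`; the index `(a, j) : Fin 2 × Fin q` is the basis vector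
number `a` of the `j`-th symplectic plane. -/
abbrev SMat (q : ℕ) (R : Type) : Type :=
  Matrix (Fin 2 ⊕ (Fin 2 × Fin q)) (Fin 2 ⊕ (Fin 2 × Fin q)) R

/-- The supertranspose `(R S; T V) ↦ (Rᵗ Tᵗ; -Sᵗ Vᵗ)`. -/
def superTranspose {q : ℕ} {R : Type} [Ring R] (x : SMat q R) : SMat q R :=
  Matrix.fromBlocks x.toBlocks₁₁.transpose x.toBlocks₂₁.transpose
    (-x.toBlocks₁₂.transpose) x.toBlocks₂₂.transpose

/-- The form `diag(-1, 1 | J_q)`, with `J_q` block diagonal with `q` blocks `(0 1; -1 0)`. -/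
def formJ (q : ℕ) (R : Type) [Ring R] : SMat q R :=
  Matrix.fromBlocks !![-1, 0; 0, 1] 0 0
    (Matrix.blockDiagonal (fun _ : Fin q => !![0, 1; -1, 0]))

/-- The matrix `σ = diag(-1, 1 | 1)` that defines the involution `θ(x) = σ x σ`. -/
def sigma (q : ℕ) (R : Type) [Ring R] : SMat q R :=
  Matrix.fromBlocks !![-1, 0; 0, 1] 0 0 1

/-- The generator `h₀` of the even Cartan subspace `𝔞`. -/
def hZero (q : ℕ) (R : Type) [Ring R] : SMat q R :=
  Matrix.fromBlocks !![0, 1; 1, 0] 0 0 0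

/-- The equation `xˢᵗ J + J x = 0` of the Lie superalgebra `𝔬𝔰𝔭(1,1|2q)`. -/
def IsOsp {q : ℕ} {R : Type} [Ring R] (x : SMat q R) : Prop :=
  superTranspose x * formJ q R + formJ q R * x = 0

/-- The restricted root space `𝔤^α = {x ∈ 𝔤 | [h₀, x] = x}` of the root `α` with `α(h₀) = 1`. -/
def rootSpace (q : ℕ) : Submodule ℂ (SMat q ℂ) where
  carrier := {x | IsOsp x ∧ hZero q ℂ * x - x * hZero q ℂ = x}
  zero_mem' := by
    refine ⟨?_, by simp⟩
    have : superTranspose (0 : SMat q ℂ) = 0 := by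
      ext (i | i) (j | j) <;>
        simp [superTranspose, Matrix.toBlocks₁₁, Matrix.toBlocks₁₂, Matrix.toBlocks₂₁,
          Matrix.toBlocks₂₂]
    simp [IsOsp, this]
  add_mem' := by
    rintro x y ⟨hx, hx'⟩ ⟨hy, hy'⟩
    have h : superTranspose (x + y) = superTranspose x + superTranspose y := by
      ext (i | i) (j | j) <;>
        simp [superTranspose, Matrix.toBlocks₁₁, Matrix.toBlocks₁₂, Matrix.toBlocks₂₁,
          Matrix.toBlocks₂₂, add_comm]
    refine ⟨?_, ?_⟩
    · unfold IsOsp at *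
      rw [h, add_mul, mul_add, add_add_add_comm, hx, hy, add_zero]
    · rw [mul_add, add_mul, add_sub_add_comm, hx', hy']
  smul_mem' := by
    rintro c x ⟨hx, hx'⟩
    have h : superTranspose (c • x) = c • superTranspose x := by
      ext (i | i) (j | j) <;>
        simp [superTranspose, Matrix.toBlocks₁₁, Matrix.toBlocks₁₂, Matrix.toBlocks₂₁,
          Matrix.toBlocks₂₂]
    refine ⟨?_, ?_⟩
    · unfold IsOsp at *
      rw [h, Matrix.smul_mul, Matrix.mul_smul, ← smul_add, hx, smul_zero]
    · rw [Matrix.smul_mul, Matrix.mul_smul, ← smul_sub, hx']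

/-- The even (block diagonal) complex supermatrices. -/
def evenMat (q : ℕ) : Submodule ℂ (SMat q ℂ) where
  carrier := {x | (∀ i j, x (Sum.inl i) (Sum.inr j) = 0) ∧ ∀ i j, x (Sum.inr i) (Sum.inl j) = 0}
  zero_mem' := by simp
  add_mem' := by
    rintro x y ⟨hx, hx'⟩ ⟨hy, hy'⟩
    exact ⟨fun i j => by simp [hx i j, hy i j], fun i j => by simp [hx' i j, hy' i j]⟩
  smul_mem' := by
    rintro c x ⟨hx, hx'⟩
    exact ⟨fun i j => by simp [hx i j], fun i j => by simp [hx' i j]⟩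

/-- The odd (block off-diagonal) complex supermatrices. -/
def oddMat (q : ℕ) : Submodule ℂ (SMat q ℂ) where
  carrier := {x | (∀ i j, x (Sum.inl i) (Sum.inl j) = 0) ∧ ∀ i j, x (Sum.inr i) (Sum.inr j) = 0}
  zero_mem' := by simp
  add_mem' := by
    rintro x y ⟨hx, hx'⟩ ⟨hy, hy'⟩
    exact ⟨fun i j => by simp [hx i j, hy i j], fun i j => by simp [hx' i j, hy' i j]⟩
  smul_mem' := by
    rintro c x ⟨hx, hx'⟩
    exact ⟨fun i j => by simp [hx i j], fun i j => by simp [hx' i j]⟩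

/-- The multiplicity `m_α = dim 𝔤^α_even - dim 𝔤^α_odd`. -/
def rootMult (q : ℕ) : ℤ :=
  (Module.finrank ℂ (rootSpace q ⊓ evenMat q : Submodule ℂ (SMat q ℂ)) : ℤ) -
    (Module.finrank ℂ (rootSpace q ⊓ oddMat q : Submodule ℂ (SMat q ℂ)) : ℤ)

/-- `ϱ = ½ m_α α`, identified with the number `ϱ(h₀)`; `α` is the only positive root. -/
def rho (q : ℕ) : ℝ := (rootMult q : ℝ) / 2

/-! ### The supergroups `G`, `K`, `M`, `A`, `N`, on superpoints -/

section Points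

variable (q : ℕ) (V : Type) [AddCommGroup V] [Module ℂ V]

/-- Even supermatrices over `⋀ V`: even entries in the diagonal blocks, odd entries in the
off-diagonal blocks. -/
def IsEvenSMat (x : SMat q (Gr V)) : Prop :=
  (∀ i j, x.toBlocks₁₁ i j ∈ parity V 0) ∧ (∀ i j, x.toBlocks₁₂ i j ∈ parity V 1) ∧
    (∀ i j, x.toBlocks₂₁ i j ∈ parity V 1) ∧ (∀ i j, x.toBlocks₂₂ i j ∈ parity V 0)

/-- The points of `G = SOSp⁺(1,1|2q)`: points of the complex orthosymplectic supergroup whose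
underlying matrix lies in `SO⁺(1,1) × USp(2q)`, where `SO⁺(1,1)` is the identity component of
`SO(1,1)`.  (The equations for the form `J` in these two groups are those of the first line.) -/
def ptsG : Set (SMat q (Gr V)) :=
  {g | IsEvenSMat q V g ∧ superTranspose g * formJ q (Gr V) * g = formJ q (Gr V) ∧
    (∃ a : Matrix (Fin 2) (Fin 2) ℝ,
      g.toBlocks₁₁.map body = a.map (fun r : ℝ => (r : ℂ)) ∧ a.det = 1 ∧ 0 < a 0 0) ∧
    g.toBlocks₂₂.map body ∈ Matrix.unitaryGroup (Fin 2 × Fin q) ℂ}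

/-- The points of `K = SOSp(1|2q)`, the fixed points of `θ` in `G`. -/
def ptsK : Set (SMat q (Gr V)) :=
  {g | g ∈ ptsG q V ∧ sigma q (Gr V) * g * sigma q (Gr V) = g}

/-- The points of `M`, the centraliser of `𝔞` in `K`. -/
def ptsM : Set (SMat q (Gr V)) :=
  {g | g ∈ ptsK q V ∧ g * hZero q (Gr V) = hZero q (Gr V) * g}

/-- The points of `N`: exponentials of the even supermatrices in `⋀ V ⊗ 𝔤^α` (which satisfy
`x³ = 0`). -/
def ptsN : Set (SMat q (Gr V)) :=
  {n | ∃ x : SMat q (Gr V), IsEvenSMat q V x ∧ IsOsp x ∧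
    hZero q (Gr V) * x - x * hZero q (Gr V) = x ∧ n = nilExp x}

/-- The points of the affine superspace of `𝔞_ℝ = ℝ h₀`: even superfunctions with real value. -/
def ptsa : Set (Gr V) := {h | h ∈ parity V 0 ∧ (body h).im = 0}

end Points

/-- The matrix exponential `e^{h h₀}`, namely `(cosh h, sinh h; sinh h, cosh h)` in the upper left
block and the identity in the lower right block (recall `h₀³ = h₀`). -/
def expA (q : ℕ) {V : Type} [AddCommGroup V] [Module ℂ V] (h : Gr V) : SMat q (Gr V) :=
  Matrix.fromBlocks
    !![(2⁻¹ : ℂ) • (grExp h + grExp (-h)), (2⁻¹ : ℂ) • (grExp h - grExp (-h));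
       (2⁻¹ : ℂ) • (grExp h - grExp (-h)), (2⁻¹ : ℂ) • (grExp h + grExp (-h))] 0 0 1

open Classical in
/-- The Iwasawa projection `H`: `g = k e^{H(g) h₀} n` with `k` in `K` and `n` in `N`. -/
def iwasawaH (q : ℕ) {V : Type} [AddCommGroup V] [Module ℂ V] (g : SMat q (Gr V)) : Gr V :=
  if hg : ∃ h ∈ ptsa V, ∃ k ∈ ptsK q V, ∃ n ∈ ptsN q V, g = k * expA q h * n
  then hg.choose else 0

/-! ### The superspace `K/M`, Berezinian densities and Berezin integrals -/

/-- The span of `n` odd coordinates `ξ_1, …, ξ_n`; the Grassmann algebra on it is the algebra of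
superfunctions on the affine superspace of dimension `0|n`. -/
abbrev Coord (n : ℕ) : Type := Fin n → ℂ

/-- `s`, a point of `K` over the affine superspace of dimension `0|2q`, is a global coordinate chart
of `K/M`: the induced morphism `y ↦ s(y)M` to `K/M` is an isomorphism, i.e. every point `k` of `K`
is congruent modulo `M` to `s(y)` for exactly one point `y` of the affine superspace.
(The space underlying `K/M` is a single point, so such charts are defined on all of `K/M`.) -/
def IsChart (q : ℕ) (s : SMat q (Gr (Coord (2 * q)))) : Prop :=
  s ∈ ptsK q (Coord (2 * q)) ∧
    ∀ (V : Type) [AddCommGroup V] [Module ℂ V] [FiniteDimensional ℂ V],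
      ∀ k ∈ ptsK q V, ∃! y : Gr (Coord (2 * q)) →ₐ[ℂ] Gr V,
        IsSuperHom y ∧ ∃ m ∈ ptsM q V, k = s.map y * m

/-- Successive left derivatives along odd directions, `d 0` being applied first. -/
def oddDerivs {U : Type} [AddCommGroup U] [Module ℂ U] {n : ℕ} (d : Fin n → Module.Dual ℂ U)
    (f : Gr U) : Gr U :=
  (List.finRange n).foldl
    (fun a i => CliffordAlgebra.contractLeft (Q := (0 : QuadraticForm ℂ U)) (d i) a) f

/-- The Berezin integral over the affine superspace of dimension `0|n`: the coefficient of
`ξ_1 ⋯ ξ_n`. -/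
def berezin {n : ℕ} (f : Gr (Coord n)) : ℂ :=
  body (oddDerivs (fun i => LinearMap.proj i) f)

/-- The Berezin fibre integral along the projection of `S × 𝔸^{0|n}` to `S`, where `S` is the
superpoint of `V`. -/
def berezinFibre (V : Type) [AddCommGroup V] [Module ℂ V] {n : ℕ} (f : Gr (V × Coord n)) : Gr V :=
  ExteriorAlgebra.map (LinearMap.fst ℂ V (Coord n))
    (oddDerivs (fun i => LinearMap.proj i ∘ₗ LinearMap.snd ℂ V (Coord n)) f)

/-- A Berezinian density on `K/M`, written `|Dξ| f` in a coordinate chart `ξ`. -/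
structure BerDensity (q : ℕ) where
  /-- the chart, as a parametrisation by a point of `K` -/
  chart : SMat q (Gr (Coord (2 * q)))
  isChart : IsChart q chart
  /-- the coefficient function `f` -/
  coeff : Gr (Coord (2 * q))

/-- `K`-invariance of the density `ω`: the integral of `f(gx)` against `ω(x)` over `K/M` is that of
`f(x)`, for all superfunctions `f` on `K/M` and all points `g` of `K` over superpoints `S`.  In the
chart `s`, the action of `g` is the morphism `y` from `S × 𝔸^{0|2q}` to `𝔸^{0|2q}` with
`g s(ξ) M = s(y) M`. -/
def BerDensity.IsInvariant {q : ℕ} (ω : BerDensity q) : Prop :=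
  ∀ (V : Type) [AddCommGroup V] [Module ℂ V] [FiniteDimensional ℂ V],
    ∀ g ∈ ptsK q V, ∀ y : Gr (Coord (2 * q)) →ₐ[ℂ] Gr (V × Coord (2 * q)), IsSuperHom y →
      ∀ m ∈ ptsM q (V × Coord (2 * q)),
        g.map (pullFst V (Coord (2 * q))) * ω.chart.map (pullSnd V (Coord (2 * q))) =
          ω.chart.map y * m →
        ∀ f : Gr (Coord (2 * q)),
          berezinFibre V (pullSnd V (Coord (2 * q)) ω.coeff * y f) =
            algebraMap ℂ (Gr V) (berezin (ω.coeff * f))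

/-- The spherical superfunction `φ_λ(g) = ∫_{K/M} |Dk̇| e^{(λ-ϱ)(H(gk))}` at a point `g` of `G` over
the superpoint of `V`.  The integrand is right `M`-invariant in `k`, so it is evaluated in the chart
of `K/M`. -/
def sphericalFn {q : ℕ} (ω : BerDensity q) (lam : ℂ) {V : Type} [AddCommGroup V] [Module ℂ V]
    (g : SMat q (Gr V)) : Gr V :=
  berezinFibre V
    (pullSnd V (Coord (2 * q)) ω.coeff *
      grExp ((lam - (rho q : ℂ)) •
        iwasawaH q (g.map (pullFst V (Coord (2 * q))) *
          ω.chart.map (pullSnd V (Coord (2 * q))))))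

/-- The value `φ_λ(e^{t h₀})` at the ordinary point `e^{t h₀}`, `t` real; ordinary points are points
over the superpoint of dimension `0|0`. -/
def sphericalAt {q : ℕ} (ω : BerDensity q) (lam : ℂ) (t : ℝ) : ℂ :=
  body (sphericalFn ω lam (V := Coord 0) (expA q (algebraMap ℂ (Gr (Coord 0)) (t : ℂ))))

end OrthoSymplectic

end

noncomputable section

namespace OrthoSymplectic

/-! ### Parity in Grassmann algebras -/

section Grassmann

variable {V W U : Type} [AddCommGroup V] [Module ℂ V] [AddCommGroup W] [Module ℂ W]
  [AddCommGroup U] [Module ℂ U]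

/-! The homogeneous space K/M is an odd sphere. A point of K fixes the first basis vector
(`mem_ptsK_iff`). Modulo M it is determined by its column of index `inl 1`, which consists of an
even entry b of value 1 and of 2q odd entries ξ with b² + τ(ξ) = 1, where τ is the symplectic
quadratic form. Square roots of value 1 are unique, so b = √(1 - τ), and the ξ are global
coordinates on K/M (`isChart_of_col`).

The invariant density is |Dξ| / b. The group K is generated by M and by elementary points, which
move a single coordinate by ηb with η odd (`ptsK_induction`). An elementary point acts through the
vector field b∂, and the weight 1/b turns this into a pure derivative, whose Berezin integral is
zero. M acts linearly and can change the integral only by a factor; the factor is 1, because τ^q is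
fixed and has non-zero integral. Conversely, invariance under the elementary points alone determines
a density up to a constant (`BerDensity.IsInvariant.eq_smul`), so an arbitrary chart and an
arbitrary non-zero invariant density reduce to the standard ones.

The sum of the first two basis vectors is fixed by N and scaled by e^h under A, and K fixes the
first row. Hence e^{H(g)} is the sum of the first two entries of the first row of g. On e^{th₀}k
this is cosh t + b sinh t = e^t (1 + r(b - 1)) with r = (1 - e^{-2t})/2 (`iwasawaH_spec`). Since b -
1 is a multiple of τ, its (q+1)-st power vanishes, the complex power λ - ϱ is a finite binomial sum,
and φ_λ is a combination of the moments m_j = ∫ b⁻¹(b - 1)^j (`sphericalAt_eq`).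

Integrating Euler's operator gives (2q - j) m_{j+1} = -2(q - j) m_j, so m_j is proportional to
(-2)^j binom(2q - j, q); the factor is non-zero because m_q is a non-zero multiple of ∫ τ^q.
Vandermonde's identity rearranges the sum in powers of e^{-2t} (`sum_choose_identity`). As t → ∞
only the constant term survives, and it contains binom(q - λ, q) = (-1)^q/q! · Γ(λ)/Γ(λ - q).
Finally ϱ = -q, because the root space is purely odd of dimension 2q. -/

theorem ι_mem_parity (v : V) : ExteriorAlgebra.ι ℂ v ∈ parity V 1 :=
  CliffordAlgebra.ι_mem_evenOdd_one _ v

theorem algebraMap_mem_parity (c : ℂ) : algebraMap ℂ (Gr V) c ∈ parity V 0 :=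
  SetLike.algebraMap_mem_graded (CliffordAlgebra.evenOdd (0 : QuadraticForm ℂ V)) c

theorem one_mem_parity : (1 : Gr V) ∈ parity V 0 := by
  simpa using algebraMap_mem_parity (V := V) 1

theorem mul_mem_parity {i j : ZMod 2} {a b : Gr V} (ha : a ∈ parity V i) (hb : b ∈ parity V j) :
    a * b ∈ parity V (i + j) :=
  SetLike.mul_mem_graded (A := CliffordAlgebra.evenOdd (0 : QuadraticForm ℂ V)) ha hb

theorem even_mul_even {a b : Gr V} (ha : a ∈ parity V 0) (hb : b ∈ parity V 0) :
    a * b ∈ parity V 0 := by simpa using mul_mem_parity ha hb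

theorem even_mul_odd {a b : Gr V} (ha : a ∈ parity V 0) (hb : b ∈ parity V 1) :
    a * b ∈ parity V 1 := by simpa using mul_mem_parity ha hb

theorem odd_mul_even {a b : Gr V} (ha : a ∈ parity V 1) (hb : b ∈ parity V 0) :
    a * b ∈ parity V 1 := by simpa using mul_mem_parity ha hb

theorem odd_mul_odd {a b : Gr V} (ha : a ∈ parity V 1) (hb : b ∈ parity V 1) :
    a * b ∈ parity V 0 := by
  have := mul_mem_parity ha hb
  rwa [show (1 : ZMod 2) + 1 = 0 from rfl] at this

theorem pow_mem_parity {a : Gr V} (ha : a ∈ parity V 0) (n : ℕ) : a ^ n ∈ parity V 0 := by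
  induction n with
  | zero => simpa using one_mem_parity
  | succ n ih => rw [pow_succ]; exact even_mul_even ih ha

theorem ι_mul_ι_swap (v w : V) :
    ExteriorAlgebra.ι ℂ v * ExteriorAlgebra.ι ℂ w =
      -(ExteriorAlgebra.ι ℂ w * ExteriorAlgebra.ι ℂ v) :=
  eq_neg_of_add_eq_zero_left (ExteriorAlgebra.ι_add_mul_swap v w)

theorem commute_ι_mul_ι (v w : V) (b : Gr V) :
    Commute (ExteriorAlgebra.ι ℂ v * ExteriorAlgebra.ι ℂ w) b := by
  induction b using ExteriorAlgebra.induction with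
  | algebraMap r => exact (Algebra.commutes r _).symm
  | ι x =>
    change _ * _ = _ * _
    rw [mul_assoc, ι_mul_ι_swap w x, mul_neg, ← mul_assoc, ι_mul_ι_swap v x, neg_mul, neg_neg,
      mul_assoc]
  | mul a b ha hb => exact ha.mul_right hb
  | add a b ha hb => exact ha.add_right hb

theorem even_commute {a : Gr V} (ha : a ∈ parity V 0) (b : Gr V) : Commute a b := by
  induction a, ha using CliffordAlgebra.even_induction with
  | algebraMap r => exact Algebra.commutes r _
  | add x y hx hy ihx ihy => exact ihx.add_left ihy
  | ι_mul_ι_mul v w x hx ih => exact (commute_ι_mul_ι v w b).mul_left ih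

theorem odd_mul_odd_swap {a b : Gr V} (ha : a ∈ parity V 1) (hb : b ∈ parity V 1) :
    a * b = -(b * a) := by
  induction a, ha using CliffordAlgebra.odd_induction with
  | ι v =>
    induction b, hb using CliffordAlgebra.odd_induction with
    | ι w => exact ι_mul_ι_swap v w
    | add x y hx hy ihx ihy => rw [mul_add, ihx, ihy, add_mul, neg_add]
    | ι_mul_ι_mul u w x hx ih =>
      have h := (commute_ι_mul_ι u w (ExteriorAlgebra.ι ℂ v)).eq
      change ExteriorAlgebra.ι ℂ v * (ExteriorAlgebra.ι ℂ u * ExteriorAlgebra.ι ℂ w * x) =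
        -(ExteriorAlgebra.ι ℂ u * ExteriorAlgebra.ι ℂ w * x * ExteriorAlgebra.ι ℂ v)
      rw [← mul_assoc, ← h, mul_assoc, mul_assoc _ x, ← mul_neg]
      exact congrArg _ ih
  | add x y hx hy ihx ihy => rw [add_mul, ihx, ihy, mul_add, neg_add]
  | ι_mul_ι_mul u w x hx ih =>
    have h := (commute_ι_mul_ι u w b).eq
    change ExteriorAlgebra.ι ℂ u * ExteriorAlgebra.ι ℂ w * x * b =
      -(b * (ExteriorAlgebra.ι ℂ u * ExteriorAlgebra.ι ℂ w * x))
    rw [← mul_assoc b, ← h, mul_assoc, ih, mul_neg, mul_assoc _ b]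

theorem odd_sq {a : Gr V} (ha : a ∈ parity V 1) : a * a = 0 := by
  have h := odd_mul_odd_swap ha ha
  have h2 : (2 : ℂ) • (a * a) = 0 := by
    rw [two_smul]; nth_rewrite 1 [h]; exact neg_add_cancel _
  exact (smul_eq_zero.mp h2).resolve_left two_ne_zero

theorem body_algebraMap (c : ℂ) : body (algebraMap ℂ (Gr V) c) = c :=
  (body (V := V)).commutes c

theorem body_ι (v : V) : body (ExteriorAlgebra.ι ℂ v) = 0 := by
  simp [body, ExteriorAlgebra.algebraMapInv]

theorem body_odd {a : Gr V} (ha : a ∈ parity V 1) : body a = 0 := by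
  induction a, ha using CliffordAlgebra.odd_induction with
  | ι v => exact body_ι v
  | add x y hx hy ihx ihy => rw [map_add, ihx, ihy, add_zero]
  | ι_mul_ι_mul u w x hx ih => rw [map_mul, ih, mul_zero]

theorem isNilpotent_sub_body {a : Gr V} (ha : a ∈ parity V 0) :
    IsNilpotent (a - algebraMap ℂ (Gr V) (body a)) := by
  induction a, ha using CliffordAlgebra.even_induction with
  | algebraMap r =>
    have h : algebraMap ℂ (Gr V) r - algebraMap ℂ (Gr V) (body (algebraMap ℂ (Gr V) r)) = 0 := by
      rw [body_algebraMap, sub_self]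
    exact ⟨1, by rw [pow_one]; exact h⟩
  | add x y hx hy ihx ihy =>
    have e : x + y - algebraMap ℂ (Gr V) (body (x + y)) =
        (x - algebraMap ℂ (Gr V) (body x)) + (y - algebraMap ℂ (Gr V) (body y)) := by
      rw [map_add, map_add]; abel
    rw [e]
    exact (even_commute (sub_mem hx (algebraMap_mem_parity _)) _).isNilpotent_add ihx ihy
  | ι_mul_ι_mul v w x hx ih =>
    have e : body (ExteriorAlgebra.ι ℂ v * ExteriorAlgebra.ι ℂ w * x) = 0 := by
      rw [map_mul, map_mul, body_ι, zero_mul, zero_mul]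
    change IsNilpotent (ExteriorAlgebra.ι ℂ v * ExteriorAlgebra.ι ℂ w * x -
      algebraMap ℂ (Gr V) (body (ExteriorAlgebra.ι ℂ v * ExteriorAlgebra.ι ℂ w * x)))
    rw [e, map_zero, sub_zero]
    refine (commute_ι_mul_ι v w x).isNilpotent_mul_right ⟨2, ?_⟩
    rw [pow_two, mul_assoc, ← mul_assoc (ExteriorAlgebra.ι ℂ w), ι_mul_ι_swap w v, neg_mul, mul_neg,
      mul_assoc, ExteriorAlgebra.ι_sq_zero, mul_zero, mul_zero, neg_zero]

theorem isNilpotent_of_body_eq_zero {a : Gr V} (ha : a ∈ parity V 0) (h : body a = 0) :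
    IsNilpotent a := by
  simpa [h] using isNilpotent_sub_body ha

theorem isUnit_of_body_ne_zero {a : Gr V} (ha : a ∈ parity V 0) (h : body a ≠ 0) : IsUnit a := by
  have hu : IsUnit (algebraMap ℂ (Gr V) (body a)) := (IsUnit.mk0 _ h).map (algebraMap ℂ (Gr V))
  have := IsNilpotent.isUnit_add_left_of_commute (isNilpotent_sub_body ha) hu
    ((Algebra.commutes _ _).symm)
  simpa using this

/-- The grading automorphism fixes a, hence also its inverse, and this kills the odd part of the
inverse because 2 is invertible. -/
theorem exists_even_inverse {a : Gr V} (ha : a ∈ parity V 0) (h : body a ≠ 0) :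
    ∃ b ∈ parity V 0, a * b = 1 ∧ b * a = 1 := by
  obtain ⟨u, rfl⟩ := isUnit_of_body_ne_zero ha h
  have hinv : CliffordAlgebra.involute (Q := (0 : QuadraticForm ℂ V)) (↑u⁻¹ : Gr V) = ↑u⁻¹ := by
    have h1 : CliffordAlgebra.involute (Q := (0 : QuadraticForm ℂ V)) (↑u⁻¹ : Gr V) * (u : Gr V)
        = 1 := by
      have := congrArg (CliffordAlgebra.involute (Q := (0 : QuadraticForm ℂ V))) u.inv_mul
      rwa [map_mul, map_one, CliffordAlgebra.involute_eq_of_mem_even ha] at this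
    calc _ = CliffordAlgebra.involute (Q := (0 : QuadraticForm ℂ V)) (↑u⁻¹ : Gr V) *
            ((u : Gr V) * ↑u⁻¹) := by rw [u.mul_inv, mul_one]
      _ = _ := by rw [← mul_assoc, h1, one_mul]
  refine ⟨↑u⁻¹, ?_, u.mul_inv, u.inv_mul⟩
  have htop : (↑u⁻¹ : Gr V) ∈ parity V 0 ⊔ parity V 1 := by
    have := (CliffordAlgebra.evenOdd_isCompl (0 : QuadraticForm ℂ V)).sup_eq_top
    rw [parity, parity, this]; trivial
  obtain ⟨x, hx, y, hy, hxy⟩ := Submodule.mem_sup.mp htop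
  rw [← hxy, map_add, CliffordAlgebra.involute_eq_of_mem_even hx,
    CliffordAlgebra.involute_eq_of_mem_odd hy] at hinv
  have hy0 : (2 : ℂ) • y = 0 := by
    rw [two_smul]
    have := add_left_cancel hinv
    nth_rewrite 1 [← this]; exact neg_add_cancel y
  rw [← hxy, (smul_eq_zero.mp hy0).resolve_left two_ne_zero, add_zero]; exact hx

/-- A square root with value `1` is unique. -/
theorem even_sqrt_unique {a b : Gr V} (ha : a ∈ parity V 0) (hb : b ∈ parity V 0)
    (ha1 : body a = 1) (hb1 : body b = 1) (h : a * a = b * b) : a = b := by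
  -- The factor a + b in (a + b)(a - b) = 0 has value 2 and is therefore a unit.
  obtain ⟨c, -, -, hc⟩ := exists_even_inverse (add_mem ha hb)
    (by rw [map_add, ha1, hb1]; norm_num : body (a + b) ≠ 0)
  have h0 : (a + b) * (a - b) = 0 := by
    rw [add_mul, mul_sub, mul_sub, h, (even_commute ha b).eq]; abel
  have : c * ((a + b) * (a - b)) = 0 := by rw [h0, mul_zero]
  rw [← mul_assoc, hc, one_mul] at this
  exact sub_eq_zero.mp this

/-- The grading automorphism. -/
abbrev inv (V : Type) [AddCommGroup V] [Module ℂ V] : Gr V →ₐ[ℂ] Gr V :=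
  CliffordAlgebra.involute (Q := (0 : QuadraticForm ℂ V))

theorem inv_ι (v : V) : inv V (ExteriorAlgebra.ι ℂ v) = -ExteriorAlgebra.ι ℂ v :=
  CliffordAlgebra.involute_ι v

theorem inv_inv (a : Gr V) : inv V (inv V a) = a := CliffordAlgebra.involute_involute a

theorem inv_even {a : Gr V} (ha : a ∈ parity V 0) : inv V a = a :=
  CliffordAlgebra.involute_eq_of_mem_even ha

theorem inv_odd {a : Gr V} (ha : a ∈ parity V 1) : inv V a = -a :=
  CliffordAlgebra.involute_eq_of_mem_odd ha

theorem odd_mul {a : Gr V} (ha : a ∈ parity V 1) (b : Gr V) : a * b = inv V b * a := by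
  induction b using ExteriorAlgebra.induction with
  | algebraMap r => rw [AlgHom.commutes]; exact (Algebra.commutes r _).symm
  | ι x => rw [inv_ι, neg_mul]; exact odd_mul_odd_swap ha (ι_mem_parity x)
  | mul x y hx hy => rw [map_mul, ← mul_assoc, hx, mul_assoc, hy, mul_assoc]
  | add x y hx hy => rw [mul_add, hx, hy, map_add, add_mul]

/-! ### Morphisms of superpoints -/

theorem isSuperHom_of_ι {φ : Gr V →ₐ[ℂ] Gr W}
    (h : ∀ v, φ (ExteriorAlgebra.ι ℂ v) ∈ parity W 1) : IsSuperHom φ := by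
  intro i a ha
  fin_cases i
  · induction a, ha using CliffordAlgebra.even_induction with
    | algebraMap r => exact (φ.commutes r).symm ▸ algebraMap_mem_parity r
    | add x y hx hy ihx ihy => rw [map_add]; exact add_mem ihx ihy
    | ι_mul_ι_mul v w x hx ih =>
      rw [map_mul, map_mul]
      exact even_mul_even (odd_mul_odd (h v) (h w)) ih
  · induction a, ha using CliffordAlgebra.odd_induction with
    | ι v => exact h v
    | add x y hx hy ihx ihy => rw [map_add]; exact add_mem ihx ihy
    | ι_mul_ι_mul v w x hx ih =>
      rw [map_mul, map_mul]
      exact even_mul_odd (odd_mul_odd (h v) (h w)) ih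

theorem IsSuperHom.comp {φ : Gr V →ₐ[ℂ] Gr W} {ψ : Gr U →ₐ[ℂ] Gr V} (hφ : IsSuperHom φ)
    (hψ : IsSuperHom ψ) : IsSuperHom (φ.comp ψ) :=
  fun i a ha => hφ i _ (hψ i a ha)

theorem isSuperHom_id : IsSuperHom (AlgHom.id ℂ (Gr V)) := fun _ _ h => h

theorem isSuperHom_map (f : V →ₗ[ℂ] W) : IsSuperHom (ExteriorAlgebra.map f) :=
  isSuperHom_of_ι fun v => by rw [ExteriorAlgebra.map_apply_ι]; exact ι_mem_parity _

theorem isSuperHom_pullFst : IsSuperHom (pullFst V W) := isSuperHom_map _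

theorem isSuperHom_pullSnd : IsSuperHom (pullSnd V W) := isSuperHom_map _

theorem IsSuperHom.body_apply {φ : Gr V →ₐ[ℂ] Gr W} (hφ : IsSuperHom φ) (a : Gr V) :
    body (φ a) = body a := by
  have : (body (V := W)).comp φ = body := by
    ext v
    change body (φ (ExteriorAlgebra.ι ℂ v)) = body (ExteriorAlgebra.ι ℂ v)
    rw [body_ι, body_odd (hφ 1 _ (ι_mem_parity v))]
  exact DFunLike.congr_fun this a

theorem IsSuperHom.inv_apply {φ : Gr V →ₐ[ℂ] Gr W} (hφ : IsSuperHom φ) (a : Gr V) :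
    φ (inv V a) = inv W (φ a) := by
  have : φ.comp (inv V) = (inv W).comp φ := by
    ext v
    change φ (inv V (ExteriorAlgebra.ι ℂ v)) = inv W (φ (ExteriorAlgebra.ι ℂ v))
    rw [inv_ι, map_neg, inv_odd (hφ 1 _ (ι_mem_parity v))]
  exact DFunLike.congr_fun this a

/-- The `i`-th odd coordinate. -/
def oddCoord {n : ℕ} (i : Fin n) : Gr (Coord n) := ExteriorAlgebra.ι ℂ (Pi.single i 1)

theorem oddCoord_mem {n : ℕ} (i : Fin n) : oddCoord i ∈ parity (Coord n) 1 := ι_mem_parity _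

theorem ι_eq_sum {n : ℕ} (v : Coord n) : ExteriorAlgebra.ι ℂ v = ∑ i, v i • oddCoord i := by
  conv_lhs => rw [pi_eq_sum_univ' v]
  rw [map_sum]
  refine Finset.sum_congr rfl fun i _ => ?_
  rw [map_smul, oddCoord]

theorem coord_hom_ext {n : ℕ} {A : Type} [Ring A] [Algebra ℂ A] {φ ψ : Gr (Coord n) →ₐ[ℂ] A}
    (h : ∀ i, φ (oddCoord i) = ψ (oddCoord i)) : φ = ψ := by
  ext v
  exact h v

theorem coordLift_sq {n : ℕ} (x : Fin n → Gr V) (hx : ∀ i, x i ∈ parity V 1) (v : Coord n) :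
    Fintype.linearCombination ℂ x v * Fintype.linearCombination ℂ x v = 0 :=
  odd_sq (by
    rw [Fintype.linearCombination_apply]
    exact sum_mem fun i _ => Submodule.smul_mem _ _ (hx i))

/-- The morphism to `𝔸^{0|n}` with prescribed odd components. -/
def coordLift {n : ℕ} (x : Fin n → Gr V) (hx : ∀ i, x i ∈ parity V 1) :
    Gr (Coord n) →ₐ[ℂ] Gr V :=
  ExteriorAlgebra.lift ℂ ⟨Fintype.linearCombination ℂ x, coordLift_sq x hx⟩

theorem coordLift_oddCoord {n : ℕ} (x : Fin n → Gr V) (hx : ∀ i, x i ∈ parity V 1) (i : Fin n) :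
    coordLift x hx (oddCoord i) = x i := by
  rw [coordLift, oddCoord, ExteriorAlgebra.lift_ι_apply]
  simp

theorem isSuperHom_coordLift {n : ℕ} (x : Fin n → Gr V) (hx : ∀ i, x i ∈ parity V 1) :
    IsSuperHom (coordLift x hx) :=
  isSuperHom_of_ι fun v => by
    rw [ι_eq_sum, map_sum]
    refine sum_mem fun i _ => ?_
    rw [map_smul, coordLift_oddCoord]
    exact Submodule.smul_mem _ _ (hx i)

instance finite_gr [FiniteDimensional ℂ V] : Module.Finite ℂ (Gr V) :=
  Module.Finite.of_basis (Module.finBasis ℂ V).ExteriorAlgebra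

/-- The entries do not commute, so determinants are not available. Finite dimension makes the matrix
ring Artinian, and there one-sided inverses are two-sided. -/
theorem mat_mul_eq_one_comm [FiniteDimensional ℂ V] {n : Type} [Fintype n] [DecidableEq n]
    {a b : Matrix n n (Gr V)} (h : a * b = 1) : b * a = 1 := by
  have : IsArtinianRing (Matrix n n (Gr V)) := IsArtinianRing.of_finite ℂ _
  exact mul_eq_one_comm.mp h

end Grassmann

/-! ### Exponentials of nilpotent elements -/

section NilExp

variable {A B : Type} [Ring A] [Algebra ℂ A] [Ring B] [Algebra ℂ B]

theorem nilExp_eq_sum {a : A} {k : ℕ} (h : a ^ k = 0) :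
    nilExp a = ∑ i ∈ Finset.range k, ((i.factorial : ℂ)⁻¹) • a ^ i := by
  let : Module ℚ A := Module.compHom A (algebraMap ℚ ℂ)
  have := IsNilpotent.exp_eq_sum (A := A) h
  rw [nilExp, this]
  refine Finset.sum_congr rfl fun i _ => ?_
  change (algebraMap ℚ ℂ ((i.factorial : ℚ)⁻¹)) • a ^ i = _
  simp

theorem nilExp_add {a b : A} (h : Commute a b) (ha : IsNilpotent a) (hb : IsNilpotent b) :
    nilExp (a + b) = nilExp a * nilExp b := by
  let : Module ℚ A := Module.compHom A (algebraMap ℚ ℂ)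
  exact IsNilpotent.exp_add_of_commute h ha hb

theorem nilExp_zero : nilExp (0 : A) = 1 := by
  let : Module ℚ A := Module.compHom A (algebraMap ℚ ℂ)
  exact IsNilpotent.exp_zero

theorem nilExp_mul_neg {a : A} (ha : IsNilpotent a) : nilExp a * nilExp (-a) = 1 := by
  rw [← nilExp_add (Commute.neg_right (Commute.refl a)) ha ha.neg, add_neg_cancel, nilExp_zero]

theorem map_nilExp (φ : A →ₐ[ℂ] B) {a : A} (ha : IsNilpotent a) :
    φ (nilExp a) = nilExp (φ a) := by
  obtain ⟨k, hk⟩ := ha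
  rw [nilExp_eq_sum hk, nilExp_eq_sum (k := k) (by rw [← map_pow, hk, map_zero]), map_sum]
  simp only [map_smul, map_pow]

theorem nilExp_nsmul {a : A} (ha : IsNilpotent a) (n : ℕ) : nilExp (n • a) = nilExp a ^ n := by
  induction n with
  | zero => rw [zero_smul, nilExp_zero, pow_zero]
  | succ n ih =>
    rw [succ_nsmul, nilExp_add ((Commute.refl a).smul_left n) (ha.smul n) ha, ih, pow_succ]

theorem nilExp_mem (S : Subalgebra ℂ A) {a : A} (ha : IsNilpotent a) (h : a ∈ S) :
    nilExp a ∈ S := by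
  obtain ⟨k, hk⟩ := ha
  rw [nilExp_eq_sum hk]
  exact sum_mem fun i _ => S.smul_mem (pow_mem h i) _

theorem commute_of_mem_adjoin {x a b : A} (ha : a ∈ Algebra.adjoin ℂ {x})
    (hb : b ∈ Algebra.adjoin ℂ {x}) : Commute a b := by
  have := Algebra.isMulCommutative_adjoin ℂ (s := {x}) (by rintro a rfl b rfl; rfl)
  exact congrArg Subtype.val (mul_comm' (⟨a, ha⟩ : Algebra.adjoin ℂ {x}) ⟨b, hb⟩)

/-- Isolating the terms of order at least two shows that (1 + x)e^{-x} differs from 1 by a multiple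
of x²; the remainder is kept inside the commutative algebra generated by x. -/
theorem exists_nilExp_neg_eq {x : A} {n : ℕ} (h : x ^ n = 0) :
    ∃ s ∈ Algebra.adjoin ℂ {x}, nilExp (-x) = 1 - x + x ^ 2 * s := by
  have hx : x ∈ Algebra.adjoin ℂ {x} := Algebra.self_mem_adjoin_singleton ℂ x
  have h' : (-x) ^ (n + 2) = 0 := by rw [neg_pow, pow_add x, h, zero_mul, mul_zero]
  refine ⟨∑ i ∈ Finset.range n, (((i + 2).factorial : ℂ)⁻¹) • (-x) ^ i,
    sum_mem fun i _ => Subalgebra.smul_mem _ (pow_mem (neg_mem hx) i) _, ?_⟩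
  rw [nilExp_eq_sum h', Finset.sum_range_succ', Finset.sum_range_succ']
  have : ∀ i, (-x) ^ (i + 1 + 1) = x ^ 2 * (-x) ^ i := fun i => by
    rw [add_assoc, add_comm i, pow_add, neg_sq]
  simp only [this, Finset.mul_sum, mul_smul_comm, add_assoc, Nat.reduceAdd]
  simp
  abel

/-- Unipotent elements have a logarithm. -/
theorem exists_nilExp_eq {x : A} {n : ℕ} (h : x ^ n = 0) :
    ∃ N ∈ Algebra.adjoin ℂ {x}, IsNilpotent N ∧ nilExp N = 1 + x := by
  induction n generalizing x with
  | zero =>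
    rw [pow_zero] at h
    have hs : ∀ y : A, y = 0 := fun y => by rw [← mul_one y, h, mul_zero]
    exact ⟨0, zero_mem _, IsNilpotent.zero, by rw [hs (1 + x), hs (nilExp 0)]⟩
  | succ n ih =>
    have hx : x ∈ Algebra.adjoin ℂ {x} := Algebra.self_mem_adjoin_singleton ℂ x
    have hnx : IsNilpotent x := ⟨_, h⟩
    by_cases hn : n = 0
    · subst hn
      have : x = 0 := by simpa using h
      subst this
      exact ⟨0, zero_mem _, IsNilpotent.zero, by rw [nilExp_zero, add_zero]⟩
    · obtain ⟨s, hs, hs'⟩ := exists_nilExp_neg_eq h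
      have hcs : Commute x s := commute_of_mem_adjoin hx hs
      set r := -1 + s + x * s with hr
      have hrm : r ∈ Algebra.adjoin ℂ {x} :=
        add_mem (add_mem (neg_mem (one_mem _)) hs) (mul_mem hx hs)
      -- Dividing by e^x replaces x by x²r. Its n-th power contains x^{2n}, which vanishes since 2n
      -- ≥ n + 1 for n ≥ 1. The induction therefore descends, and the logarithm is x plus that of
      -- the new element.
      have hy : (1 + x) * nilExp (-x) = 1 + x ^ 2 * r := by
        rw [hs', hr]; noncomm_ring
      have hyn : (x ^ 2 * r) ^ n = 0 := by
        rw [((commute_of_mem_adjoin hx hrm).pow_left 2).mul_pow, ← pow_mul,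
          show 2 * n = (n + 1) + (n - 1) by omega, pow_add, h, zero_mul, zero_mul]
      obtain ⟨N, hN, hNn, hNe⟩ := ih hyn
      have hsub : Algebra.adjoin ℂ {x ^ 2 * r} ≤ Algebra.adjoin ℂ {x} :=
        Algebra.adjoin_le (by
          rintro _ rfl; exact mul_mem (pow_mem hx 2) hrm)
      have hN' := hsub hN
      have hc : Commute x N := commute_of_mem_adjoin hx hN'
      refine ⟨x + N, add_mem hx hN', hc.isNilpotent_add hnx hNn, ?_⟩
      rw [nilExp_add hc hnx hNn, hNe, ← hy, ← mul_assoc,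
        (commute_of_mem_adjoin (nilExp_mem _ hnx hx) (add_mem (one_mem _) hx) : Commute _ (1 + x)).eq,
        mul_assoc, nilExp_mul_neg hnx, mul_one]

open Polynomial in
-- Polynomial dependence on μ is what allows identities in complex exponents to be checked on
-- natural numbers.
theorem ring_choose_eq_eval (j : ℕ) :
    ∃ p : ℂ[X], ∀ μ : ℂ, Ring.choose μ j = p.eval μ := by
  refine ⟨C ((j.factorial : ℂ)⁻¹) * descPochhammer ℂ j, fun μ => ?_⟩
  rw [Ring.choose_eq_smul, eval_mul, eval_C, smul_eq_mul,
    ← Polynomial.aeval_eq_smeval, ← descPochhammer_map (Int.castRingHom ℂ) j, eval_map]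
  simp [Polynomial.aeval_def]

open Polynomial in
/-- The binomial series for complex powers of a unipotent element. -/
theorem nilExp_smul_eq_sum {N : A} (hN : IsNilpotent N) {X : A} (hX : nilExp N = 1 + X) {k : ℕ}
    (hk : X ^ k = 0) (μ : ℂ) :
    nilExp (μ • N) = ∑ j ∈ Finset.range k, Ring.choose μ j • X ^ j := by
  obtain ⟨m, hm⟩ := hN
  -- After applying a linear functional, the difference of the two sides is a polynomial P in μ. It
  -- vanishes at every natural number by the ordinary binomial theorem, hence identically.
  rw [← sub_eq_zero, ← Module.forall_dual_apply_eq_zero_iff ℂ]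
  intro ℓ
  choose p hp using ring_choose_eq_eval
  set P : ℂ[X] := (∑ i ∈ Finset.range m, C ((i.factorial : ℂ)⁻¹ * ℓ (N ^ i)) * Polynomial.X ^ i) -
    ∑ j ∈ Finset.range k, C (ℓ (X ^ j)) * p j with hP
  have hev : ∀ ν : ℂ, ℓ (nilExp (ν • N) - ∑ j ∈ Finset.range k, Ring.choose ν j • X ^ j) =
      P.eval ν := by
    intro ν
    rw [nilExp_eq_sum (k := m) (by rw [_root_.smul_pow, hm, smul_zero]), map_sub, map_sum, map_sum, hP,
      eval_sub, eval_finsetSum, eval_finsetSum]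
    congr 1
    · refine Finset.sum_congr rfl fun i _ => ?_
      simp only [_root_.smul_pow, map_smul, smul_eq_mul, eval_mul, eval_C, eval_pow, eval_X]
      ring
    · refine Finset.sum_congr rfl fun j _ => ?_
      rw [map_smul, smul_eq_mul, eval_mul, eval_C, hp, mul_comm]
  rw [hev]
  have hP0 : P = 0 := by
    refine Polynomial.eq_zero_of_infinite_isRoot P
      ((Set.infinite_range_of_injective (Nat.cast_injective (R := ℂ))).mono ?_)
    rintro _ ⟨n, rfl⟩
    change P.eval (n : ℂ) = 0
    rw [← hev, Nat.cast_smul_eq_nsmul, nilExp_nsmul ⟨m, hm⟩, hX, add_comm,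
      (Commute.one_right X).add_pow]
    -- Both sums are extended to a common range: beyond n the binomial coefficients vanish, and from
    -- k on the powers of X do.
    have h1 : ∑ j ∈ Finset.range (n + 1), X ^ j * 1 ^ (n - j) * (n.choose j : A) =
        ∑ j ∈ Finset.range (max k (n + 1)), Ring.choose (n : ℂ) j • X ^ j := by
      refine (Finset.sum_congr rfl fun j _ => ?_).trans
        (Finset.sum_subset (Finset.range_mono (le_max_right k (n + 1))) fun j _ hj => ?_)
      · rw [Ring.choose_natCast, one_pow, mul_one, Nat.cast_smul_eq_nsmul, nsmul_eq_mul,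
          Nat.cast_comm]
      · rw [Ring.choose_natCast, Nat.choose_eq_zero_of_lt (by simpa using hj), Nat.cast_zero,
          zero_smul]
    have h2 : ∑ j ∈ Finset.range k, Ring.choose (n : ℂ) j • X ^ j =
        ∑ j ∈ Finset.range (max k (n + 1)), Ring.choose (n : ℂ) j • X ^ j := by
      refine Finset.sum_subset (Finset.range_mono (le_max_left k (n + 1))) fun j _ hj => ?_
      rw [← Nat.add_sub_cancel' (by simpa using hj : k ≤ j), pow_add, hk, zero_mul, smul_zero]
    rw [h1, h2, sub_self, map_zero]
  rw [hP0, eval_zero]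

end NilExp

/-! ### The exponential of a superfunction -/

section GrExp

variable {V W : Type} [AddCommGroup V] [Module ℂ V] [AddCommGroup W] [Module ℂ W]

theorem nilExp_mem_parity {a : Gr V} (ha : a ∈ parity V 0) (hn : IsNilpotent a) :
    nilExp a ∈ parity V 0 :=
  nilExp_mem (CliffordAlgebra.even (0 : QuadraticForm ℂ V)) hn ha

theorem body_nilpotent {a : Gr V} (hn : IsNilpotent a) : body a = 0 :=
  (hn.map (body (V := V))).eq_zero

theorem body_nilExp {a : Gr V} (hn : IsNilpotent a) : body (nilExp a) = 1 := by
  rw [map_nilExp _ hn, body_nilpotent hn, nilExp_zero]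

/-- Even superfunctions with value `1` have an even nilpotent logarithm. -/
theorem exists_even_log {x : Gr V} (hx : x ∈ parity V 0) (h : body x = 1) :
    ∃ N ∈ parity V 0, IsNilpotent N ∧ nilExp N = x := by
  have hx1 : x - 1 ∈ parity V 0 := sub_mem hx one_mem_parity
  obtain ⟨n, hn⟩ := isNilpotent_of_body_eq_zero hx1 (by rw [map_sub, map_one, h, sub_self])
  obtain ⟨N, hN, hNn, hNe⟩ := exists_nilExp_eq hn
  refine ⟨N, ?_, hNn, by rw [hNe]; abel⟩
  exact (Algebra.adjoin_le (S := CliffordAlgebra.even (0 : QuadraticForm ℂ V)) (by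
    rintro _ rfl; exact hx1)) hN

theorem exists_even_sqrt {x : Gr V} (hx : x ∈ parity V 0) (h : body x = 1) :
    ∃ b ∈ parity V 0, body b = 1 ∧ b * b = x := by
  obtain ⟨N, hN, hNn, hNe⟩ := exists_even_log hx h
  have hn := hNn.smul (2⁻¹ : ℂ)
  refine ⟨nilExp ((2⁻¹ : ℂ) • N), nilExp_mem_parity (Submodule.smul_mem _ _ hN) hn,
    body_nilExp hn, ?_⟩
  rw [← nilExp_add (Commute.refl _) hn hn, ← add_smul, ← hNe]
  norm_num

theorem grExp_eq {a : Gr V} {N : Gr V} {z : ℂ} (h : a = algebraMap ℂ (Gr V) z + N)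
    (hN : IsNilpotent N) : grExp a = Complex.exp z • nilExp N := by
  have hb : body a = z := by rw [h, map_add, body_algebraMap, body_nilpotent hN, add_zero]
  rw [grExp, hb, h, add_sub_cancel_left]

theorem grExp_add {a b : Gr V} (ha : a ∈ parity V 0) (hb : b ∈ parity V 0) :
    grExp (a + b) = grExp a * grExp b := by
  have hc := even_commute (sub_mem ha (algebraMap_mem_parity (body a)))
    (b - algebraMap ℂ (Gr V) (body b))
  rw [grExp_eq (a := a + b) (z := body a + body b)
    (N := (a - algebraMap ℂ (Gr V) (body a)) + (b - algebraMap ℂ (Gr V) (body b)))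
    (by rw [map_add]; abel)
    (hc.isNilpotent_add (isNilpotent_sub_body ha) (isNilpotent_sub_body hb)),
    nilExp_add hc (isNilpotent_sub_body ha) (isNilpotent_sub_body hb), Complex.exp_add, grExp,
    grExp, smul_mul_smul_comm]

theorem grExp_algebraMap (z : ℂ) : grExp (algebraMap ℂ (Gr V) z) =
    algebraMap ℂ (Gr V) (Complex.exp z) := by
  rw [grExp_eq (z := z) (N := 0) (by rw [add_zero]) IsNilpotent.zero, nilExp_zero,
    Algebra.algebraMap_eq_smul_one]

theorem grExp_zero : grExp (0 : Gr V) = 1 := by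
  simpa using grExp_algebraMap (V := V) 0

theorem grExp_mul_neg {a : Gr V} (ha : a ∈ parity V 0) : grExp a * grExp (-a) = 1 := by
  rw [← grExp_add ha (neg_mem ha), add_neg_cancel, grExp_zero]

theorem grExp_mem {a : Gr V} (ha : a ∈ parity V 0) : grExp a ∈ parity V 0 :=
  Submodule.smul_mem _ _ (nilExp_mem_parity (sub_mem ha (algebraMap_mem_parity _))
    (isNilpotent_sub_body ha))

theorem body_grExp {a : Gr V} (ha : a ∈ parity V 0) :
    body (grExp a) = Complex.exp (body a) := by
  rw [grExp, map_smul, body_nilExp (isNilpotent_sub_body ha), smul_eq_mul, mul_one]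

theorem map_grExp {φ : Gr V →ₐ[ℂ] Gr W} (hφ : IsSuperHom φ) {a : Gr V} (ha : a ∈ parity V 0) :
    φ (grExp a) = grExp (φ a) := by
  rw [grExp, map_smul, map_nilExp _ (isNilpotent_sub_body ha), grExp, hφ.body_apply, map_sub,
    AlgHom.commutes]

/-- Complex powers of `e^h` as binomial series. -/
theorem grExp_smul_eq_sum {h X : Gr V} (hh : h ∈ parity V 0) {z : ℂ} (hz : body h = z)
    (hX : grExp h = Complex.exp z • (1 + X)) {k : ℕ} (hk : X ^ k = 0) (μ : ℂ) :
    grExp (μ • h) = Complex.exp (μ * z) •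
      ∑ j ∈ Finset.range k, Ring.choose μ j • X ^ j := by
  have hn := isNilpotent_sub_body hh
  rw [hz] at hn
  rw [grExp_eq (a := μ • h) (z := μ * z) (N := μ • (h - algebraMap ℂ (Gr V) z)) _ (hn.smul μ),
    nilExp_smul_eq_sum hn _ hk]
  · rw [grExp, hz] at hX
    exact smul_right_injective _ (Complex.exp_ne_zero z) hX
  · rw [smul_sub, Algebra.algebraMap_eq_smul_one, Algebra.algebraMap_eq_smul_one, smul_smul]
    abel

end GrExp

/-! ### Odd derivatives and Berezin integrals -/

section Derivative

variable {V W U : Type} [AddCommGroup V] [Module ℂ V] [AddCommGroup W] [Module ℂ W]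
  [AddCommGroup U] [Module ℂ U]

/-- The left derivative along an odd direction. -/
abbrev del (d : Module.Dual ℂ U) : Gr U →ₗ[ℂ] Gr U :=
  CliffordAlgebra.contractLeft (Q := (0 : QuadraticForm ℂ U)) d

theorem del_ι_mul (d : Module.Dual ℂ U) (v : U) (b : Gr U) :
    del d (ExteriorAlgebra.ι ℂ v * b) = d v • b - ExteriorAlgebra.ι ℂ v * del d b :=
  CliffordAlgebra.contractLeft_ι_mul d v b

theorem del_ι (d : Module.Dual ℂ U) (v : U) :
    del d (ExteriorAlgebra.ι ℂ v) = algebraMap ℂ (Gr U) (d v) :=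
  CliffordAlgebra.contractLeft_ι _ d v

theorem del_algebraMap (d : Module.Dual ℂ U) (c : ℂ) : del d (algebraMap ℂ (Gr U) c) = 0 :=
  CliffordAlgebra.contractLeft_algebraMap _ d c

theorem del_del (d : Module.Dual ℂ U) (a : Gr U) : del d (del d a) = 0 :=
  CliffordAlgebra.contractLeft_contractLeft _ a

theorem del_comm (d d' : Module.Dual ℂ U) (a : Gr U) : del d (del d' a) = -del d' (del d a) :=
  CliffordAlgebra.contractLeft_comm d d' a

theorem del_mul (d : Module.Dual ℂ U) (a b : Gr U) :
    del d (a * b) = del d a * b + inv U a * del d b := by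
  induction a using ExteriorAlgebra.induction generalizing b with
  | algebraMap r =>
    rw [del_algebraMap, zero_mul, zero_add, AlgHom.commutes, ← Algebra.smul_def, map_smul,
      Algebra.smul_def]
  | ι v => rw [del_ι_mul, del_ι, inv_ι, neg_mul, ← Algebra.smul_def, sub_eq_add_neg]
  | mul x y hx hy => rw [mul_assoc, hx, hy, hx, map_mul]; noncomm_ring
  | add x y hx hy => rw [add_mul, map_add, hx, hy, map_add, map_add]; noncomm_ring

theorem del_inv (d : Module.Dual ℂ U) (a : Gr U) : del d (inv U a) = -inv U (del d a) := by
  induction a using ExteriorAlgebra.induction with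
  | algebraMap r => rw [AlgHom.commutes, del_algebraMap, map_zero, neg_zero]
  | ι v => rw [inv_ι, map_neg, del_ι, AlgHom.commutes]
  | mul x y hx hy => rw [map_mul, del_mul, hx, hy, del_mul, map_add, map_mul, map_mul]; noncomm_ring
  | add x y hx hy => rw [map_add, map_add, hx, hy, map_add, map_add, neg_add]

theorem del_map (d : Module.Dual ℂ W) (f : U →ₗ[ℂ] W) (a : Gr U) :
    del d (ExteriorAlgebra.map f a) = ExteriorAlgebra.map f (del (d ∘ₗ f) a) := by
  induction a using ExteriorAlgebra.induction with
  | algebraMap r => rw [AlgHom.commutes, del_algebraMap, del_algebraMap, map_zero]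
  | ι v => rw [ExteriorAlgebra.map_apply_ι, del_ι, del_ι, AlgHom.commutes, LinearMap.comp_apply]
  | mul x y hx hy =>
    rw [map_mul, del_mul, hx, hy, del_mul, map_add, map_mul, map_mul,
      (isSuperHom_map f).inv_apply]
  | add x y hx hy => rw [map_add, map_add, hx, hy, map_add, map_add]

/-- Successive left derivatives along a list of directions. -/
def delList {n : ℕ} (d : Fin n → Module.Dual ℂ U) : List (Fin n) → Gr U →ₗ[ℂ] Gr U
  | [] => LinearMap.id
  | i :: l => delList d l ∘ₗ del (d i)

variable {n : ℕ} (d : Fin n → Module.Dual ℂ U)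

theorem delList_cons (i : Fin n) (l : List (Fin n)) (a : Gr U) :
    delList d (i :: l) a = delList d l (del (d i) a) := rfl

theorem oddDerivs_eq (a : Gr U) : oddDerivs d a = delList d (List.finRange n) a := by
  have : ∀ (l : List (Fin n)) (a : Gr U), l.foldl (fun a i => del (d i) a) a = delList d l a := by
    intro l
    induction l with
    | nil => intro a; rfl
    | cons i l ih => intro a; exact ih _
  exact this _ a

/-- Odd derivatives anticommute, so the extra one can be moved, up to sign, next to its twin in the
list, and its square is zero. -/
theorem delList_del_of_mem {l : List (Fin n)} {i : Fin n} (hi : i ∈ l) (a : Gr U) :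
    delList d l (del (d i) a) = 0 := by
  induction l generalizing a with
  | nil => simp at hi
  | cons j l ih =>
    rw [delList_cons]
    rcases List.mem_cons.mp hi with rfl | h
    · rw [del_del, map_zero]
    · rw [del_comm, map_neg, ih h, neg_zero]

theorem del_delList_of_del_eq_zero (l : List (Fin n)) {i : Fin n} {a : Gr U}
    (ha : del (d i) a = 0) : del (d i) (delList d l a) = 0 := by
  induction l generalizing a with
  | nil => exact ha
  | cons j l ih => exact ih (by rw [del_comm, ha, map_zero, neg_zero])

theorem del_delList_of_mem {l : List (Fin n)} {i : Fin n} (hi : i ∈ l) (a : Gr U) :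
    del (d i) (delList d l a) = 0 := by
  induction l generalizing a with
  | nil => simp at hi
  | cons j l ih =>
    rcases List.mem_cons.mp hi with rfl | h
    · exact del_delList_of_del_eq_zero d l (del_del _ _)
    · exact ih h _

theorem delList_mul_right (l : List (Fin n)) (a : Gr U) {b : Gr U}
    (hb : ∀ i, del (d i) b = 0) : delList d l (a * b) = delList d l a * b := by
  induction l generalizing a with
  | nil => rfl
  | cons i l ih => rw [delList_cons, del_mul, hb, mul_zero, add_zero, ih, delList_cons]

theorem delList_map (d' : Fin n → Module.Dual ℂ W) (f : U →ₗ[ℂ] W)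
    (hd : ∀ i, d' i ∘ₗ f = d i) (l : List (Fin n)) (a : Gr U) :
    delList d' l (ExteriorAlgebra.map f a) = ExteriorAlgebra.map f (delList d l a) := by
  induction l generalizing a with
  | nil => rfl
  | cons i l ih => rw [delList_cons, del_map, hd, ih, delList_cons]

/-- The substitution u ↦ u - δ(u)v is affine on the whole exterior algebra, because any second order
term would contain v twice. -/
theorem sub_ι_mul_del (δ : Module.Dual ℂ U) (v : U) (a : Gr U) :
    a - ExteriorAlgebra.ι ℂ v * del δ a =
      ExteriorAlgebra.map (LinearMap.id - δ.smulRight v) a := by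
  induction a using CliffordAlgebra.left_induction with
  | algebraMap r =>
    have h := del_algebraMap δ r
    have h2 := (ExteriorAlgebra.map (LinearMap.id - δ.smulRight v)).commutes r
    change algebraMap ℂ (Gr U) r - _ * del δ (algebraMap ℂ (Gr U) r) = _
    rw [h, mul_zero, sub_zero]; exact h2.symm
  | add x y hx hy => rw [map_add, mul_add, map_add, ← hx, ← hy]; abel
  | ι_mul x w hx =>
    have e1 := del_ι_mul δ w x
    have e2 := ExteriorAlgebra.map_apply_ι (R := ℂ) (LinearMap.id - δ.smulRight v) w
    change ExteriorAlgebra.ι ℂ w * x - ExteriorAlgebra.ι ℂ v * del δ (ExteriorAlgebra.ι ℂ w * x) =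
      ExteriorAlgebra.map (LinearMap.id - δ.smulRight v) (ExteriorAlgebra.ι ℂ w * x)
    rw [e1, map_mul, ← hx, e2]
    have e3 : (LinearMap.id - δ.smulRight v : U →ₗ[ℂ] U) w = w - δ w • v := rfl
    rw [e3, map_sub, map_smul, sub_mul, mul_sub, mul_sub, mul_sub, smul_mul_assoc,
      ← mul_assoc (ExteriorAlgebra.ι ℂ v) (ExteriorAlgebra.ι ℂ w), ι_mul_ι_swap v w,
      smul_mul_assoc, ← mul_assoc (ExteriorAlgebra.ι ℂ v) (ExteriorAlgebra.ι ℂ v),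
      ExteriorAlgebra.ι_sq_zero, zero_mul, smul_zero, mul_smul_comm, neg_mul, mul_assoc]
    abel

variable {d} {e : Fin n → U}

/-- An element without derivatives along the coordinates e_i does not involve them. The projection π
that kills these coordinates is a composite of the rank one substitutions of `sub_ι_mul_del`, each
of which acts trivially on such an element. -/
theorem map_eq_self_of_del_eq_zero (hde : ∀ i j, d i (e j) = if i = j then 1 else 0)
    {π : U →ₗ[ℂ] U} (hπ : ∀ u, π u = u - ∑ i, d i u • e i) {a : Gr U}
    (ha : ∀ i, del (d i) a = 0) : ExteriorAlgebra.map π a = a := by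
  have key : ∀ s : Finset (Fin n), ∃ ρ : U →ₗ[ℂ] U, (∀ u, ρ u = u - ∑ i ∈ s, d i u • e i) ∧
      ExteriorAlgebra.map ρ a = a := by
    intro s
    induction s using Finset.induction_on with
    | empty => exact ⟨LinearMap.id, by simp, by rw [ExteriorAlgebra.map_id]; rfl⟩
    | insert i s hi ih =>
      obtain ⟨ρ, h1, h2⟩ := ih
      refine ⟨(LinearMap.id - (d i).smulRight (e i)) ∘ₗ ρ, fun u => ?_, ?_⟩
      · have h3 : d i (ρ u) = d i u := by
          rw [h1, map_sub, map_sum, Finset.sum_eq_zero, sub_zero]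
          intro j hj
          rw [map_smul, hde, if_neg (by rintro rfl; exact hi hj), smul_zero]
        change ρ u - d i (ρ u) • e i = _
        rw [h3, h1, Finset.sum_insert hi]; abel
      · rw [← ExteriorAlgebra.map_comp_map, AlgHom.comp_apply, h2, ← sub_ι_mul_del, ha, mul_zero,
          sub_zero]
  obtain ⟨ρ, h1, h2⟩ := key Finset.univ
  rwa [show π = ρ from LinearMap.ext fun u => by rw [hπ, h1]]

/-- Integration by parts: J kills ∂_i(e_i a) = a - e_i ∂_i a. -/
theorem ι_mul_del_top (hde : ∀ i j, d i (e j) = if i = j then 1 else 0) {X : Type}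
    [AddCommGroup X] [Module ℂ X] {J : Gr U →ₗ[ℂ] X} (hJ : ∀ i a, J (del (d i) a) = 0) (i : Fin n)
    (a : Gr U) : J a = J (ExteriorAlgebra.ι ℂ (e i) * del (d i) a) := by
  have := hJ i (ExteriorAlgebra.ι ℂ (e i) * a)
  rw [del_ι_mul, hde, if_pos rfl, one_smul, map_sub, sub_eq_zero] at this
  exact this

/-- A functional that kills all derivatives only depends on the top coefficient. -/
theorem exists_top (hde : ∀ i j, d i (e j) = if i = j then 1 else 0) :
    ∃ T : Gr U, ∀ {X : Type} [AddCommGroup X] [Module ℂ X] (J : Gr U →ₗ[ℂ] X),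
      (∀ i a, J (del (d i) a) = 0) → ∀ a, J a = J (T * delList d (List.finRange n) a) := by
  suffices ∀ l : List (Fin n), l.Nodup → ∃ T : Gr U, ∀ {X : Type} [AddCommGroup X] [Module ℂ X]
      (J : Gr U →ₗ[ℂ] X), (∀ i a, J (del (d i) a) = 0) → ∀ a, J a = J (T * delList d l a) from
    this _ (List.nodup_finRange n)
  -- The induction also records that T is free of the directions outside l; this removes the term
  -- with ∂_i T from the Leibniz rule when i is appended.
  have main : ∀ l : List (Fin n), l.Nodup → ∃ T : Gr U, (∀ j, j ∉ l → del (d j) T = 0) ∧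
      ∀ {X : Type} [AddCommGroup X] [Module ℂ X]
      (J : Gr U →ₗ[ℂ] X), (∀ i a, J (del (d i) a) = 0) → ∀ a, J a = J (T * delList d l a) := by
    intro l
    induction l using List.reverseRecOn with
    | nil =>
      intro _
      refine ⟨1, fun j _ => ?_, fun J _ a => ?_⟩
      · rw [← map_one (algebraMap ℂ (Gr U)), del_algebraMap]
      · rw [one_mul]; rfl
    | append_singleton l i ih =>
      intro hl
      obtain ⟨hl1, hl2⟩ : l.Nodup ∧ i ∉ l := by
        rw [List.nodup_append] at hl
        exact ⟨hl.1, fun h => hl.2.2 i h i (by simp) rfl⟩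
      have happ : ∀ a, delList d (l ++ [i]) a = del (d i) (delList d l a) := by
        intro a
        have : ∀ (l : List (Fin n)) (a : Gr U), delList d (l ++ [i]) a =
            del (d i) (delList d l a) := by
          intro l
          induction l with
          | nil => intro a; rfl
          | cons j l ih => intro a; exact ih _
        exact this l a
      obtain ⟨T, hT1, hT2⟩ := ih hl1
      -- T is built up as the signed monomial in the coordinates of l. The grading automorphism is
      -- the sign produced when ∂_i passes T.
      refine ⟨ExteriorAlgebra.ι ℂ (e i) * inv U T, fun j hj => ?_, fun J hJ a => ?_⟩
      · have hj' : j ∉ l ∧ j ≠ i := by simpa using hj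
        rw [del_ι_mul, hde, if_neg hj'.2, zero_smul, del_inv, hT1 j hj'.1, map_zero, neg_zero,
          mul_zero, sub_zero]
      · rw [hT2 J hJ, ι_mul_del_top hde hJ i, del_mul, hT1 i hl2, zero_mul, zero_add, happ,
          mul_assoc]
  intro l hl
  obtain ⟨T, -, hT⟩ := main l hl
  exact ⟨T, hT⟩

/-- An element annihilated by all the coordinates in question cannot lose them unnoticed: if both
c·e_i and ∂_i c vanished, the Leibniz rule would give c = 0. The derivative ∂_i c is again
annihilated by the remaining coordinates, so the argument repeats along the list. -/
theorem delList_ne_zero (hde : ∀ i j, d i (e j) = if i = j then 1 else 0) {l : List (Fin n)}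
    (hl : l.Nodup) {c : Gr U} (hc : c ≠ 0) (h : ∀ i ∈ l, c * ExteriorAlgebra.ι ℂ (e i) = 0) :
    delList d l c ≠ 0 := by
  induction l generalizing c with
  | nil => exact hc
  | cons i l ih =>
    have hmul : ∀ j, del (d i) c * ExteriorAlgebra.ι ℂ (e j) =
        del (d i) (c * ExteriorAlgebra.ι ℂ (e j)) - (if i = j then (1 : ℂ) else 0) • inv U c := by
      intro j
      rw [del_mul, del_ι, hde, add_sub_assoc, ← Algebra.commutes, ← Algebra.smul_def, sub_self,
        add_zero]
    refine ih hl.of_cons (fun h0 => hc ?_) fun j hj => ?_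
    · have := hmul i
      rw [h0, zero_mul, h i (by simp), map_zero, zero_sub, if_pos rfl, one_smul, eq_comm,
        neg_eq_zero] at this
      rw [← inv_inv c, this, map_zero]
    · have hij : i ≠ j := by rintro rfl; exact (List.nodup_cons.mp hl).1 hj
      rw [hmul, h j (List.mem_cons_of_mem _ hj), map_zero, if_neg hij, zero_smul, sub_zero]

end Derivative

/-! ### Berezin integrals on odd affine space, absolute and along fibres -/

section Berezin

variable {V : Type} [AddCommGroup V] [Module ℂ V] {n : ℕ}

/-- The partial derivatives on `𝔸^{0|n}`. -/
abbrev coordDual (i : Fin n) : Module.Dual ℂ (Coord n) := LinearMap.proj i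

/-- The partial derivatives on `S × 𝔸^{0|n}` along the fibres over `S`. -/
abbrev fibreDual (V : Type) [AddCommGroup V] [Module ℂ V] (i : Fin n) :
    Module.Dual ℂ (V × Coord n) := LinearMap.proj i ∘ₗ LinearMap.snd ℂ V (Coord n)

theorem coordDual_single (i j : Fin n) :
    coordDual i (Pi.single j (1 : ℂ) : Coord n) = if i = j then 1 else 0 := by
  simp [Pi.single_apply]

theorem fibreDual_single (i j : Fin n) :
    fibreDual V i ((0, Pi.single j (1 : ℂ)) : V × Coord n) = if i = j then 1 else 0 := by
  simp [Pi.single_apply]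

theorem berezin_eq (a : Gr (Coord n)) :
    berezin a = body (delList coordDual (List.finRange n) a) := by
  rw [berezin, oddDerivs_eq]

theorem berezin_add (a b : Gr (Coord n)) : berezin (a + b) = berezin a + berezin b := by
  simp only [berezin_eq, map_add]

theorem berezin_smul (c : ℂ) (a : Gr (Coord n)) : berezin (c • a) = c * berezin a := by
  simp only [berezin_eq, map_smul, smul_eq_mul]

theorem berezin_del (i : Fin n) (a : Gr (Coord n)) : berezin (del (coordDual i) a) = 0 := by
  rw [berezin_eq, delList_del_of_mem _ (List.mem_finRange i), map_zero]

/-- After differentiation in every direction no derivative is left, so the result is fixed by the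
projection that kills all coordinates and is therefore a constant. -/
theorem algebraMap_berezin (a : Gr (Coord n)) :
    delList coordDual (List.finRange n) a = algebraMap ℂ _ (berezin a) := by
  have h := map_eq_self_of_del_eq_zero (π := 0) (coordDual_single (n := n)) (fun u => by
    have : ∑ i, coordDual i u • (Pi.single i (1 : ℂ) : Coord n) = u := (pi_eq_sum_univ' u).symm
    rw [this, sub_self]; rfl)
    (a := delList coordDual (List.finRange n) a)
    (fun i => del_delList_of_mem _ (List.mem_finRange i) a)
  have h0 : (ExteriorAlgebra.map (0 : Coord n →ₗ[ℂ] Coord n)) =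
      (Algebra.ofId ℂ (Gr (Coord n))).comp body := by
    refine coord_hom_ext fun i => ?_
    rw [oddCoord, ExteriorAlgebra.map_apply_ι, AlgHom.comp_apply, body_ι, map_zero]
    exact map_zero _
  rw [berezin_eq]
  rw [h0] at h
  exact h.symm

theorem berezin_ne_zero {c : Gr (Coord n)} (hc : c ≠ 0) (h : ∀ i, c * oddCoord i = 0) :
    berezin c ≠ 0 := by
  intro h0
  refine delList_ne_zero (coordDual_single (n := n)) (List.nodup_finRange n) hc (fun i _ => h i) ?_
  rw [algebraMap_berezin, h0, map_zero]

/-- The pairing `(c, f) ↦ ∫ c f` is non-degenerate. -/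
theorem exists_berezin_mul_ne_zero {c : Gr (Coord n)} (hc : c ≠ 0) : ∃ f, berezin (c * f) ≠ 0 := by
  -- Multiplying c by every coordinate that does not yet annihilate the product pushes it to the top
  -- degree without making it zero.
  have key : ∀ s : Finset (Fin n), ∃ f, c * f ≠ 0 ∧ ∀ i ∈ s, c * f * oddCoord i = 0 := by
    intro s
    induction s using Finset.induction_on with
    | empty => exact ⟨1, by rwa [mul_one], by simp⟩
    | insert i s hi ih =>
      obtain ⟨f, hf, hf'⟩ := ih
      by_cases h : c * f * oddCoord i = 0
      · exact ⟨f, hf, by simpa [h] using hf'⟩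
      · refine ⟨f * oddCoord i, by rwa [← mul_assoc], fun j hj => ?_⟩
        rw [← mul_assoc, mul_assoc]
        rcases Finset.mem_insert.mp hj with rfl | hj
        · rw [odd_sq (oddCoord_mem j), mul_zero]
        · rw [odd_mul_odd_swap (oddCoord_mem i) (oddCoord_mem j), mul_neg, ← mul_assoc, hf' j hj,
            zero_mul, neg_zero]
  obtain ⟨f, hf, hf'⟩ := key Finset.univ
  exact ⟨f, berezin_ne_zero hf fun i => hf' i (Finset.mem_univ i)⟩

/-- A functional that kills all derivatives is a multiple of the Berezin integral. -/
theorem exists_eq_berezin_mul (J : Gr (Coord n) →ₗ[ℂ] ℂ)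
    (hJ : ∀ i a, J (del (coordDual i) a) = 0) : ∃ c : ℂ, ∀ a, J a = c * berezin a := by
  obtain ⟨T, hT⟩ := exists_top (coordDual_single (n := n))
  refine ⟨J T, fun a => ?_⟩
  rw [hT J hJ a, algebraMap_berezin, ← Algebra.commutes, ← Algebra.smul_def, map_smul, smul_eq_mul,
    mul_comm]

theorem berezinFibre_eq (a : Gr (V × Coord n)) : berezinFibre V a =
    ExteriorAlgebra.map (LinearMap.fst ℂ V (Coord n))
      (delList (fibreDual V) (List.finRange n) a) := by
  rw [berezinFibre, oddDerivs_eq]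

theorem berezinFibre_add (a b : Gr (V × Coord n)) :
    berezinFibre V (a + b) = berezinFibre V a + berezinFibre V b := by
  simp only [berezinFibre_eq, map_add]

theorem berezinFibre_smul (c : ℂ) (a : Gr (V × Coord n)) :
    berezinFibre V (c • a) = c • berezinFibre V a := by
  simp only [berezinFibre_eq, map_smul]

/-- The fibre integral as a linear map. -/
def berezinFibreL (V : Type) [AddCommGroup V] [Module ℂ V] (n : ℕ) :
    Gr (V × Coord n) →ₗ[ℂ] Gr V where
  toFun := berezinFibre V
  map_add' := berezinFibre_add
  map_smul' := berezinFibre_smul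

/-- The Berezin integral as a linear map. -/
def berezinL (n : ℕ) : Gr (Coord n) →ₗ[ℂ] ℂ where
  toFun := berezin
  map_add' := berezin_add
  map_smul' := berezin_smul

theorem berezinFibre_del (i : Fin n) (a : Gr (V × Coord n)) :
    berezinFibre V (del (fibreDual V i) a) = 0 := by
  rw [berezinFibre_eq, delList_del_of_mem _ (List.mem_finRange i), map_zero]

theorem del_pullFst (i : Fin n) (v : Gr V) :
    del (fibreDual V i) (pullFst V (Coord n) v) = 0 := by
  have h : (LinearMap.snd ℂ V (Coord n)) ∘ₗ LinearMap.inl ℂ V (Coord n) = 0 := by ext; simp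
  rw [pullFst, del_map, LinearMap.comp_assoc, h, LinearMap.comp_zero]
  simp only [del, map_zero, LinearMap.zero_apply]

theorem del_pullSnd (i : Fin n) (a : Gr (Coord n)) :
    del (fibreDual V i) (pullSnd V (Coord n) a) = pullSnd V (Coord n) (del (coordDual i) a) := by
  rw [pullSnd, del_map]; rfl

theorem map_fst_pullFst (v : Gr V) :
    ExteriorAlgebra.map (LinearMap.fst ℂ V (Coord n)) (pullFst V (Coord n) v) = v := by
  rw [pullFst, ← AlgHom.comp_apply, ExteriorAlgebra.map_comp_map, LinearMap.fst_comp_inl,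
    ExteriorAlgebra.map_id]; rfl

/-- Functions on the base factor out on the right, where the left derivatives never have to pass
them; hence there is no sign. -/
theorem berezinFibre_mul_pullFst (a : Gr (V × Coord n)) (v : Gr V) :
    berezinFibre V (a * pullFst V (Coord n) v) = berezinFibre V a * v := by
  rw [berezinFibre_eq, delList_mul_right _ _ _ (fun i => del_pullFst i v), map_mul,
    map_fst_pullFst, berezinFibre_eq]

theorem berezinFibre_pullSnd (a : Gr (Coord n)) :
    berezinFibre V (pullSnd V (Coord n) a) = algebraMap ℂ (Gr V) (berezin a) := by
  rw [berezinFibre_eq, pullSnd, delList_map coordDual (fibreDual V) _ (fun i => rfl),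
    algebraMap_berezin, AlgHom.commutes, AlgHom.commutes]

theorem pullFst_berezinFibre (a : Gr (V × Coord n)) :
    delList (fibreDual V) (List.finRange n) a = pullFst V (Coord n) (berezinFibre V a) := by
  have h := map_eq_self_of_del_eq_zero
    (π := LinearMap.inl ℂ V (Coord n) ∘ₗ LinearMap.fst ℂ V (Coord n))
    (fibreDual_single (V := V) (n := n)) (fun u => by
      have : ∑ i, fibreDual V i u • ((0, Pi.single i (1 : ℂ)) : V × Coord n) = (0, u.2) := by
        have h2 := congrArg (LinearMap.inr ℂ V (Coord n)) (pi_eq_sum_univ' u.2)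
        rw [map_sum] at h2
        simp only [map_smul] at h2
        exact h2.symm
      rw [this]
      ext <;> simp)
    (a := delList (fibreDual V) (List.finRange n) a)
    (fun i => del_delList_of_mem _ (List.mem_finRange i) a)
  rw [← ExteriorAlgebra.map_comp_map, AlgHom.comp_apply] at h
  rw [berezinFibre_eq]
  exact h.symm

/-- Relative form of `exists_eq_berezin_mul`: a map that kills the fibre derivatives sees only the
fibre integral. The target is arbitrary, so this applies to integrals with values in functions on
the base. -/
theorem exists_fibre_top (V : Type) [AddCommGroup V] [Module ℂ V] (n : ℕ) :
    ∃ T : Gr (V × Coord n), ∀ {X : Type} [AddCommGroup X] [Module ℂ X]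
      (J : Gr (V × Coord n) →ₗ[ℂ] X), (∀ i a, J (del (fibreDual V i) a) = 0) →
        ∀ a, J a = J (T * pullFst V (Coord n) (berezinFibre V a)) := by
  obtain ⟨T, hT⟩ := exists_top (fibreDual_single (V := V) (n := n))
  exact ⟨T, fun J hJ a => by rw [hT J hJ a, pullFst_berezinFibre]⟩

end Berezin

open Sum

/-! ### Supermatrices and the orthosymplectic group -/

section SuperMatrix

variable {q : ℕ} {V W : Type} [AddCommGroup V] [Module ℂ V] [AddCommGroup W] [Module ℂ W]

/-- The parity of a basis vector. -/
def deg {q : ℕ} : Fin 2 ⊕ (Fin 2 × Fin q) → ZMod 2 := Sum.elim (fun _ => 0) (fun _ => 1)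

theorem isEvenSMat_iff {x : SMat q (Gr V)} :
    IsEvenSMat q V x ↔ ∀ i j, x i j ∈ parity V (deg i + deg j) := by
  have h2 : (1 : ZMod 2) + 1 = 0 := rfl
  constructor
  · rintro ⟨h1, h2', h3, h4⟩ (i | i) (j | j)
    · exact h1 i j
    · exact h2' i j
    · exact h3 i j
    · simp only [deg, elim_inr, h2]; exact h4 i j
  · intro h
    refine ⟨fun i j => h (inl i) (inl j), fun i j => h (inl i) (inr j),
      fun i j => h (inr i) (inl j), fun i j => ?_⟩
    have := h (inr i) (inr j)
    simp only [deg, elim_inr, h2] at this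
    exact this

theorem IsEvenSMat.mul {x y : SMat q (Gr V)} (hx : IsEvenSMat q V x) (hy : IsEvenSMat q V y) :
    IsEvenSMat q V (x * y) := by
  rw [isEvenSMat_iff] at *
  intro i j
  rw [Matrix.mul_apply]
  refine sum_mem fun k _ => ?_
  have := mul_mem_parity (hx i k) (hy k j)
  rwa [show deg i + deg k + (deg k + deg j) = deg i + deg j by
    rw [add_assoc, ← add_assoc (deg k), CharTwo.add_self_eq_zero, zero_add]] at this

theorem IsEvenSMat.map {x : SMat q (Gr V)} (hx : IsEvenSMat q V x) {φ : Gr V →ₐ[ℂ] Gr W}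
    (hφ : IsSuperHom φ) : IsEvenSMat q W (x.map φ) := by
  rw [isEvenSMat_iff] at *
  exact fun i j => hφ _ _ (hx i j)

theorem isEvenSMat_one : IsEvenSMat q V 1 := by
  rw [isEvenSMat_iff]
  intro i j
  by_cases h : i = j
  · subst h
    rw [Matrix.one_apply_eq, CharTwo.add_self_eq_zero]; exact one_mem_parity
  · rw [Matrix.one_apply_ne h]; exact zero_mem _

theorem transpose_mul_of_commute {l m n : Type} [Fintype m] {R : Type} [Ring R] {A : Matrix l m R}
    {B : Matrix m n R} (h : ∀ i j k, A i j * B j k = B j k * A i j) :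
    (A * B).transpose = B.transpose * A.transpose := by
  ext i j
  simp only [Matrix.transpose_apply, Matrix.mul_apply]
  exact Finset.sum_congr rfl fun k _ => h _ _ _

theorem transpose_mul_of_anticommute {l m n : Type} [Fintype m] {R : Type} [Ring R]
    {A : Matrix l m R} {B : Matrix m n R} (h : ∀ i j k, A i j * B j k = -(B j k * A i j)) :
    (A * B).transpose = -(B.transpose * A.transpose) := by
  ext i j
  simp only [Matrix.transpose_apply, Matrix.mul_apply, Matrix.neg_apply, ← Finset.sum_neg_distrib]
  exact Finset.sum_congr rfl fun k _ => h _ _ _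

theorem superTranspose_fromBlocks {R : Type} [Ring R] (A : Matrix (Fin 2) (Fin 2) R)
    (B : Matrix (Fin 2) (Fin 2 × Fin q) R) (C : Matrix (Fin 2 × Fin q) (Fin 2) R)
    (D : Matrix (Fin 2 × Fin q) (Fin 2 × Fin q) R) :
    superTranspose (Matrix.fromBlocks A B C D) =
      Matrix.fromBlocks A.transpose C.transpose (-B.transpose) D.transpose := by
  simp [superTranspose]

/-- Transposing a product of two odd blocks costs a sign. The minus sign in one off-diagonal block
of the supertranspose compensates for it exactly. -/
theorem superTranspose_mul {x y : SMat q (Gr V)} (hx : IsEvenSMat q V x)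
    (hy : IsEvenSMat q V y) : superTranspose (x * y) = superTranspose y * superTranspose x := by
  obtain ⟨hA, hB, hC, hD⟩ := hx
  obtain ⟨hA', hB', hC', hD'⟩ := hy
  rw [← Matrix.fromBlocks_toBlocks x, ← Matrix.fromBlocks_toBlocks y, Matrix.fromBlocks_multiply,
    superTranspose_fromBlocks, superTranspose_fromBlocks, superTranspose_fromBlocks,
    Matrix.fromBlocks_multiply, Matrix.transpose_add, Matrix.transpose_add, Matrix.transpose_add,
    Matrix.transpose_add,
    transpose_mul_of_commute (fun i j k => (even_commute (hA i j) _).eq),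
    transpose_mul_of_anticommute (fun i j k => odd_mul_odd_swap (hB i j) (hC' j k)),
    transpose_mul_of_commute (fun i j k => (even_commute (hA i j) _).eq),
    transpose_mul_of_commute (fun i j k => (even_commute (hD' j k) _).symm.eq),
    transpose_mul_of_commute (fun i j k => (even_commute (hA' j k) _).symm.eq),
    transpose_mul_of_commute (fun i j k => (even_commute (hD i j) _).eq),
    transpose_mul_of_anticommute (fun i j k => odd_mul_odd_swap (hC i j) (hB' j k)),
    transpose_mul_of_commute (fun i j k => (even_commute (hD i j) _).eq)]
  congr 1 <;> simp [add_comm]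

theorem superTranspose_map {R S : Type} [Ring R] [Ring S] (φ : R →+* S) (x : SMat q R) :
    superTranspose (x.map φ) = (superTranspose x).map φ := by
  ext (i | i) (j | j) <;> simp [superTranspose, Matrix.toBlocks₁₁, Matrix.toBlocks₁₂,
    Matrix.toBlocks₂₁, Matrix.toBlocks₂₂]

theorem superTranspose_one {R : Type} [Ring R] : superTranspose (1 : SMat q R) = 1 := by
  rw [← Matrix.fromBlocks_one, superTranspose_fromBlocks]; simp

theorem superTranspose_even {x : SMat q (Gr V)} (hx : IsEvenSMat q V x) :
    IsEvenSMat q V (superTranspose x) := by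
  obtain ⟨hA, hB, hC, hD⟩ := hx
  rw [superTranspose]
  exact ⟨fun i j => hA j i, fun i j => hC j i, fun i j => neg_mem (hB j i), fun i j => hD j i⟩

/-- The action of `J_q` on column vectors. -/
def symp {R : Type} [Ring R] (v : Fin 2 × Fin q → R) (i : Fin 2 × Fin q) : R :=
  if i.1 = 0 then v (1, i.2) else -v (0, i.2)

@[simp] theorem symp_zero {R : Type} [Ring R] (v : Fin 2 × Fin q → R) (j : Fin q) :
    symp v (0, j) = v (1, j) := rfl

@[simp] theorem symp_one {R : Type} [Ring R] (v : Fin 2 × Fin q → R) (j : Fin q) :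
    symp v (1, j) = -v (0, j) := rfl

theorem symp_symp {R : Type} [Ring R] (v : Fin 2 × Fin q → R) : symp (symp v) = -v := by
  ext ⟨a, j⟩; fin_cases a <;> simp

theorem symp_add {R : Type} [Ring R] (v w : Fin 2 × Fin q → R) :
    symp (v + w) = symp v + symp w := by
  ext ⟨a, j⟩; fin_cases a <;> simp [add_comm]

theorem symp_mul {R : Type} [Ring R] (a b : R) (v : Fin 2 × Fin q → R) (i : Fin 2 × Fin q) :
    symp (fun k => a * v k * b) i = a * symp v i * b := by
  obtain ⟨c, j⟩ := i; fin_cases c <;> simp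

theorem symp_mem {i : ZMod 2} {v : Fin 2 × Fin q → Gr V} (hv : ∀ k, v k ∈ parity V i)
    (k : Fin 2 × Fin q) : symp v k ∈ parity V i := by
  obtain ⟨c, j⟩ := k
  fin_cases c
  · exact hv _
  · exact neg_mem (hv _)

theorem symp_map {R S : Type} [Ring R] [Ring S] (φ : R →+* S) (v : Fin 2 × Fin q → R)
    (i : Fin 2 × Fin q) : φ (symp v i) = symp (fun k => φ (v k)) i := by
  obtain ⟨c, j⟩ := i; fin_cases c <;> simp

/-- The quadratic form `vᵗ J_q v`. -/
def sympForm {R : Type} [Ring R] (v w : Fin 2 × Fin q → R) : R := ∑ i, v i * symp w i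

theorem sum_mul_symp_single {R : Type} [Ring R] (v : Fin 2 × Fin q → R) (j : Fin 2 × Fin q) :
    ∑ i, v i * symp (fun k => if k = j then (1 : R) else 0) i = -symp v j := by
  obtain ⟨c, j⟩ := j
  rw [Fintype.sum_prod_type]
  fin_cases c <;> simp [Fin.sum_univ_two]

theorem formJ_mulVec_inl_zero {R : Type} [Ring R] (v : Fin 2 ⊕ (Fin 2 × Fin q) → R) :
    (formJ q R).mulVec v (inl 0) = -v (inl 0) := by
  simp [formJ, Matrix.mulVec, dotProduct]

theorem formJ_mulVec_inl_one {R : Type} [Ring R] (v : Fin 2 ⊕ (Fin 2 × Fin q) → R) :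
    (formJ q R).mulVec v (inl 1) = v (inl 1) := by
  simp [formJ, Matrix.mulVec, dotProduct]

theorem formJ_mulVec_inr {R : Type} [Ring R] (v : Fin 2 ⊕ (Fin 2 × Fin q) → R)
    (i : Fin 2 × Fin q) : (formJ q R).mulVec v (inr i) = symp (fun k => v (inr k)) i := by
  obtain ⟨c, j⟩ := i
  simp only [formJ, Matrix.mulVec, dotProduct, Fintype.sum_sum_type, Fintype.sum_prod_type,
    Matrix.fromBlocks_apply₂₁, Matrix.fromBlocks_apply₂₂, Matrix.zero_apply, zero_mul,
    Finset.sum_const_zero, zero_add, Matrix.blockDiagonal_apply, ite_mul]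
  fin_cases c <;> simp [Fin.sum_univ_two]

theorem formJ_inr_inr {R : Type} [Ring R] (i j : Fin 2 × Fin q) :
    formJ q R (inr i) (inr j) = symp (fun k => if k = j then (1 : R) else 0) i := by
  have := formJ_mulVec_inr (Pi.single (inr j) (1 : R)) i
  rw [Matrix.mulVec_single_one] at this
  refine (Matrix.col_apply (formJ q R) (inr j) (inr i)).symm.trans (this.trans ?_)
  congr 1
  ext k
  simp [Pi.single_apply]

theorem formJ_map {R S : Type} [Ring R] [Ring S] (φ : R →+* S) :
    (formJ q R).map φ = formJ q S := by
  ext (i | i) (j | j)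
  · fin_cases i <;> fin_cases j <;> simp [formJ]
  · simp [formJ]
  · simp [formJ]
  · rw [Matrix.map_apply, formJ_inr_inr, formJ_inr_inr, symp_map]
    congr 1
    ext k
    split_ifs <;> simp

theorem isEvenSMat_formJ : IsEvenSMat q V (formJ q (Gr V)) := by
  refine ⟨fun i j => ?_, fun i j => ?_, fun i j => ?_, fun i j => ?_⟩
  · fin_cases i <;> fin_cases j <;>
      simp [formJ, one_mem_parity, zero_mem]
  · simp [formJ]
  · simp [formJ]
  · change formJ q (Gr V) (inr i) (inr j) ∈ _
    rw [formJ_inr_inr]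
    refine symp_mem (fun k => ?_) i
    split_ifs
    exacts [one_mem_parity, zero_mem _]

/-- The inverse of `J`. -/
def formJInv (q : ℕ) (R : Type) [Ring R] : SMat q R :=
  Matrix.fromBlocks 1 0 0 (-1) * formJ q R

theorem formJ_mul_formJ {R : Type} [Ring R] :
    formJ q R * formJ q R = Matrix.fromBlocks 1 0 0 (-1) := by
  rw [formJ, Matrix.fromBlocks_multiply, ← Matrix.blockDiagonal_mul]
  congr 1
  · ext i j; fin_cases i <;> fin_cases j <;> simp
  · simp
  · simp
  · have : (!![0, 1; -1, 0] : Matrix (Fin 2) (Fin 2) R) * !![0, 1; -1, 0] = -1 := by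
      ext i j; fin_cases i <;> fin_cases j <;> simp
    simp only [this, Matrix.zero_mul, zero_add]
    rw [← Matrix.blockDiagonal_one, ← Matrix.blockDiagonal_neg]
    rfl

theorem formJInv_mul {R : Type} [Ring R] : formJInv q R * formJ q R = 1 := by
  rw [formJInv, mul_assoc, formJ_mul_formJ, Matrix.fromBlocks_multiply]
  simp

theorem formJ_mul_formJInv {R : Type} [Ring R] : formJ q R * formJInv q R = 1 := by
  have hc : formJInv q R = formJ q R * Matrix.fromBlocks 1 0 0 (-1) := by
    rw [formJInv, ← formJ_mul_formJ, mul_assoc]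
  rw [hc, ← mul_assoc, formJ_mul_formJ, Matrix.fromBlocks_multiply]
  simp

theorem isEvenSMat_formJInv : IsEvenSMat q V (formJInv q (Gr V)) := by
  refine IsEvenSMat.mul ?_ isEvenSMat_formJ
  rw [← formJ_mul_formJ]
  exact isEvenSMat_formJ.mul isEvenSMat_formJ

/-- Points of the complex orthosymplectic supergroup. -/
def IsOSpPt (x : SMat q (Gr V)) : Prop :=
  IsEvenSMat q V x ∧ superTranspose x * formJ q (Gr V) * x = formJ q (Gr V)

theorem IsOSpPt.mul {x y : SMat q (Gr V)} (hx : IsOSpPt x) (hy : IsOSpPt y) :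
    IsOSpPt (x * y) := by
  refine ⟨hx.1.mul hy.1, ?_⟩
  calc superTranspose (x * y) * formJ q (Gr V) * (x * y)
      = superTranspose y * (superTranspose x * formJ q (Gr V) * x) * y := by
        rw [superTranspose_mul hx.1 hy.1]; simp only [mul_assoc]
    _ = _ := by rw [hx.2, hy.2]

theorem IsOSpPt.map {x : SMat q (Gr V)} (hx : IsOSpPt x) {φ : Gr V →ₐ[ℂ] Gr W}
    (hφ : IsSuperHom φ) : IsOSpPt (x.map φ) := by
  refine ⟨hx.1.map hφ, ?_⟩
  have h := congrArg (fun m => Matrix.map m (φ : Gr V →+* Gr W)) hx.2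
  simp only [Matrix.map_mul, formJ_map] at h
  have e := superTranspose_map (φ : Gr V →+* Gr W) x
  simp only [RingHom.coe_coe] at e h
  rw [e]; exact h

theorem IsOSpPt.inv_mul {x : SMat q (Gr V)} (hx : IsOSpPt x) :
    formJInv q (Gr V) * superTranspose x * formJ q (Gr V) * x = 1 := by
  rw [mul_assoc, mul_assoc, ← mul_assoc (superTranspose x), hx.2, formJInv_mul]

theorem IsOSpPt.mul_inv [FiniteDimensional ℂ V] {x : SMat q (Gr V)} (hx : IsOSpPt x) :
    x * (formJInv q (Gr V) * superTranspose x * formJ q (Gr V)) = 1 :=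
  mat_mul_eq_one_comm hx.inv_mul

/-- The inverse of a point of the orthosymplectic supergroup. -/
theorem IsOSpPt.exists_inv [FiniteDimensional ℂ V] {x : SMat q (Gr V)} (hx : IsOSpPt x) :
    ∃ y, IsOSpPt y ∧ x * y = 1 ∧ y * x = 1 := by
  have he : IsEvenSMat q V (formJInv q (Gr V) * superTranspose x * formJ q (Gr V)) :=
    (isEvenSMat_formJInv.mul (superTranspose_even hx.1)).mul isEvenSMat_formJ
  refine ⟨_, ⟨he, ?_⟩, hx.mul_inv, hx.inv_mul⟩
  set y := formJInv q (Gr V) * superTranspose x * formJ q (Gr V)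
  have h1 : x * y = 1 := hx.mul_inv
  calc superTranspose y * formJ q (Gr V) * y
      = superTranspose y * (superTranspose x * formJ q (Gr V) * x) * y := by rw [hx.2]
    _ = superTranspose (x * y) * formJ q (Gr V) * (x * y) := by
        rw [superTranspose_mul hx.1 he]; simp only [mul_assoc]
    _ = _ := by rw [h1, superTranspose_one, one_mul, mul_one]

theorem superTranspose_mul_formJ_mul_apply {R : Type} [Ring R] (x y : SMat q R)
    (i j : Fin 2 ⊕ (Fin 2 × Fin q)) :
    (x * formJ q R * y) i j = -(x i (inl 0) * y (inl 0) j) + x i (inl 1) * y (inl 1) j +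
      ∑ k, x i (inr k) * symp (fun l => y (inr l) j) k := by
  rw [mul_assoc, Matrix.mul_apply]
  have h : ∀ a, (formJ q R * y) a j = (formJ q R).mulVec (fun b => y b j) a := fun a => rfl
  simp only [h, Fintype.sum_sum_type, Fin.sum_univ_two, formJ_mulVec_inl_zero,
    formJ_mulVec_inl_one, formJ_mulVec_inr, mul_neg]

end SuperMatrix

/-! ### The subgroups `K` and `M` -/

section Subgroups

variable {q : ℕ} {V W : Type} [AddCommGroup V] [Module ℂ V] [AddCommGroup W] [Module ℂ W]

theorem fin_two_cases (i : Fin 2) : i = 0 ∨ i = 1 := by fin_cases i <;> simp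

/-- The first row and column of a matrix are those of the identity. -/
def FixesFirst {R : Type} [Ring R] (x : SMat q R) : Prop :=
  (∀ j, x (inl 0) j = (1 : SMat q R) (inl 0) j) ∧ ∀ i, x i (inl 0) = (1 : SMat q R) i (inl 0)

theorem FixesFirst.row_mul {R : Type} [Ring R] {x : SMat q R} (hx : FixesFirst x) (y : SMat q R)
    (j : Fin 2 ⊕ (Fin 2 × Fin q)) : (x * y) (inl 0) j = y (inl 0) j := by
  rw [Matrix.mul_apply]
  simp only [hx.1]
  rw [← Matrix.mul_apply, one_mul]

theorem FixesFirst.mul_col {R : Type} [Ring R] {x : SMat q R} (hx : FixesFirst x) (y : SMat q R)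
    (i : Fin 2 ⊕ (Fin 2 × Fin q)) : (y * x) i (inl 0) = y i (inl 0) := by
  rw [Matrix.mul_apply]
  simp only [hx.2]
  rw [← Matrix.mul_apply, mul_one]

theorem sigma_conj_apply {R : Type} [Ring R] (x : SMat q R) (i j : Fin 2 ⊕ (Fin 2 × Fin q)) :
    (sigma q R * x * sigma q R) i j = (if i = inl 0 then -1 else 1) * x i j *
      (if j = inl 0 then -1 else 1) := by
  have h : sigma q R = Matrix.diagonal (fun i => if i = inl 0 then -1 else 1) := by
    ext (a | a) (b | b)
    · fin_cases a <;> fin_cases b <;> simp [sigma, Matrix.diagonal]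
    · simp [sigma, Matrix.diagonal]
    · simp [sigma, Matrix.diagonal]
    · simp [sigma, Matrix.diagonal, Matrix.one_apply]
  rw [h, Matrix.mul_diagonal, Matrix.diagonal_mul]

theorem sigma_conj_eq_iff {x : SMat q (Gr V)} : sigma q (Gr V) * x * sigma q (Gr V) = x ↔
    (∀ j, j ≠ inl 0 → x (inl 0) j = 0) ∧ ∀ i, i ≠ inl 0 → x i (inl 0) = 0 := by
  have hneg : ∀ a : Gr V, -a = a → a = 0 := fun a h => by
    have : (2 : ℂ) • a = 0 := by rw [two_smul]; nth_rewrite 1 [← h]; exact neg_add_cancel a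
    exact (smul_eq_zero.mp this).resolve_left two_ne_zero
  constructor
  · intro h
    refine ⟨fun j hj => hneg _ ?_, fun i hi => hneg _ ?_⟩
    · have := congrFun (congrFun h (inl 0)) j
      rw [sigma_conj_apply, if_pos rfl, if_neg hj] at this
      simpa using this
    · have := congrFun (congrFun h i) (inl 0)
      rw [sigma_conj_apply, if_pos rfl, if_neg hi] at this
      simpa using this
  · rintro ⟨h1, h2⟩
    ext i j
    rw [sigma_conj_apply]
    by_cases hi : i = inl 0 <;> by_cases hj : j = inl 0
    · simp [hi, hj]
    · simp [hi, h1 j hj]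
    · simp [hj, h2 i hi]
    · simp [hi, hj]

theorem IsOSpPt.col_form {x : SMat q (Gr V)} (hx : IsOSpPt x) (j : Fin 2 ⊕ (Fin 2 × Fin q))
    (a : Fin 2) :
    -(x (inl 0) (inl a) * x (inl 0) j) + x (inl 1) (inl a) * x (inl 1) j +
      ∑ k, x (inr k) (inl a) * symp (fun l => x (inr l) j) k = formJ q (Gr V) (inl a) j := by
  have := congrFun (congrFun hx.2 (inl a)) j
  rwa [superTranspose_mul_formJ_mul_apply] at this

/-- Invariance under θ kills the first row and column off the diagonal. The form equation then makes
the corner a square root of 1, and positivity of its value makes it equal to 1. The determinant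
condition leaves the value 1 for the next diagonal entry. -/
theorem mem_ptsK_iff {k : SMat q (Gr V)} : k ∈ ptsK q V ↔ IsOSpPt k ∧ FixesFirst k ∧
    body (k (inl 1) (inl 1)) = 1 ∧
    k.toBlocks₂₂.map body ∈ Matrix.unitaryGroup (Fin 2 × Fin q) ℂ := by
  constructor
  · rintro ⟨⟨he, hJ, ⟨a, ha, hdet, hpos⟩, hu⟩, hσ⟩
    have hk : IsOSpPt k := ⟨he, hJ⟩
    obtain ⟨hr, hc⟩ := sigma_conj_eq_iff.mp hσ
    have hab : ∀ i j, body (k (inl i) (inl j)) = (a i j : ℂ) := fun i j =>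
      congrFun (congrFun ha i) j
    have hsq : k (inl 0) (inl 0) * k (inl 0) (inl 0) = 1 * 1 := by
      have := hk.col_form (inl 0) 0
      rw [hc (inl 1) (by simp)] at this
      simp only [hc (inr _) (by simp), zero_mul, Finset.sum_const_zero, add_zero] at this
      simpa [formJ] using this
    have ha1 : a 0 0 = 1 := by
      have h1 := congrArg body hsq
      rw [map_mul, hab, map_mul, map_one] at h1
      have h2 : a 0 0 * a 0 0 = 1 := by exact_mod_cast h1.trans (one_mul 1)
      nlinarith
    have h00 : k (inl 0) (inl 0) = 1 :=
      even_sqrt_unique (he.1 0 0) one_mem_parity (by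
        rw [hab, ha1, Complex.ofReal_one]) (map_one _) hsq
    have h01 : a 0 1 = 0 := by
      have h1 := hab 0 1
      rw [hr (inl 1) (by simp), map_zero] at h1
      exact_mod_cast h1.symm
    refine ⟨hk, ⟨fun j => ?_, fun i => ?_⟩, ?_, hu⟩
    · by_cases hj : j = inl 0
      · rw [hj, h00, Matrix.one_apply_eq]
      · rw [hr j hj, Matrix.one_apply_ne (Ne.symm hj)]
    · by_cases hi : i = inl 0
      · rw [hi, h00, Matrix.one_apply_eq]
      · rw [hc i hi, Matrix.one_apply_ne hi]
    · rw [Matrix.det_fin_two, ha1, h01] at hdet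
      rw [hab, show a 1 1 = 1 by linarith, Complex.ofReal_one]
  · rintro ⟨⟨he, hJ⟩, ⟨hr, hc⟩, hb, hu⟩
    refine ⟨⟨he, hJ, ⟨1, ?_, by simp, by simp⟩, hu⟩, sigma_conj_eq_iff.mpr
      ⟨fun j hj => by rw [hr, Matrix.one_apply_ne (Ne.symm hj)],
        fun i hi => by rw [hc, Matrix.one_apply_ne hi]⟩⟩
    ext i j
    change body (k (inl i) (inl j)) = (((1 : Matrix (Fin 2) (Fin 2) ℝ) i j : ℝ) : ℂ)
    fin_cases i <;> fin_cases j
    · change body (k (inl 0) (inl 0)) = _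
      rw [hr]; simp
    · change body (k (inl 0) (inl 1)) = _
      rw [hr]; simp
    · change body (k (inl 1) (inl 0)) = _
      rw [hc]; simp
    · simpa using hb

theorem body_mul_inr_inr {x y : SMat q (Gr V)} (hx : IsEvenSMat q V x) :
    (x * y).toBlocks₂₂.map body = x.toBlocks₂₂.map body * y.toBlocks₂₂.map body := by
  ext i j
  change body ((x * y) (inr i) (inr j)) = ∑ k, body (x (inr i) (inr k)) * body (y (inr k) (inr j))
  rw [Matrix.mul_apply, Fintype.sum_sum_type, map_add, map_sum, map_sum]
  rw [Finset.sum_eq_zero fun k _ => ?_, zero_add]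
  · exact Finset.sum_congr rfl fun k _ => map_mul _ _ _
  · have h : x (inr i) (inl k) ∈ parity V 1 := hx.2.2.1 i k
    rw [map_mul, body_odd h, zero_mul]

theorem body_mul_inl_inl {x y : SMat q (Gr V)} (hx : IsEvenSMat q V x) (i j : Fin 2) :
    body ((x * y) (inl i) (inl j)) = body (x (inl i) (inl 0)) * body (y (inl 0) (inl j)) +
      body (x (inl i) (inl 1)) * body (y (inl 1) (inl j)) := by
  rw [Matrix.mul_apply, Fintype.sum_sum_type, map_add, map_sum, map_sum, Fin.sum_univ_two]
  rw [Finset.sum_eq_zero (s := Finset.univ (α := Fin 2 × Fin q)) fun k _ => ?_, add_zero,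
    map_mul, map_mul]
  have h : x (inl i) (inr k) ∈ parity V 1 := hx.2.1 i k
  rw [map_mul, body_odd h, zero_mul]

theorem mul_mem_ptsK {x y : SMat q (Gr V)} (hx : x ∈ ptsK q V) (hy : y ∈ ptsK q V) :
    x * y ∈ ptsK q V := by
  rw [mem_ptsK_iff] at *
  obtain ⟨hx1, hx2, hx3, hx4⟩ := hx
  obtain ⟨hy1, hy2, hy3, hy4⟩ := hy
  refine ⟨hx1.mul hy1, ⟨fun j => by rw [hx2.row_mul, hy2.1], fun i => by rw [hy2.mul_col, hx2.2]⟩,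
    ?_, by rw [body_mul_inr_inr hx1.1]; exact mul_mem hx4 hy4⟩
  rw [body_mul_inl_inl hx1.1, hx3, hy3, hx2.2]
  simp

theorem exists_inv_mem_ptsK [FiniteDimensional ℂ V] {x : SMat q (Gr V)} (hx : x ∈ ptsK q V) :
    ∃ y ∈ ptsK q V, x * y = 1 ∧ y * x = 1 := by
  rw [mem_ptsK_iff] at hx
  obtain ⟨hx1, hx2, hx3, hx4⟩ := hx
  obtain ⟨y, hy, hxy, hyx⟩ := hx1.exists_inv
  have hrow : ∀ j, y (inl 0) j = (1 : SMat q (Gr V)) (inl 0) j := fun j => by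
    rw [← hx2.row_mul y, hxy]
  have hcol : ∀ i, y i (inl 0) = (1 : SMat q (Gr V)) i (inl 0) := fun i => by
    rw [← hx2.mul_col y, hyx]
  refine ⟨y, mem_ptsK_iff.mpr ⟨hy, ⟨hrow, hcol⟩, ?_, ?_⟩, hxy, hyx⟩
  · have := body_mul_inl_inl (y := y) hx1.1 1 1
    rw [hxy, hx3, hx2.2] at this
    simpa using this.symm
  · have h1 : x.toBlocks₂₂.map body * y.toBlocks₂₂.map body = 1 := by
      rw [← body_mul_inr_inr hx1.1, hxy]
      ext i j
      by_cases h : i = j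
      · subst h; simp [Matrix.toBlocks₂₂]
      · simp [Matrix.toBlocks₂₂, Matrix.one_apply, h]
    have h2 : y.toBlocks₂₂.map body = star (x.toBlocks₂₂.map body) := by
      have h3 := Matrix.mem_unitaryGroup_iff'.mp hx4
      calc _ = star (x.toBlocks₂₂.map body) * (x.toBlocks₂₂.map body) * y.toBlocks₂₂.map body := by
            rw [h3, one_mul]
        _ = _ := by rw [mul_assoc, h1, mul_one]
    rw [h2]
    exact Unitary.star_mem hx4

theorem map_mem_ptsK {x : SMat q (Gr V)} (hx : x ∈ ptsK q V) {φ : Gr V →ₐ[ℂ] Gr W}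
    (hφ : IsSuperHom φ) : x.map φ ∈ ptsK q W := by
  rw [mem_ptsK_iff] at *
  obtain ⟨hx1, hx2, hx3, hx4⟩ := hx
  have h1 : ∀ i j, φ ((1 : SMat q (Gr V)) i j) = (1 : SMat q (Gr W)) i j := fun i j => by
    rw [Matrix.one_apply, Matrix.one_apply]; split_ifs <;> simp
  refine ⟨hx1.map hφ, ⟨fun j => ?_, fun i => ?_⟩, ?_, ?_⟩
  · rw [Matrix.map_apply, hx2.1, h1]
  · rw [Matrix.map_apply, hx2.2, h1]
  · rw [Matrix.map_apply, hφ.body_apply, hx3]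
  · convert hx4 using 1
    ext i j
    exact hφ.body_apply _

theorem mem_ptsM_iff {m : SMat q (Gr V)} : m ∈ ptsM q V ↔ m ∈ ptsK q V ∧
    (∀ j, m (inl 1) j = (1 : SMat q (Gr V)) (inl 1) j) ∧
    ∀ i, m i (inl 1) = (1 : SMat q (Gr V)) i (inl 1) := by
  have hR : ∀ i j, (m * hZero q (Gr V)) i j =
      if j = inl 0 then m i (inl 1) else if j = inl 1 then m i (inl 0) else 0 := by
    rintro i (j | j)
    · fin_cases j <;>
        simp [Matrix.mul_apply, hZero, Fintype.sum_sum_type, Fin.sum_univ_two]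
    · simp [Matrix.mul_apply, hZero, Fintype.sum_sum_type]
  have hL : ∀ i j, (hZero q (Gr V) * m) i j =
      if i = inl 0 then m (inl 1) j else if i = inl 1 then m (inl 0) j else 0 := by
    rintro (i | i) j
    · fin_cases i <;>
        simp [Matrix.mul_apply, hZero, Fintype.sum_sum_type, Fin.sum_univ_two]
    · simp [Matrix.mul_apply, hZero, Fintype.sum_sum_type]
  constructor
  · rintro ⟨hm, hc⟩
    obtain ⟨-, hm2, -⟩ := mem_ptsK_iff.mp hm
    refine ⟨hm, fun j => ?_, fun i => ?_⟩
    · have h := congrFun (congrFun hc (inl 0)) j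
      rw [hR, hL, if_pos rfl] at h
      rw [← h]
      rcases j with j | j
      · obtain rfl | rfl := fin_two_cases j
        · simpa using hm2.1 (inl 1)
        · simpa using hm2.1 (inl 0)
      · simp
    · have h := congrFun (congrFun hc i) (inl 0)
      rw [hR, hL, if_pos rfl] at h
      rw [h]
      rcases i with i | i
      · obtain rfl | rfl := fin_two_cases i
        · simpa using hm2.2 (inl 1)
        · simpa using hm2.2 (inl 0)
      · simp
  · rintro ⟨hm, hr, hc⟩
    obtain ⟨-, hm2, -⟩ := mem_ptsK_iff.mp hm
    refine ⟨hm, ?_⟩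
    ext i j
    rw [hR, hL, hr, hc, hm2.1, hm2.2]
    rcases i with i | i <;> rcases j with j | j
    · obtain rfl | rfl := fin_two_cases i <;> obtain rfl | rfl := fin_two_cases j <;> simp
    · obtain rfl | rfl := fin_two_cases i <;> simp
    · obtain rfl | rfl := fin_two_cases j <;> simp
    · simp

/-- The quadratic form of the first column of a point of `K` is `1`. -/
theorem col_norm {k : SMat q (Gr V)} (hk : k ∈ ptsK q V) :
    k (inl 1) (inl 1) * k (inl 1) (inl 1) +
      sympForm (fun i => k (inr i) (inl 1)) (fun i => k (inr i) (inl 1)) = 1 := by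
  obtain ⟨hk1, hk2, -⟩ := mem_ptsK_iff.mp hk
  have := hk1.col_form (inl 1) 1
  rw [hk2.1, Matrix.one_apply_ne (by simp), mul_zero, neg_zero, zero_add] at this
  simpa [formJ, sympForm] using this

/-- With the odd entries gone, the norm equation makes the even entry a square root of 1 of value 1,
and orthogonality to this column clears the corresponding row. This column therefore separates the
classes modulo M. -/
theorem mem_ptsM_of_col {k : SMat q (Gr V)} (hk : k ∈ ptsK q V)
    (h : ∀ i, k (inr i) (inl 1) = 0) : k ∈ ptsM q V := by
  obtain ⟨hk1, hk2, hk3, -⟩ := mem_ptsK_iff.mp hk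
  have h11 : k (inl 1) (inl 1) = 1 := by
    refine even_sqrt_unique (hk1.1.1 1 1) one_mem_parity hk3 (map_one _) ?_
    have := col_norm hk
    simp only [h, sympForm, zero_mul, Finset.sum_const_zero, add_zero] at this
    rw [mul_one]; exact this
  refine mem_ptsM_iff.mpr ⟨hk, ?_, ?_⟩
  · rintro (j | j)
    · obtain rfl | rfl := fin_two_cases j
      · simpa using hk2.2 (inl 1)
      · simpa using h11
    · have := hk1.col_form (inr j) 1
      rw [hk2.1, h11, Matrix.one_apply_ne (by simp), zero_mul, neg_zero, zero_add] at this
      simp only [h, zero_mul, Finset.sum_const_zero, add_zero, one_mul] at this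
      rw [this]; simp [formJ]
  · rintro (i | i)
    · obtain rfl | rfl := fin_two_cases i
      · simpa using hk2.1 (inl 1)
      · simpa using h11
    · simpa using h i

theorem mul_ptsM_col {m : SMat q (Gr V)} (hm : m ∈ ptsM q V) (x : SMat q (Gr V))
    (i : Fin 2 ⊕ (Fin 2 × Fin q)) : (x * m) i (inl 1) = x i (inl 1) := by
  rw [Matrix.mul_apply]
  simp only [(mem_ptsM_iff.mp hm).2.2]
  rw [← Matrix.mul_apply, mul_one]

theorem mul_mem_ptsM {x y : SMat q (Gr V)} (hx : x ∈ ptsM q V) (hy : y ∈ ptsM q V) :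
    x * y ∈ ptsM q V :=
  ⟨mul_mem_ptsK hx.1 hy.1, by rw [mul_assoc, hy.2, ← mul_assoc, hx.2, mul_assoc]⟩

theorem map_mem_ptsM {x : SMat q (Gr V)} (hx : x ∈ ptsM q V) {φ : Gr V →ₐ[ℂ] Gr W}
    (hφ : IsSuperHom φ) : x.map φ ∈ ptsM q W := by
  refine mem_ptsM_of_col (map_mem_ptsK hx.1 hφ) fun i => ?_
  rw [Matrix.map_apply, (mem_ptsM_iff.mp hx).2.2, Matrix.one_apply_ne (by simp), map_zero]

end Subgroups

/-! ### Standard points of `K` -/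

section StandardPoints

variable {q : ℕ} {V W : Type} [AddCommGroup V] [Module ℂ V] [AddCommGroup W] [Module ℂ W]

/-- The point of `K` with first column `(b, ξ)`, where `c` is the inverse of `1 + b`. -/
def stdPt (b c : Gr V) (ξ : Fin 2 × Fin q → Gr V) : SMat q (Gr V) :=
  Matrix.fromBlocks !![1, 0; 0, b] (Matrix.of fun a i => if a = 1 then symp ξ i else 0)
    (Matrix.of fun i a => if a = 1 then ξ i else 0)
    (Matrix.of fun i j => (if i = j then 1 else 0) + c * ξ i * symp ξ j)

theorem symp_single_self (i : Fin 2 × Fin q) (η : Gr V) :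
    symp (fun k => if k = i then η else 0) i = 0 := by
  obtain ⟨c, i⟩ := i
  fin_cases c <;> simp

section

variable {b c : Gr V} {ξ : Fin 2 × Fin q → Gr V}

@[simp] theorem stdPt_inl_one_inl_one : stdPt b c ξ (inl 1) (inl 1) = b := by simp [stdPt]

@[simp] theorem stdPt_inr_inl_one (i : Fin 2 × Fin q) :
    stdPt b c ξ (inr i) (inl 1) = ξ i := by simp [stdPt]

@[simp] theorem stdPt_inl_one_inr (i : Fin 2 × Fin q) :
    stdPt b c ξ (inl 1) (inr i) = symp ξ i := by simp [stdPt]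

@[simp] theorem stdPt_inr_inr (i j : Fin 2 × Fin q) :
    stdPt b c ξ (inr i) (inr j) = (if i = j then 1 else 0) + c * ξ i * symp ξ j := by
  simp [stdPt]

theorem fixesFirst_stdPt : FixesFirst (stdPt b c ξ) := by
  refine ⟨?_, ?_⟩
  · rintro (j | j)
    · obtain rfl | rfl := fin_two_cases j <;> simp [stdPt]
    · simp [stdPt]
  · rintro (j | j)
    · obtain rfl | rfl := fin_two_cases j <;> simp [stdPt]
    · simp [stdPt]

theorem isEvenSMat_stdPt (hb : b ∈ parity V 0) (hc : c ∈ parity V 0)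
    (hξ : ∀ i, ξ i ∈ parity V 1) : IsEvenSMat q V (stdPt b c ξ) := by
  rw [stdPt]
  refine ⟨fun i j => ?_, fun i j => ?_, fun i j => ?_, fun i j => ?_⟩
  · rw [Matrix.toBlocks_fromBlocks₁₁]
    fin_cases i <;> fin_cases j <;> simp [one_mem_parity, hb]
  · rw [Matrix.toBlocks_fromBlocks₁₂, Matrix.of_apply]
    split_ifs
    exacts [symp_mem hξ j, zero_mem _]
  · rw [Matrix.toBlocks_fromBlocks₂₁, Matrix.of_apply]
    split_ifs
    exacts [hξ i, zero_mem _]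
  · rw [Matrix.toBlocks_fromBlocks₂₂, Matrix.of_apply]
    refine add_mem ?_ (odd_mul_odd (even_mul_odd hc (hξ i)) (symp_mem hξ j))
    split_ifs
    exacts [one_mem_parity, zero_mem _]

theorem symp_stdPt_col (j k : Fin 2 × Fin q) :
    symp (fun l => stdPt b c ξ (inr l) (inr j)) k =
      symp (fun l => if l = j then (1 : Gr V) else 0) k + c * symp ξ k * symp ξ j := by
  simp only [stdPt_inr_inr]
  rw [← symp_mul c (symp ξ j) ξ k]
  exact congrFun (symp_add _ _) k

/-- The point is the super analogue of the rotation that takes the base vector of the sphere to (b,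
ξ). All block equations reduce to the relation cτ = 1 - b between the correction in the lower block
and the column. -/
theorem isOSpPt_stdPt (hb : b ∈ parity V 0) (hc : c ∈ parity V 0) (hξ : ∀ i, ξ i ∈ parity V 1)
    (hn : b * b + sympForm ξ ξ = 1) (hbc : (1 + b) * c = 1) : IsOSpPt (stdPt b c ξ) := by
  refine ⟨isEvenSMat_stdPt hb hc hξ, ?_⟩
  have hσ := symp_mem hξ
  -- The norm equation factors as τ = (1 + b)(1 - b), and c inverts the first factor.
  have hτ : c * sympForm ξ ξ = 1 - b := by
    have h1 : sympForm ξ ξ = (1 + b) * (1 - b) := by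
      rw [← sub_eq_iff_eq_add'.mpr hn.symm]; noncomm_ring
    rw [h1, ← mul_assoc, (even_commute hc _).eq, hbc, one_mul]
  obtain ⟨hr, hc0⟩ := fixesFirst_stdPt (b := b) (c := c) (ξ := ξ)
  have hT1 : ∀ a d, superTranspose (stdPt b c ξ) (inl a) (inl d) =
      stdPt b c ξ (inl d) (inl a) := fun _ _ => rfl
  have hT2 : ∀ a k, superTranspose (stdPt b c ξ) (inl a) (inr k) =
      stdPt b c ξ (inr k) (inl a) := fun _ _ => rfl
  have hT3 : ∀ k a, superTranspose (stdPt b c ξ) (inr k) (inl a) =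
      -stdPt b c ξ (inl a) (inr k) := fun _ _ => rfl
  have hT4 : ∀ k l, superTranspose (stdPt b c ξ) (inr k) (inr l) =
      stdPt b c ξ (inr l) (inr k) := fun _ _ => rfl
  have h4 : ∀ i, ∑ k, ξ k * (symp ξ i * symp ξ k) = -(sympForm ξ ξ * symp ξ i) := fun i => by
    rw [sympForm, Finset.sum_mul, ← Finset.sum_neg_distrib]
    refine Finset.sum_congr rfl fun k _ => ?_
    rw [odd_mul_odd_swap (hσ i) (hσ k), mul_neg, mul_assoc]
  have hcc : ∀ x y : Gr V, x * (c * y) = c * (x * y) := fun x y => by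
    rw [← mul_assoc, ← (even_commute hc x).eq, mul_assoc]
  ext i j
  rw [superTranspose_mul_formJ_mul_apply]
  rcases i with i | i <;> rcases j with j | j <;> simp only [hT1, hT2, hT3, hT4]
  · obtain rfl | rfl := fin_two_cases i
    · simp only [hr]
      obtain rfl | rfl := fin_two_cases j <;>
        simp [formJ, hc0]
    · obtain rfl | rfl := fin_two_cases j
      · have : symp (fun l => stdPt b c ξ (inr l) (inl 0)) = 0 := by
          simp only [hc0]; ext ⟨a, k⟩; fin_cases a <;> simp
        simp only [this]
        simp [formJ, hc0, hr]
      · simpa [hr, formJ, sympForm] using hn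
  · obtain rfl | rfl := fin_two_cases i
    · simp only [hr]
      simp [formJ, hc0]
    · simp only [hr, symp_stdPt_col, mul_add, Finset.sum_add_distrib]
      have h3 : ∑ k, ξ k * (c * symp ξ k * symp ξ j) = (1 - b) * symp ξ j := by
        rw [← hτ, sympForm, Finset.mul_sum, Finset.sum_mul]
        refine Finset.sum_congr rfl fun k _ => ?_
        rw [mul_assoc, hcc]; simp only [mul_assoc]
      simp [formJ, sum_mul_symp_single, h3]
      noncomm_ring
  · obtain rfl | rfl := fin_two_cases j
    · have : symp (fun _ : Fin 2 × Fin q => (0 : Gr V)) = 0 := by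
        ext ⟨a, k⟩; fin_cases a <;> simp
      simp [formJ, this, hr, hc0]
    · have h3 : ∑ k, c * ξ k * symp ξ i * symp ξ k = -((1 - b) * symp ξ i) := by
        rw [← hτ, mul_assoc, ← mul_neg, ← h4, Finset.mul_sum]
        exact Finset.sum_congr rfl fun k _ => by simp only [mul_assoc]
      simp [formJ, hr, add_mul, Finset.sum_add_distrib, h3]
      rw [← (even_commute hb _).eq]
      noncomm_ring
  · have h3 : ∑ k, c * ξ k * symp ξ i * symp (fun l => if l = j then (1 : Gr V) else 0) k =
        c * symp ξ i * symp ξ j := by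
      rw [← neg_neg (symp ξ j), ← sum_mul_symp_single, mul_neg, Finset.mul_sum,
        ← Finset.sum_neg_distrib]
      refine Finset.sum_congr rfl fun k _ => ?_
      rw [mul_assoc c, odd_mul_odd_swap (hξ k) (hσ i)]
      noncomm_ring
    have h5 : ∑ k, c * ξ k * symp ξ i * (c * symp ξ k * symp ξ j) =
        -(c * (1 - b) * symp ξ i * symp ξ j) := by
      rw [← hτ]
      have : c * (c * sympForm ξ ξ) * symp ξ i * symp ξ j =
          -(c * c * (-(sympForm ξ ξ * symp ξ i)) * symp ξ j) := by noncomm_ring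
      rw [this, neg_neg, ← h4, Finset.mul_sum, Finset.sum_mul]
      refine Finset.sum_congr rfl fun k _ => ?_
      rw [mul_assoc c (symp ξ k), hcc]
      simp only [mul_assoc]
    have h6 : b * c = 1 - c := by
      rw [eq_sub_iff_add_eq, add_comm, ← hbc]; noncomm_ring
    have h7 : c * (1 - b) = c + c - 1 := by
      rw [mul_sub, mul_one, (even_commute hc b).eq, h6]; abel
    simp only [stdPt_inl_one_inr, symp_stdPt_col, formJ_inr_inr, hr]
    simp only [stdPt_inr_inr, mul_add, add_mul, Finset.sum_add_distrib, h3, h5, h7]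
    simp
    noncomm_ring

end

theorem stdPt_mem_ptsK {b c : Gr V} {ξ : Fin 2 × Fin q → Gr V} (hb : b ∈ parity V 0)
    (hb1 : body b = 1) (hc : c ∈ parity V 0)
    (hξ : ∀ i, ξ i ∈ parity V 1)
    (hn : b * b + sympForm ξ ξ = 1) (hbc : (1 + b) * c = 1) : stdPt b c ξ ∈ ptsK q V := by
  refine mem_ptsK_iff.mpr ⟨isOSpPt_stdPt hb hc hξ hn hbc, fixesFirst_stdPt, by simpa using hb1, ?_⟩
  have : (stdPt b c ξ).toBlocks₂₂.map body = 1 := by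
    ext i j
    change body (stdPt b c ξ (inr i) (inr j)) = _
    rw [stdPt_inr_inr, map_add, map_mul, body_odd (symp_mem hξ j), mul_zero, add_zero,
      Matrix.one_apply]
    split_ifs <;> simp
  rw [this]
  exact one_mem _

/-- The elementary point of `K` in the direction of the `i`-th odd coordinate. -/
def elemPt (i : Fin 2 × Fin q) (η : Gr V) : SMat q (Gr V) :=
  stdPt 1 (algebraMap ℂ (Gr V) 2⁻¹) (fun k => if k = i then η else 0)

theorem elemPt_mem (i : Fin 2 × Fin q) {η : Gr V} (hη : η ∈ parity V 1) :
    elemPt i η ∈ ptsK q V := by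
  refine stdPt_mem_ptsK one_mem_parity (map_one _) (algebraMap_mem_parity _)
    (fun k => by split_ifs; exacts [hη, zero_mem _]) ?_ ?_
  -- The form pairs each coordinate with its partner in the symplectic plane, so it vanishes on a
  -- vector with one non-zero entry. This is why b = 1 and c = 1/2 are admissible.
  · rw [sympForm, Finset.sum_eq_single i]
    · rw [symp_single_self, mul_zero, add_zero, one_mul]
    · intro k _ hk; rw [if_neg hk, zero_mul]
    · intro h; exact absurd (Finset.mem_univ i) h
  · rw [one_add_one_eq_two, ← map_ofNat (algebraMap ℂ (Gr V)) 2, ← map_mul]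
    norm_num

theorem elemPt_inr_inr (i : Fin 2 × Fin q) {η : Gr V} (hη : η ∈ parity V 1)
    (k l : Fin 2 × Fin q) : elemPt i η (inr k) (inr l) = if k = l then 1 else 0 := by
  rw [elemPt, stdPt_inr_inr]
  have : (if k = i then η else 0) * symp (fun k => if k = i then η else 0) l = 0 := by
    obtain ⟨a, l⟩ := l
    fin_cases a <;> simp [odd_sq hη]
  rw [mul_assoc, this, mul_zero, add_zero]

/-- Since η² = 0, the lower block of an elementary point is the identity, and the only effect on the
odd coordinates comes from the column. -/
theorem elemPt_mul_inr (i : Fin 2 × Fin q) {η : Gr V} (hη : η ∈ parity V 1) {k : SMat q (Gr V)}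
    (hk : FixesFirst k) (l : Fin 2 × Fin q) : (elemPt i η * k) (inr l) (inl 1) =
      k (inr l) (inl 1) + if l = i then η * k (inl 1) (inl 1) else 0 := by
  rw [Matrix.mul_apply, Fintype.sum_sum_type, Fin.sum_univ_two, hk.1]
  simp only [elemPt_inr_inr i hη]
  rw [elemPt, stdPt_inr_inl_one]
  simp [add_comm]

theorem elemPt_mul_elemPt_neg (i : Fin 2 × Fin q) {η : Gr V} (hη : η ∈ parity V 1) :
    elemPt i η * elemPt i (-η) = 1 := by
  have hX : ∀ η ∈ parity V 1, elemPt i η = 1 + Matrix.fromBlocks 0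
      (Matrix.of fun a j => if a = 1 then symp (fun k => if k = i then η else 0) j else 0)
      (Matrix.of fun j a => if a = 1 then (if j = i then η else 0) else 0) 0 := by
    intro η hη
    ext (a | k) (b | l)
    · fin_cases a <;> fin_cases b <;> simp [elemPt, stdPt]
    · simp [elemPt, stdPt]
    · simp [elemPt, stdPt]
    · rw [elemPt_inr_inr i hη]; simp [Matrix.one_apply]
  rw [hX η hη, hX (-η) (neg_mem hη), mul_add, mul_one, add_mul, one_mul, Matrix.fromBlocks_multiply,
    add_assoc, ← add_assoc (Matrix.fromBlocks _ _ _ _), Matrix.fromBlocks_add, add_eq_left]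
  have hneg : ∀ j : Fin 2 × Fin q, symp (fun k => if k = i then -η else 0) j =
      -symp (fun k => if k = i then η else 0) j := by
    rintro ⟨a, j⟩; fin_cases a <;> simp <;> split_ifs <;> simp
  rw [Matrix.fromBlocks_add, ← Matrix.fromBlocks_zero]
  congr 1
  · ext a b
    simp [Matrix.mul_apply, symp_single_self]
  · ext a b; simp [hneg]; split_ifs <;> simp
  · ext a b; simp; split_ifs <;> simp
  · ext k ⟨c, l⟩
    simp [Matrix.mul_apply]
    fin_cases c <;> simp [odd_sq hη]

/-- The group `K` is generated by the elementary points and `M`. -/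
theorem ptsK_induction {P : SMat q (Gr V) → Prop} (hM : ∀ m ∈ ptsM q V, P m)
    (hE : ∀ (i : Fin 2 × Fin q), ∀ η ∈ parity V 1, ∀ k ∈ ptsK q V, P k → P (elemPt i η * k))
    {k : SMat q (Gr V)} (hk : k ∈ ptsK q V) : P k := by
  have key : ∀ s : Finset (Fin 2 × Fin q), ∀ k ∈ ptsK q V,
      (∀ i, i ∉ s → k (inr i) (inl 1) = 0) → P k := by
    intro s
    induction s using Finset.induction_on with
    | empty => exact fun k hk h => hM k (mem_ptsM_of_col hk fun i => h i (by simp))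
    | insert i s hi ih =>
      intro k hk h
      obtain ⟨hk1, hk2, hk3, -⟩ := mem_ptsK_iff.mp hk
      obtain ⟨b', hb', -, hbb⟩ := exists_even_inverse (hk1.1.1 1 1)
        (by change body (k (inl 1) (inl 1)) ≠ 0; rw [hk3]; exact one_ne_zero)
      -- Gaussian elimination in the column: the even entry b is invertible, and the elementary
      -- point with parameter -ξ_i b⁻¹ clears ξ_i and leaves the other odd entries unchanged.
      set η := k (inr i) (inl 1) * b' with hη
      have hηo : η ∈ parity V 1 := odd_mul_even (hk1.1.2.2.1 i 1) hb'
      have hk' := mul_mem_ptsK (elemPt_mem i (neg_mem hηo)) hk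
      have h1 : k = elemPt i η * (elemPt i (-η) * k) := by
        rw [← mul_assoc, elemPt_mul_elemPt_neg i hηo, one_mul]
      rw [h1]
      refine hE i η hηo _ hk' (ih _ hk' fun j hj => ?_)
      rw [elemPt_mul_inr i (neg_mem hηo) hk2]
      by_cases hji : j = i
      · subst hji
        have hb1 : b' * k (inl 1) (inl 1) = 1 := hbb
        rw [if_pos rfl, hη, neg_mul, mul_assoc, hb1, mul_one, add_neg_cancel]
      · rw [if_neg hji, h j (by simp [hji, hj]), add_zero]
  exact key Finset.univ k hk fun i hi => absurd (Finset.mem_univ i) hi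

end StandardPoints

/-! ### The standard chart -/

section Chart

variable {q : ℕ} {V W : Type} [AddCommGroup V] [Module ℂ V] [AddCommGroup W] [Module ℂ W]

/-- The numbering of the odd coordinates. -/
def idx (q : ℕ) : Fin 2 × Fin q ≃ Fin (2 * q) := finProdFinEquiv

/-- A point of `K` whose first column consists of the coordinates is a chart. -/
theorem isChart_of_col {s : SMat q (Gr (Coord (2 * q)))} (hs : s ∈ ptsK q (Coord (2 * q)))
    (h : ∀ i, s (inr i) (inl 1) = oddCoord (idx q i)) : IsChart q s := by
  refine ⟨hs, ?_⟩
  intro V _ _ _ k hk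
  obtain ⟨hk1, hk2, hk3, -⟩ := mem_ptsK_iff.mp hk
  have hodd : ∀ i, k (inr ((idx q).symm i)) (inl 1) ∈ parity V 1 := fun i => hk1.1.2.2.1 _ 1
  refine ⟨coordLift (fun i => k (inr ((idx q).symm i)) (inl 1)) hodd,
    ⟨isSuperHom_coordLift _ hodd, ?_⟩, ?_⟩
  · have hsK := map_mem_ptsK hs (isSuperHom_coordLift _ hodd)
    obtain ⟨y, hyK, hy1, hy2⟩ := exists_inv_mem_ptsK hsK
    refine ⟨y * k, mem_ptsM_of_col (mul_mem_ptsK hyK hk) fun i => ?_,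
      by rw [← mul_assoc, hy1, one_mul]⟩
    set S := s.map (coordLift (fun i => k (inr ((idx q).symm i)) (inl 1)) hodd) with hS
    -- The odd entries agree by the choice of the morphism. The even entries are then square roots
    -- of value 1 of the same element.
    have hcol : ∀ a, S a (inl 1) = k a (inl 1) := by
      have hr : ∀ i, S (inr i) (inl 1) = k (inr i) (inl 1) := fun i => by
        rw [hS, Matrix.map_apply, h, coordLift_oddCoord, Equiv.symm_apply_apply]
      obtain ⟨hS1, hS2, hS3, -⟩ := mem_ptsK_iff.mp hsK
      rintro (a | i)
      · obtain rfl | rfl := fin_two_cases a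
        · rw [hS2.1, hk2.1]
        · refine even_sqrt_unique (hS1.1.1 1 1) (hk1.1.1 1 1) hS3 hk3 ?_
          have e1 := col_norm hsK
          have e2 := col_norm hk
          simp only [hr] at e1
          exact add_right_cancel (e1.trans e2.symm)
      · exact hr i
    have : (y * k) (inr i) (inl 1) = (y * S) (inr i) (inl 1) := by
      rw [Matrix.mul_apply, Matrix.mul_apply]
      simp only [hcol]
    rw [this, hy2, Matrix.one_apply_ne (by simp)]
  · rintro y ⟨hy, m, hm, hkm⟩
    refine coord_hom_ext fun i => ?_
    rw [coordLift_oddCoord, hkm, mul_ptsM_col hm, Matrix.map_apply, h, Equiv.apply_symm_apply]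

/-- The coordinates as a column vector. -/
def coordCol (q : ℕ) (i : Fin 2 × Fin q) : Gr (Coord (2 * q)) := oddCoord (idx q i)

theorem coordCol_mem (i : Fin 2 × Fin q) : coordCol q i ∈ parity (Coord (2 * q)) 1 :=
  oddCoord_mem _

/-- The invariant quadratic form in the odd coordinates. -/
def coordForm (q : ℕ) : Gr (Coord (2 * q)) := sympForm (coordCol q) (coordCol q)

theorem coordForm_mem : coordForm q ∈ parity (Coord (2 * q)) 0 := by
  rw [coordForm, sympForm]
  exact sum_mem fun i _ => odd_mul_odd (coordCol_mem i) (symp_mem coordCol_mem i)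

theorem body_coordForm : body (coordForm q) = 0 := by
  rw [coordForm, sympForm, map_sum]
  exact Finset.sum_eq_zero fun i _ => by rw [map_mul, body_odd (coordCol_mem i), zero_mul]

theorem exists_chartRoot (q : ℕ) : ∃ b ∈ parity (Coord (2 * q)) 0, body b = 1 ∧
    b * b = 1 - coordForm q :=
  exists_even_sqrt (sub_mem one_mem_parity coordForm_mem)
    (by rw [map_sub, map_one, body_coordForm, sub_zero])

/-- The even entry `√(1 - τ)` of the first column in the standard chart. -/
def chartRoot (q : ℕ) : Gr (Coord (2 * q)) := (exists_chartRoot q).choose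

theorem chartRoot_mem : chartRoot q ∈ parity (Coord (2 * q)) 0 :=
  (exists_chartRoot q).choose_spec.1

theorem body_chartRoot : body (chartRoot q) = 1 := (exists_chartRoot q).choose_spec.2.1

theorem chartRoot_sq : chartRoot q * chartRoot q = 1 - coordForm q :=
  (exists_chartRoot q).choose_spec.2.2

theorem exists_stdChart (q : ℕ) : ∃ s : SMat q (Gr (Coord (2 * q))), IsChart q s ∧
    s (inl 1) (inl 1) = chartRoot q ∧ ∀ i, s (inr i) (inl 1) = coordCol q i := by
  obtain ⟨c, hc, hbc, -⟩ := exists_even_inverse (add_mem one_mem_parity (chartRoot_mem (q := q)))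
    (by rw [map_add, map_one, body_chartRoot]; norm_num)
  refine ⟨stdPt (chartRoot q) c (coordCol q), isChart_of_col ?_ fun i => ?_, by simp, by simp⟩
  · refine stdPt_mem_ptsK chartRoot_mem body_chartRoot hc coordCol_mem ?_ hbc
    rw [chartRoot_sq, coordForm]; abel
  · simp [coordCol]

/-- The standard chart. -/
def stdChart (q : ℕ) : SMat q (Gr (Coord (2 * q))) := (exists_stdChart q).choose

theorem isChart_stdChart : IsChart q (stdChart q) := (exists_stdChart q).choose_spec.1

theorem stdChart_inl : stdChart q (inl 1) (inl 1) = chartRoot q :=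
  (exists_stdChart q).choose_spec.2.1

theorem stdChart_inr (i : Fin 2 × Fin q) : stdChart q (inr i) (inl 1) = coordCol q i :=
  (exists_stdChart q).choose_spec.2.2 i

end Chart

/-! ### The Iwasawa decomposition -/

section Iwasawa

variable {q : ℕ} {V W : Type} [AddCommGroup V] [Module ℂ V] [AddCommGroup W] [Module ℂ W]

/-- The superfunction `cosh h`. -/
def grCosh (h : Gr V) : Gr V := (2⁻¹ : ℂ) • (grExp h + grExp (-h))

/-- The superfunction `sinh h`. -/
def grSinh (h : Gr V) : Gr V := (2⁻¹ : ℂ) • (grExp h - grExp (-h))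

theorem grCosh_add_grSinh (h : Gr V) : grCosh h + grSinh h = grExp h := by
  rw [grCosh, grSinh]; module

theorem grCosh_neg (h : Gr V) : grCosh (-h) = grCosh h := by
  rw [grCosh, grCosh, neg_neg, add_comm]

theorem grSinh_neg (h : Gr V) : grSinh (-h) = -grSinh h := by
  rw [grSinh, grSinh, neg_neg]; module

theorem grCosh_mem {h : Gr V} (hh : h ∈ parity V 0) : grCosh h ∈ parity V 0 :=
  Submodule.smul_mem _ _ (add_mem (grExp_mem hh) (grExp_mem (neg_mem hh)))

theorem grSinh_mem {h : Gr V} (hh : h ∈ parity V 0) : grSinh h ∈ parity V 0 :=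
  Submodule.smul_mem _ _ (sub_mem (grExp_mem hh) (grExp_mem (neg_mem hh)))

theorem grCosh_sq_sub {h : Gr V} (hh : h ∈ parity V 0) :
    grCosh h * grCosh h - grSinh h * grSinh h = 1 := by
  have h1 := grExp_mul_neg hh
  have h2 : grExp (-h) * grExp h = 1 := by
    rw [← h1, (even_commute (grExp_mem hh) _).eq]
  simp only [grCosh, grSinh, smul_mul_smul_comm, add_mul, mul_add, sub_mul, mul_sub, h1, h2]
  module

theorem expA_eq (h : Gr V) : expA q h = Matrix.fromBlocks
    !![grCosh h, grSinh h; grSinh h, grCosh h] 0 0 1 := rfl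

@[simp] theorem expA_zero_zero (h : Gr V) : expA q h (inl 0) (inl 0) = grCosh h := rfl

@[simp] theorem expA_zero_one (h : Gr V) : expA q h (inl 0) (inl 1) = grSinh h := rfl

@[simp] theorem expA_one_zero (h : Gr V) : expA q h (inl 1) (inl 0) = grSinh h := rfl

@[simp] theorem expA_one_one (h : Gr V) : expA q h (inl 1) (inl 1) = grCosh h := rfl

@[simp] theorem expA_inl_inr (h : Gr V) (a : Fin 2) (j : Fin 2 × Fin q) :
    expA q h (inl a) (inr j) = 0 := rfl

@[simp] theorem expA_inr_inl (h : Gr V) (a : Fin 2) (j : Fin 2 × Fin q) :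
    expA q h (inr j) (inl a) = 0 := rfl

theorem expA_inr_inr (h : Gr V) : (expA q h).toBlocks₂₂ = 1 := by rw [expA_eq]; simp

theorem isOSpPt_expA {h : Gr V} (hh : h ∈ parity V 0) : IsOSpPt (expA q h) := by
  have hC := grCosh_mem hh
  have hS := grSinh_mem hh
  refine ⟨⟨fun i j => ?_, fun i j => zero_mem _, fun i j => zero_mem _, fun i j => ?_⟩, ?_⟩
  · fin_cases i <;> fin_cases j
    exacts [hC, hS, hS, hC]
  · rw [expA_inr_inr, Matrix.one_apply]
    split_ifs
    exacts [one_mem_parity, zero_mem _]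
  · have h1 := grCosh_sq_sub hh
    have h2 := (even_commute hC (grSinh h)).eq
    rw [expA_eq, superTranspose_fromBlocks, formJ, Matrix.fromBlocks_multiply,
      Matrix.fromBlocks_multiply]
    congr 1
    · ext i j
      fin_cases i <;> fin_cases j <;> simp [Matrix.mul_apply, Fin.sum_univ_two, h2]
      · rw [← h1]; abel
      · rw [← h1]; abel
    · simp
    · simp
    · simp

theorem expA_mul_expA_neg {h : Gr V} (hh : h ∈ parity V 0) :
    expA q h * expA q (-h) = 1 := by
  have h1 := grCosh_sq_sub hh
  have h2 := (even_commute (grCosh_mem hh) (grSinh h)).eq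
  rw [expA_eq, expA_eq, Matrix.fromBlocks_multiply, ← Matrix.fromBlocks_one, grCosh_neg,
    grSinh_neg]
  congr 1
  · ext i j
    fin_cases i <;> fin_cases j <;> simp [h2]
    · rw [← h1]; abel
    · rw [← h1]; abel
  · simp
  · simp
  · simp

theorem map_expA {φ : Gr V →ₐ[ℂ] Gr W} (hφ : IsSuperHom φ) {h : Gr V} (hh : h ∈ parity V 0) :
    (expA q h).map φ = expA q (φ h) := by
  have hC : φ (grCosh h) = grCosh (φ h) := by
    rw [grCosh, map_smul, map_add, map_grExp hφ hh, map_grExp hφ (neg_mem hh), map_neg, grCosh]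
  have hS : φ (grSinh h) = grSinh (φ h) := by
    rw [grSinh, map_smul, map_sub, map_grExp hφ hh, map_grExp hφ (neg_mem hh), map_neg, grSinh]
  ext (i | i) (j | j)
  · fin_cases i <;> fin_cases j
    exacts [hC, hS, hS, hC]
  · simp
  · simp
  · simp [expA_eq, Matrix.one_apply]

/-! ### The root space and its exponentials -/

section Root

variable {R : Type} [Ring R]

/-- The supermatrices with `[h₀, x] = x`. -/
def rootMat (w u : Fin 2 × Fin q → R) : SMat q (R) :=
  Matrix.fromBlocks 0 (Matrix.of fun _ j => w j)
    (Matrix.of fun i a => if a = 0 then u i else -u i) 0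

theorem mul_hZero_apply (m : SMat q (R)) (i j : Fin 2 ⊕ (Fin 2 × Fin q)) :
    (m * hZero q (R)) i j =
      if j = inl 0 then m i (inl 1) else if j = inl 1 then m i (inl 0) else 0 := by
  rcases j with j | j
  · fin_cases j <;>
      simp [Matrix.mul_apply, hZero, Fintype.sum_sum_type, Fin.sum_univ_two]
  · simp [Matrix.mul_apply, hZero, Fintype.sum_sum_type]

theorem hZero_mul_apply (m : SMat q (R)) (i j : Fin 2 ⊕ (Fin 2 × Fin q)) :
    (hZero q (R) * m) i j =
      if i = inl 0 then m (inl 1) j else if i = inl 1 then m (inl 0) j else 0 := by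
  rcases i with i | i
  · fin_cases i <;>
      simp [Matrix.mul_apply, hZero, Fintype.sum_sum_type, Fin.sum_univ_two]
  · simp [Matrix.mul_apply, hZero, Fintype.sum_sum_type]

/-- These are the eigenvector equations for the commutator with h₀ on the upper left block. Its
eigenvalues there are 0 and ±2, so 1 does not occur. -/
theorem eq_zero_of_rotated_sub {E : Type} [AddCommGroup E] [Module ℂ E] {a b c d : E}
    (ha : c - b = a) (hb : d - a = b) (hc : a - d = c) (hd : b - c = d) :
    a = 0 ∧ b = 0 ∧ c = 0 ∧ d = 0 := by
  have hc' : c = -b := by rw [← hc, ← hb]; abel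
  have hd' : d = b + b := by rw [← hd, hc']; abel
  have ha' : a = -(b + b) := by rw [← ha, hc']; abel
  have h3 : (3 : ℂ) • b = 0 := by
    have : (3 : ℂ) • b = d - a - b := by rw [hd', ha']; module
    rw [this, hb, sub_self]
  have hb0 := (smul_eq_zero.mp h3).resolve_left three_ne_zero
  simp [ha', hc', hd', hb0]

theorem eq_rootMat [Algebra ℂ R] {x : SMat q (R)}
    (hx : hZero q (R) * x - x * hZero q (R) = x) :
    x = rootMat (fun j => x (inl 0) (inr j)) (fun i => x (inr i) (inl 0)) := by
  have e : ∀ i j, (if i = inl 0 then x (inl 1) j else if i = inl 1 then x (inl 0) j else 0) -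
      (if j = inl 0 then x i (inl 1) else if j = inl 1 then x i (inl 0) else 0) = x i j := by
    intro i j
    rw [← mul_hZero_apply, ← hZero_mul_apply, ← Matrix.sub_apply, hx]
  have e00 := e (inl 0) (inl 0)
  have e01 := e (inl 0) (inl 1)
  have e10 := e (inl 1) (inl 0)
  have e11 := e (inl 1) (inl 1)
  simp at e00 e01 e10 e11
  obtain ⟨z00, z01, z10, z11⟩ := eq_zero_of_rotated_sub e00 e01 e10 e11
  ext (i | i) (j | j)
  · obtain rfl | rfl := fin_two_cases i <;> obtain rfl | rfl := fin_two_cases j <;>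
      simp [rootMat, z00, z01, z10, z11]
  · have := e (inl 1) (inr j)
    simp at this
    obtain rfl | rfl := fin_two_cases i <;> simp [rootMat, this]
  · have := e (inr i) (inl 0)
    simp at this
    obtain rfl | rfl := fin_two_cases j
    · simp [rootMat]
    · simp [rootMat, ← this]
  · have := e (inr i) (inr j)
    simp at this
    simp [rootMat, ← this]

theorem isOsp_rootMat (w : Fin 2 × Fin q → R) : IsOsp (rootMat w (symp w)) := by
  have h2 : ∀ j, ∑ i, symp w i * symp (fun k => if k = j then (1 : R) else 0) i = w j :=
    fun j => by rw [sum_mul_symp_single, symp_symp]; simp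
  have hR : ∀ (i : Fin 2 ⊕ (Fin 2 × Fin q)) j, (formJ q (R) * rootMat w (symp w)) i j =
      (formJ q (R)).mulVec (fun k => rootMat w (symp w) k j) i := fun _ _ => rfl
  have hL : ∀ (i : Fin 2 ⊕ (Fin 2 × Fin q)) j,
      (superTranspose (rootMat w (symp w)) * formJ q (R)) i j =
      ∑ a, superTranspose (rootMat w (symp w)) i (inl a) * formJ q (R) (inl a) j +
      ∑ k, superTranspose (rootMat w (symp w)) i (inr k) * formJ q (R) (inr k) j :=
    fun _ _ => by rw [Matrix.mul_apply, Fintype.sum_sum_type]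
  have hneg : ∀ i, symp (fun k => -symp w k) i = w i := fun i => by
    have h1 : symp (fun k => -symp w k) i = symp (symp (-w)) i := by
      congr 1; ext ⟨a, j⟩; fin_cases a <;> simp
    rw [h1, symp_symp]; simp
  have hss : ∀ i, symp (fun k => symp w k) i = -w i := fun i => congrFun (symp_symp w) i
  ext i j
  rw [Matrix.add_apply, hL, hR]
  rcases i with i | i <;> rcases j with j | j
  · obtain rfl | rfl := fin_two_cases i <;> obtain rfl | rfl := fin_two_cases j <;>
      simp only [formJ_mulVec_inl_zero, formJ_mulVec_inl_one] <;>
      simp [superTranspose, rootMat, Matrix.toBlocks₁₁, Matrix.toBlocks₂₁, formJ]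
  · obtain rfl | rfl := fin_two_cases i <;>
      simp [superTranspose, rootMat, formJ_mulVec_inl_zero, formJ_mulVec_inl_one,
        Matrix.toBlocks₁₁, Matrix.toBlocks₂₁, formJ_inr_inr, h2]
  · obtain rfl | rfl := fin_two_cases j <;>
      simp only [formJ_mulVec_inr] <;>
      simp [superTranspose, rootMat, hneg, hss, Matrix.toBlocks₁₂, Matrix.toBlocks₂₂, formJ]
  · have h0 : symp (fun _ : Fin 2 × Fin q => (0 : R)) = 0 := by
      ext ⟨a, k⟩; fin_cases a <;> simp
    simp only [formJ_mulVec_inr]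
    simp [superTranspose, rootMat, h0, Matrix.toBlocks₁₂, Matrix.toBlocks₂₂, formJ]

theorem commutator_rootMat (w u : Fin 2 × Fin q → R) :
    hZero q (R) * rootMat w u - rootMat w u * hZero q (R) = rootMat w u := by
  ext i j
  rw [Matrix.sub_apply, mul_hZero_apply, hZero_mul_apply]
  rcases i with i | i <;> rcases j with j | j
  · obtain rfl | rfl := fin_two_cases i <;> obtain rfl | rfl := fin_two_cases j <;>
      simp [rootMat]
  · obtain rfl | rfl := fin_two_cases i <;> simp [rootMat]
  · obtain rfl | rfl := fin_two_cases j <;> simp [rootMat]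
  · simp [rootMat]

end Root

theorem rootMat_sq (w u : Fin 2 × Fin q → Gr V) : rootMat w u ^ 2 =
    Matrix.fromBlocks (Matrix.of fun _ b => if b = 0 then ∑ i, w i * u i else -∑ i, w i * u i)
      0 0 0 := by
  rw [pow_two, rootMat, Matrix.fromBlocks_multiply]
  congr 1
  · ext a b
    obtain rfl | rfl := fin_two_cases b <;> simp [Matrix.mul_apply]
  · simp
  · simp
  · ext i j
    simp [Matrix.mul_apply, Fin.sum_univ_two]

theorem rootMat_cube (w u : Fin 2 × Fin q → Gr V) : rootMat w u ^ 3 = 0 := by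
  rw [pow_succ, rootMat_sq, rootMat, Matrix.fromBlocks_multiply, ← Matrix.fromBlocks_zero]
  congr 1
  · simp
  · ext a j
    simp [Matrix.mul_apply, Fin.sum_univ_two]
  · simp
  · simp

theorem nilExp_rootMat (w u : Fin 2 × Fin q → Gr V) :
    nilExp (rootMat w u) = 1 + rootMat w u + (2⁻¹ : ℂ) • rootMat w u ^ 2 := by
  rw [nilExp_eq_sum (rootMat_cube w u), Finset.sum_range_succ, Finset.sum_range_succ,
    Finset.sum_range_succ]
  simp

theorem rootMat_neg (w u : Fin 2 × Fin q → Gr V) : rootMat (-w) (-u) = -rootMat w u := by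
  ext (i | i) (j | j)
  · simp [rootMat]
  · simp [rootMat]
  · obtain rfl | rfl := fin_two_cases j <;> simp [rootMat]
  · simp [rootMat]

theorem isEvenSMat_rootMat {w u : Fin 2 × Fin q → Gr V} (hw : ∀ i, w i ∈ parity V 1)
    (hu : ∀ i, u i ∈ parity V 1) : IsEvenSMat q V (rootMat w u) := by
  rw [isEvenSMat_iff]
  rintro (i | i) (j | j)
  · simp [rootMat]
  · simpa [rootMat, deg] using hw j
  · obtain rfl | rfl := fin_two_cases j <;> simpa [rootMat, deg] using hu i
  · simp [rootMat]

theorem nilExp_rootMat_mem_ptsN {w : Fin 2 × Fin q → Gr V} (hw : ∀ i, w i ∈ parity V 1) :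
    nilExp (rootMat w (symp w)) ∈ ptsN q V :=
  ⟨_, isEvenSMat_rootMat hw (symp_mem hw), isOsp_rootMat w, commutator_rootMat _ _, rfl⟩

theorem superTranspose_add {R : Type} [Ring R] (x y : SMat q R) :
    superTranspose (x + y) = superTranspose x + superTranspose y := by
  ext (i | i) (j | j) <;> simp [superTranspose, Matrix.toBlocks₁₁, Matrix.toBlocks₁₂,
    Matrix.toBlocks₂₁, Matrix.toBlocks₂₂, add_comm]

theorem superTranspose_smul (c : ℂ) (x : SMat q (Gr V)) :
    superTranspose (c • x) = c • superTranspose x := by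
  ext (i | i) (j | j) <;> simp [superTranspose, Matrix.toBlocks₁₁, Matrix.toBlocks₁₂,
    Matrix.toBlocks₂₁, Matrix.toBlocks₂₂]

theorem IsEvenSMat.add {x y : SMat q (Gr V)} (hx : IsEvenSMat q V x) (hy : IsEvenSMat q V y) :
    IsEvenSMat q V (x + y) := by
  rw [isEvenSMat_iff] at *
  exact fun i j => add_mem (hx i j) (hy i j)

theorem IsEvenSMat.smul {x : SMat q (Gr V)} (hx : IsEvenSMat q V x) (c : ℂ) :
    IsEvenSMat q V (c • x) := by
  rw [isEvenSMat_iff] at *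
  exact fun i j => Submodule.smul_mem _ _ (hx i j)

theorem isOSpPt_nilExp_rootMat {w : Fin 2 × Fin q → Gr V} (hw : ∀ i, w i ∈ parity V 1) :
    IsOSpPt (nilExp (rootMat w (symp w))) := by
  have hx := isEvenSMat_rootMat hw (symp_mem hw)
  have ho := isOsp_rootMat w
  have hn : IsNilpotent (rootMat w (symp w)) := ⟨3, rootMat_cube _ _⟩
  have hneg : nilExp (-rootMat w (symp w)) =
      1 - rootMat w (symp w) + (2⁻¹ : ℂ) • rootMat w (symp w) ^ 2 := by
    rw [← rootMat_neg, nilExp_rootMat, rootMat_neg, neg_sq]; abel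
  have hpos := nilExp_rootMat w (symp w)
  set x := rootMat w (symp w) with hxd
  refine ⟨?_, ?_⟩
  · rw [hpos, pow_two]
    exact (isEvenSMat_one.add hx).add ((hx.mul hx).smul _)
  · have h1 : superTranspose x * formJ q (Gr V) = -(formJ q (Gr V) * x) :=
      eq_neg_of_add_eq_zero_left ho
    have h2 : superTranspose (nilExp x) * formJ q (Gr V) = formJ q (Gr V) * nilExp (-x) := by
      rw [hneg, hpos, superTranspose_add, superTranspose_add, superTranspose_smul, pow_two,
        superTranspose_mul hx hx, superTranspose_one, add_mul, add_mul, Matrix.smul_mul, mul_assoc,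
        h1, mul_neg, ← mul_assoc, h1, neg_mul, neg_neg, mul_add, mul_sub, Matrix.mul_smul, one_mul,
        mul_one, mul_assoc, sub_eq_add_neg]
    have h3 : nilExp (-x) * nilExp x = 1 := by
      have := nilExp_mul_neg hn.neg
      rwa [neg_neg] at this
    rw [h2, mul_assoc, h3, mul_one]

/-- For a first row (a, a', 0) the form gives a² - a'² = 1. Together with a + a' = 1 this gives a -
a' = 1, hence a = 1 and a' = 0. The first column follows because the inverse is read off from the
supertranspose. -/
theorem IsOSpPt.fixesFirst [FiniteDimensional ℂ V] {k : SMat q (Gr V)} (hk : IsOSpPt k)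
    (h0 : ∀ j, k (inl 0) (inr j) = 0) (h1 : k (inl 0) (inl 0) + k (inl 0) (inl 1) = 1) :
    FixesFirst k := by
  set y := formJInv q (Gr V) * superTranspose k * formJ q (Gr V) with hy
  have hky : k * y = 1 := hk.mul_inv
  have hJy : formJ q (Gr V) * y = superTranspose k * formJ q (Gr V) := by
    rw [hy, ← mul_assoc, ← mul_assoc, formJ_mul_formJInv, one_mul]
  have hJ : ∀ i, (formJ q (Gr V)).mulVec (fun j => y j (inl 0)) i =
      superTranspose k i (inl 0) * -1 := fun i => by
    have := congrFun (congrFun hJy i) (inl 0)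
    refine this.trans ?_
    rw [Matrix.mul_apply, Fintype.sum_sum_type, Fin.sum_univ_two]
    simp [formJ]
  have y0 : y (inl 0) (inl 0) = k (inl 0) (inl 0) := by
    have := hJ (inl 0)
    rw [formJ_mulVec_inl_zero, mul_neg_one] at this
    exact neg_inj.mp this
  have y1 : y (inl 1) (inl 0) = -k (inl 0) (inl 1) := by
    have := hJ (inl 1)
    rwa [formJ_mulVec_inl_one, mul_neg_one] at this
  have y2 : ∀ j, y (inr j) (inl 0) = 0 := by
    have h2 : symp (fun j => y (inr j) (inl 0)) = 0 := by
      ext i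
      have := hJ (inr i)
      rw [formJ_mulVec_inr] at this
      rw [this]
      change -k (inl 0) (inr i) * -1 = 0
      rw [h0]; simp
    intro j
    have h3 := congrFun (symp_symp fun j => y (inr j) (inl 0)) j
    rw [h2] at h3
    have h4 : symp (0 : Fin 2 × Fin q → Gr V) j = 0 := by
      obtain ⟨a, l⟩ := j; obtain rfl | rfl := fin_two_cases a <;> simp
    rw [h4] at h3
    exact neg_eq_zero.mp h3.symm
  have hn : k (inl 0) (inl 0) - k (inl 0) (inl 1) = 1 := by
    have := congrFun (congrFun hky (inl 0)) (inl 0)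
    rw [Matrix.mul_apply, Fintype.sum_sum_type, Fin.sum_univ_two] at this
    simp only [y0, y1, y2, mul_zero, Finset.sum_const_zero, add_zero, Matrix.one_apply_eq] at this
    have hc := (even_commute (hk.1.1 0 0) (k (inl 0) (inl 1))).eq
    change k (inl 0) (inl 0) * k (inl 0) (inl 1) =
      k (inl 0) (inl 1) * k (inl 0) (inl 0) at hc
    calc k (inl 0) (inl 0) - k (inl 0) (inl 1)
        = (k (inl 0) (inl 0) + k (inl 0) (inl 1)) * (k (inl 0) (inl 0) - k (inl 0) (inl 1)) := by
          rw [h1, one_mul]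
      _ = k (inl 0) (inl 0) * k (inl 0) (inl 0) + k (inl 0) (inl 1) * -k (inl 0) (inl 1) := by
          rw [add_mul, mul_sub, mul_sub, hc]; noncomm_ring
      _ = 1 := this
  have hz : k (inl 0) (inl 1) = 0 := by
    have : (2 : ℂ) • k (inl 0) (inl 1) = 0 := by
      rw [two_smul]
      have e : k (inl 0) (inl 1) + k (inl 0) (inl 1) =
        (k (inl 0) (inl 0) + k (inl 0) (inl 1)) - (k (inl 0) (inl 0) - k (inl 0) (inl 1)) := by abel
      rw [e, h1, hn, sub_self]
    exact (smul_eq_zero.mp this).resolve_left two_ne_zero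
  have ho : k (inl 0) (inl 0) = 1 := by rwa [hz, add_zero] at h1
  refine ⟨?_, fun i => ?_⟩
  · rintro (j | j)
    · obtain rfl | rfl := fin_two_cases j <;> simp [hz, ho]
    · simp [h0]
  · have := congrFun (congrFun hky i) (inl 0)
    rw [← this, Matrix.mul_apply, Fintype.sum_sum_type, Fin.sum_univ_two]
    simp [y0, y1, y2, hz, ho]

/-- The sum of the first two basis vectors is a highest weight vector: N fixes it, and h₀ acts on it
by 1. Pairing it with the first row isolates the factor from A in the Iwasawa decomposition. -/
theorem nilExp_rootMat_sum (w u : Fin 2 × Fin q → Gr V) (i : Fin 2 ⊕ (Fin 2 × Fin q)) :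
    nilExp (rootMat w u) i (inl 0) + nilExp (rootMat w u) i (inl 1) =
      (1 : SMat q (Gr V)) i (inl 0) + (1 : SMat q (Gr V)) i (inl 1) := by
  rw [nilExp_rootMat, rootMat_sq, rootMat]
  rcases i with i | i
  · obtain rfl | rfl := fin_two_cases i <;> simp
  · simp

theorem nilExp_rootMat_inr (w u : Fin 2 × Fin q → Gr V) (i : Fin 2 ⊕ (Fin 2 × Fin q))
    (j : Fin 2 × Fin q) : nilExp (rootMat w u) i (inr j) =
      (1 : SMat q (Gr V)) i (inr j) + Sum.elim (fun _ => w j) 0 i := by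
  rw [nilExp_rootMat, rootMat_sq, rootMat]
  rcases i with i | i
  · obtain rfl | rfl := fin_two_cases i <;> simp
  · simp [Matrix.one_apply]

theorem mul_nilExp_rootMat_sum (x : SMat q (Gr V)) (w u : Fin 2 × Fin q → Gr V)
    (i : Fin 2 ⊕ (Fin 2 × Fin q)) :
    (x * nilExp (rootMat w u)) i (inl 0) + (x * nilExp (rootMat w u)) i (inl 1) =
      x i (inl 0) + x i (inl 1) := by
  rw [Matrix.mul_apply, Matrix.mul_apply, ← Finset.sum_add_distrib]
  simp only [← mul_add, nilExp_rootMat_sum]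
  simp only [mul_add, Finset.sum_add_distrib]
  rw [← Matrix.mul_apply, ← Matrix.mul_apply, mul_one]

theorem mul_nilExp_rootMat_inr (x : SMat q (Gr V)) (w u : Fin 2 × Fin q → Gr V)
    (i : Fin 2 ⊕ (Fin 2 × Fin q)) (j : Fin 2 × Fin q) :
    (x * nilExp (rootMat w u)) i (inr j) =
      x i (inr j) + (x i (inl 0) + x i (inl 1)) * w j := by
  rw [Matrix.mul_apply]
  simp only [nilExp_rootMat_inr, mul_add, Finset.sum_add_distrib]
  rw [← Matrix.mul_apply, mul_one, Fintype.sum_sum_type, Fin.sum_univ_two]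
  simp [add_mul]

/-- The Iwasawa projection is determined by the first row. -/
theorem grExp_of_decomposition {k n : SMat q (Gr V)} {h : Gr V} (hk : k ∈ ptsK q V)
    (hn : n ∈ ptsN q V) : (k * expA q h * n) (inl 0) (inl 0) + (k * expA q h * n) (inl 0) (inl 1) =
      grExp h := by
  obtain ⟨x, -, -, hx, rfl⟩ := hn
  rw [eq_rootMat hx, mul_nilExp_rootMat_sum, (mem_ptsK_iff.mp hk).2.1.row_mul,
    (mem_ptsK_iff.mp hk).2.1.row_mul, expA_zero_zero, expA_zero_one, grCosh_add_grSinh]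

theorem body_grCosh {h : Gr V} (hh : h ∈ parity V 0) :
    body (grCosh h) = Complex.cosh (body h) := by
  rw [grCosh, map_smul, map_add, body_grExp hh, body_grExp (neg_mem hh), map_neg, Complex.cosh,
    smul_eq_mul]
  ring

theorem body_grSinh {h : Gr V} (hh : h ∈ parity V 0) :
    body (grSinh h) = Complex.sinh (body h) := by
  rw [grSinh, map_smul, map_sub, body_grExp hh, body_grExp (neg_mem hh), map_neg, Complex.sinh,
    smul_eq_mul]
  ring

theorem body_nilExp_rootMat {w u : Fin 2 × Fin q → Gr V} (hw : ∀ i, w i ∈ parity V 1)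
    (a b : Fin 2) : body (nilExp (rootMat w u) (inl a) (inl b)) = if a = b then 1 else 0 := by
  have h : ∑ i, body (w i) * body (u i) = 0 :=
    Finset.sum_eq_zero fun i _ => by rw [body_odd (hw i), zero_mul]
  rw [nilExp_rootMat, rootMat_sq, rootMat]
  obtain rfl | rfl := fin_two_cases a <;> obtain rfl | rfl := fin_two_cases b <;>
    simp [h, -Finset.sum_neg_distrib]

/-- The sum c of the first two entries of the first row must be e^h, which fixes h through a
nilpotent logarithm. Stripping off the factors in N and A leaves a matrix to which
`IsOSpPt.fixesFirst` applies. The assumptions on values say that the underlying matrix has the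
hyperbolic block of e^{th₀}. -/
theorem exists_iwasawa [FiniteDimensional ℂ V] {g : SMat q (Gr V)} (hg : IsOSpPt g) {t : ℝ}
    (h00 : body (g (inl 0) (inl 0)) = Complex.cosh t)
    (h01 : body (g (inl 0) (inl 1)) = Complex.sinh t)
    (h10 : body (g (inl 1) (inl 0)) = Complex.sinh t)
    (h11 : body (g (inl 1) (inl 1)) = Complex.cosh t)
    (hu : g.toBlocks₂₂.map body ∈ Matrix.unitaryGroup (Fin 2 × Fin q) ℂ) :
    ∃ h ∈ ptsa V, ∃ k ∈ ptsK q V, ∃ n ∈ ptsN q V, g = k * expA q h * n := by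
  set c := g (inl 0) (inl 0) + g (inl 0) (inl 1) with hc
  have hce : c ∈ parity V 0 := add_mem (hg.1.1 0 0) (hg.1.1 0 1)
  have hcb : body c = Complex.exp t := by rw [hc, map_add, h00, h01, Complex.cosh_add_sinh]
  obtain ⟨d, hd, hcd, hdc⟩ := exists_even_inverse hce (by rw [hcb]; exact Complex.exp_ne_zero _)
  obtain ⟨N, hN, hNn, hNe⟩ := exists_even_log (x := Complex.exp (-t) • c)
    (Submodule.smul_mem _ _ hce) (by rw [map_smul, hcb, smul_eq_mul, ← Complex.exp_add]; simp)
  set h := algebraMap ℂ (Gr V) (t : ℂ) + N with hh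
  have hhe : h ∈ parity V 0 := add_mem (algebraMap_mem_parity _) hN
  have hhb : body h = t := by rw [hh, map_add, body_algebraMap, body_nilpotent hNn, add_zero]
  have hexp : grExp h = c := by
    rw [grExp_eq hh hNn, hNe, smul_smul, ← Complex.exp_add]; simp
  -- Right multiplication by the exponential with parameter -w subtracts c·w from the odd part of
  -- the first row; with d = c⁻¹ this clears it.
  set w : Fin 2 × Fin q → Gr V := fun j => d * g (inl 0) (inr j) with hw
  have hwo : ∀ j, w j ∈ parity V 1 := fun j => even_mul_odd hd (hg.1.2.1 0 j)
  have hwo' : ∀ j, (-w) j ∈ parity V 1 := fun j => neg_mem (hwo j)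
  have hsn : symp (-w) = -symp w := by
    ext ⟨a, j⟩; obtain rfl | rfl := fin_two_cases a <;> simp
  set n' := nilExp (rootMat (-w) (symp (-w))) with hn'
  have hn'o : IsOSpPt n' := isOSpPt_nilExp_rootMat hwo'
  have hnn : n' * nilExp (rootMat w (symp w)) = 1 := by
    have hx : IsNilpotent (rootMat (-w) (symp (-w))) := ⟨3, rootMat_cube _ _⟩
    have := nilExp_mul_neg hx
    have h2 : -symp (-w) = symp w := by rw [hsn, neg_neg]
    rwa [← rootMat_neg, neg_neg, h2] at this
  set k := g * n' * expA q (-h) with hk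
  have hko : IsOSpPt k := (hg.mul hn'o).mul (isOSpPt_expA (neg_mem hhe))
  have hA : expA q (-h) * expA q h = 1 := by
    have := expA_mul_expA_neg (q := q) (neg_mem hhe)
    rwa [neg_neg] at this
  have r2 : ∀ j, (g * n') (inl 0) (inr j) = 0 := fun j => by
    rw [hn', mul_nilExp_rootMat_inr, ← hc, Pi.neg_apply, hw]
    simp only [mul_neg, ← mul_assoc, hcd, one_mul, add_neg_cancel]
  have kF : FixesFirst k := by
    refine hko.fixesFirst (fun j => ?_) ?_
    · rw [hk, Matrix.mul_apply, Fintype.sum_sum_type]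
      simp [r2]
    · rw [hk, Matrix.mul_apply, Matrix.mul_apply, Fintype.sum_sum_type, Fintype.sum_sum_type]
      simp only [r2, zero_mul, Finset.sum_const_zero, add_zero, Fin.sum_univ_two,
        expA_zero_zero, expA_zero_one, expA_one_zero, expA_one_one]
      rw [add_add_add_comm, ← mul_add, ← mul_add, grCosh_add_grSinh,
        add_comm (grSinh (-h)), grCosh_add_grSinh, ← add_mul, hn', mul_nilExp_rootMat_sum, ← hc,
        ← hexp, grExp_mul_neg hhe]
  have hgn : IsEvenSMat q V (g * n') := hg.1.mul hn'o.1
  have kK : k ∈ ptsK q V := by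
    refine mem_ptsK_iff.mpr ⟨hko, kF, ?_, ?_⟩
    · rw [hk, body_mul_inl_inl hgn, body_mul_inl_inl hg.1, body_mul_inl_inl hg.1, hn']
      simp only [body_nilExp_rootMat hwo', h10, h11, expA_zero_one, expA_one_one,
        body_grSinh (neg_mem hhe), body_grCosh (neg_mem hhe), map_neg, hhb, Complex.sinh_neg,
        Complex.cosh_neg]
      have := Complex.cosh_sq_sub_sinh_sq t
      simp
      linear_combination this
    · rw [hk, body_mul_inr_inr hgn, body_mul_inr_inr hg.1, expA_inr_inr]
      have h1 : n'.toBlocks₂₂ = 1 := by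
        ext i j
        change n' (inr i) (inr j) = _
        rw [hn', nilExp_rootMat_inr]
        simp [Matrix.one_apply]
      have h2 : (1 : Matrix (Fin 2 × Fin q) (Fin 2 × Fin q) (Gr V)).map body = 1 :=
        Matrix.map_one _ (map_zero _) (map_one _)
      rw [h1, h2, mul_one, mul_one]
      exact hu
  refine ⟨h, ⟨hhe, by rw [hhb, Complex.ofReal_im]⟩, k, kK, _, nilExp_rootMat_mem_ptsN hwo, ?_⟩
  rw [hk, mul_assoc (g * n'), hA, mul_one, mul_assoc, hnn, mul_one]

/-- The Iwasawa projection on `e^{t h₀} K`. -/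
theorem iwasawaH_spec [FiniteDimensional ℂ V] {k : SMat q (Gr V)} (hk : k ∈ ptsK q V) (t : ℝ) :
    let H := iwasawaH q (expA q (algebraMap ℂ (Gr V) (t : ℂ)) * k)
    H ∈ parity V 0 ∧ body H = t ∧ grExp H = Complex.exp t •
      (1 + ((1 - Complex.exp (-2 * t)) / 2) • (k (inl 1) (inl 1) - 1)) := by
  intro H
  obtain ⟨hk1, hk2, hk3, hk4⟩ := mem_ptsK_iff.mp hk
  set g := expA q (algebraMap ℂ (Gr V) (t : ℂ)) * k with hg
  have hte := algebraMap_mem_parity (V := V) (t : ℂ)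
  have hgo : IsOSpPt g := (isOSpPt_expA hte).mul hk1
  have hC : body (grCosh (algebraMap ℂ (Gr V) (t : ℂ))) = Complex.cosh t := by
    rw [body_grCosh hte, body_algebraMap]
  have hS : body (grSinh (algebraMap ℂ (Gr V) (t : ℂ))) = Complex.sinh t := by
    rw [body_grSinh hte, body_algebraMap]
  have k00 : k (inl 0) (inl 0) = 1 := by rw [hk2.1]; simp
  have k01 : k (inl 0) (inl 1) = 0 := by rw [hk2.1]; simp
  have k10 : k (inl 1) (inl 0) = 0 := by rw [hk2.2]; simp
  have hex : ∃ h ∈ ptsa V, ∃ k ∈ ptsK q V, ∃ n ∈ ptsN q V, g = k * expA q h * n := by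
    refine exists_iwasawa hgo (t := t) ?_ ?_ ?_ ?_ ?_
    iterate 4
      rw [hg, body_mul_inl_inl (isOSpPt_expA hte).1]
      simp [k00, k01, k10, hk3, hC, hS]
    rw [hg, body_mul_inr_inr (isOSpPt_expA hte).1, expA_inr_inr,
      Matrix.map_one _ (map_zero _) (map_one _), one_mul]
    exact hk4
  have hH : H = hex.choose := by
    change iwasawaH q g = _
    rw [iwasawaH, dif_pos hex]
  obtain ⟨⟨h1, h2⟩, k', hk', n, hn, he⟩ := hex.choose_spec
  rw [← hH] at h1 h2 he
  -- The definition chooses some decomposition, not necessarily the one constructed above; the first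
  -- row determines e^H for every choice.
  have hsum : grExp H = g (inl 0) (inl 0) + g (inl 0) (inl 1) := by
    rw [← grExp_of_decomposition hk' hn, ← he]
  have hval : grExp H = Complex.exp t •
      (1 + ((1 - Complex.exp (-2 * t)) / 2) • (k (inl 1) (inl 1) - 1)) := by
    have e1 : Complex.exp t * ((1 - Complex.exp (-2 * t)) / 2) = Complex.sinh t := by
      rw [mul_div_assoc', mul_sub, ← Complex.exp_add, Complex.sinh]
      ring_nf
    have e2 : grCosh (algebraMap ℂ (Gr V) (t : ℂ)) = Complex.cosh t • (1 : Gr V) := by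
      rw [grCosh, ← map_neg, grExp_algebraMap, grExp_algebraMap, ← map_add,
        Algebra.algebraMap_eq_smul_one, smul_smul, Complex.cosh]
      congr 1; ring
    have e3 : grSinh (algebraMap ℂ (Gr V) (t : ℂ)) = Complex.sinh t • (1 : Gr V) := by
      rw [grSinh, ← map_neg, grExp_algebraMap, grExp_algebraMap, ← map_sub,
        Algebra.algebraMap_eq_smul_one, smul_smul, Complex.sinh]
      congr 1; ring
    rw [hsum, hg, Matrix.mul_apply, Matrix.mul_apply, Fintype.sum_sum_type, Fintype.sum_sum_type]
    simp only [Fin.sum_univ_two, expA_zero_zero, expA_zero_one, expA_inl_inr, zero_mul,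
      Finset.sum_const_zero, add_zero, k00, k01, k10, mul_one, mul_zero, zero_add, e2, e3]
    rw [smul_add, smul_smul, e1, ← Complex.cosh_add_sinh, smul_mul_assoc, one_mul, smul_sub,
      add_smul]
    abel
  refine ⟨h1, ?_, hval⟩
  -- The exponential fixes the value of H only modulo 2πi; the reality condition in `ptsa` removes
  -- the ambiguity.
  have hb : Complex.exp (body H) = Complex.exp t := by
    rw [← body_grExp h1, hval]
    simp [hk3]
  have hre : body H = ((body H).re : ℂ) := Complex.ext rfl (by simpa using h2)
  rw [hre, ← Complex.ofReal_exp, ← Complex.ofReal_exp, Complex.ofReal_inj,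
    Real.exp_eq_exp] at hb
  rw [hre, hb]

end Iwasawa

/-! ### The invariant quadratic form in the odd coordinates -/

section CoordForm

theorem add_pow_succ_of_sq_eq_zero {A : Type} [Ring A] {x p : A} (h : Commute x p) (hp : p * p = 0)
    (n : ℕ) : (x + p) ^ (n + 1) = x ^ (n + 1) + (n + 1) • (x ^ n * p) := by
  induction n with
  | zero => simp
  | succ n ih =>
    have h1 : x ^ n * p * p = 0 := by rw [mul_assoc, hp, mul_zero]
    have h2 : x ^ n * p * x = x ^ (n + 1) * p := by rw [mul_assoc, ← h.eq, ← mul_assoc, pow_succ]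
    rw [pow_succ, ih, add_mul, mul_add, smul_mul_assoc, mul_add, h1, h2, add_zero, ← pow_succ,
      add_assoc, add_comm (x ^ (n + 1) * p), ← succ_nsmul]

variable {q : ℕ}

/-- The product of the two odd coordinates of a symplectic plane. -/
def planeForm (j : Fin q) : Gr (Coord (2 * q)) := coordCol q (0, j) * coordCol q (1, j)

theorem planeForm_mem (j : Fin q) : planeForm j ∈ parity (Coord (2 * q)) 0 :=
  odd_mul_odd (coordCol_mem _) (coordCol_mem _)

theorem coordForm_eq : coordForm q = (2 : ℂ) • ∑ j : Fin q, planeForm j := by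
  rw [coordForm, sympForm, Fintype.sum_prod_type, Fin.sum_univ_two, ← Finset.sum_add_distrib,
    Finset.smul_sum]
  refine Finset.sum_congr rfl fun j _ => ?_
  rw [symp_zero, symp_one, mul_neg, odd_mul_odd_swap (coordCol_mem (1, j)) (coordCol_mem (0, j)),
    neg_neg, two_smul, planeForm]

theorem planeForm_mul_coordCol (a : Fin 2) (j : Fin q) : planeForm j * coordCol q (a, j) = 0 := by
  obtain rfl | rfl := fin_two_cases a
  · rw [planeForm, mul_assoc, odd_mul_odd_swap (coordCol_mem (1, j)) (coordCol_mem (0, j)), mul_neg,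
      ← mul_assoc, odd_sq (coordCol_mem _), zero_mul, neg_zero]
  · rw [planeForm, mul_assoc, odd_sq (coordCol_mem _), mul_zero]

theorem planeForm_sq (j : Fin q) : planeForm j * planeForm j = 0 := by
  change planeForm j * (coordCol q (0, j) * coordCol q (1, j)) = 0
  rw [← mul_assoc, planeForm_mul_coordCol, zero_mul]

/-- A product of more factors than there are planes repeats one of them, and each plane form has
square zero. -/
theorem sum_planeForm_pow_eq_zero (s : Finset (Fin q)) : (∑ j ∈ s, planeForm j) ^ (s.card + 1) = 0 := by
  induction s using Finset.induction_on with
  | empty => simp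
  | insert j s hj ih =>
    rw [Finset.sum_insert hj, Finset.card_insert_of_notMem hj, add_comm (planeForm j),
      add_pow_succ_of_sq_eq_zero (even_commute (planeForm_mem j) _).symm (planeForm_sq j), ih,
      pow_succ, ih, zero_mul, zero_mul, smul_zero, add_zero]

theorem coordForm_pow_succ : coordForm q ^ (q + 1) = 0 := by
  have := sum_planeForm_pow_eq_zero (Finset.univ : Finset (Fin q))
  rw [Finset.card_univ, Fintype.card_fin] at this
  rw [coordForm_eq, smul_pow, this, smul_zero]

/-- A coordinate kills the form of its own plane, and the sum over the other q - 1 planes already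
has vanishing q-th power. Thus τ^q has top degree. -/
theorem coordForm_pow_mul_coordCol (i : Fin 2 × Fin q) : coordForm q ^ q * coordCol q i = 0 := by
  obtain ⟨a, j⟩ := i
  have h1 : ∑ j : Fin q, planeForm j = ∑ l ∈ Finset.univ.erase j, planeForm l + planeForm j :=
    (Finset.sum_erase_add _ _ (Finset.mem_univ j)).symm
  have h2 := sum_planeForm_pow_eq_zero ((Finset.univ : Finset (Fin q)).erase j)
  have hq : q - 1 + 1 = q := Nat.sub_add_cancel (Fin.pos j)
  rw [Finset.card_erase_of_mem (Finset.mem_univ j), Finset.card_univ, Fintype.card_fin] at h2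
  have h3 := add_pow_succ_of_sq_eq_zero (even_commute (planeForm_mem j)
    (∑ l ∈ Finset.univ.erase j, planeForm l)).symm (planeForm_sq j) (q - 1)
  rw [h2, zero_add, hq, ← h1] at h3
  rw [coordForm_eq, smul_pow, h3, smul_mul_assoc, smul_mul_assoc, mul_assoc,
    planeForm_mul_coordCol, mul_zero, smul_zero, smul_zero]

/-- The derivative with respect to a coordinate. -/
abbrev coordDel (i : Fin 2 × Fin q) : Gr (Coord (2 * q)) →ₗ[ℂ] Gr (Coord (2 * q)) :=
  del (coordDual (idx q i))

theorem coordDel_coordCol (i j : Fin 2 × Fin q) :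
    coordDel i (coordCol q j) = if i = j then 1 else 0 := by
  rw [coordCol, oddCoord, del_ι, coordDual_single]
  by_cases h : i = j
  · simp [h]
  · rw [if_neg (fun e => h ((idx q).injective e)), if_neg h, map_zero]

theorem del_pow_eq_zero {U : Type} [AddCommGroup U] [Module ℂ U] {d : Module.Dual ℂ U} {x : Gr U}
    (h : del d x = 0) (n : ℕ) : del d (x ^ n) = 0 := by
  induction n with
  | zero => rw [pow_zero, ← map_one (algebraMap ℂ (Gr U)), del_algebraMap]
  | succ n ih => rw [pow_succ, del_mul, ih, h, zero_mul, mul_zero, add_zero]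

theorem coordDel_planeForm_of_ne (a : Fin 2) {j l : Fin q} (h : j ≠ l) :
    coordDel (a, j) (planeForm l) = 0 := by
  rw [planeForm, del_mul, coordDel_coordCol, coordDel_coordCol, if_neg (by simp [h]),
    if_neg (by simp [h]), zero_mul, mul_zero, add_zero]

/-- In the expansion only one term survives, a positive multiple of the power for one plane fewer
times the new plane form. Differentiating in the two directions of the new plane strips that form
off. -/
theorem sum_planeForm_pow_ne_zero (s : Finset (Fin q)) : (∑ j ∈ s, planeForm j) ^ s.card ≠ 0 := by
  induction s using Finset.induction_on with
  | empty => simp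
  | insert j s hj ih =>
    rw [Finset.sum_insert hj, Finset.card_insert_of_notMem hj, add_comm (planeForm j),
      add_pow_succ_of_sq_eq_zero (even_commute (planeForm_mem j) _).symm (planeForm_sq j),
      sum_planeForm_pow_eq_zero, zero_add]
    set x := ∑ j ∈ s, planeForm j with hx
    have hxe : x ∈ parity (Coord (2 * q)) 0 := sum_mem fun l _ => planeForm_mem l
    have hd : ∀ a, coordDel (a, j) (x ^ s.card) = 0 := fun a => by
      refine del_pow_eq_zero ?_ _
      rw [hx, map_sum]
      exact Finset.sum_eq_zero fun l hl => coordDel_planeForm_of_ne a fun e => hj (e ▸ hl)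
    intro h0
    have h1 : x ^ s.card * planeForm j = 0 := by
      rw [← Nat.cast_smul_eq_nsmul ℂ] at h0
      exact (smul_eq_zero.mp h0).resolve_left (Nat.cast_ne_zero.mpr (Nat.succ_ne_zero _))
    have h2 := congrArg (coordDel (0, j)) h1
    rw [del_mul, hd, zero_mul, zero_add, inv_even (pow_mem_parity hxe _), planeForm, del_mul,
      coordDel_coordCol, coordDel_coordCol, if_pos rfl, if_neg (by simp), mul_zero, add_zero,
      one_mul, map_zero] at h2
    have h3 := congrArg (coordDel (1, j)) h2
    rw [del_mul, hd, zero_mul, zero_add, inv_even (pow_mem_parity hxe _), coordDel_coordCol,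
      if_pos rfl, mul_one, map_zero] at h3
    exact ih h3

theorem berezin_coordForm_pow_ne_zero (q : ℕ) : berezin (coordForm q ^ q) ≠ 0 := by
  refine berezin_ne_zero ?_ fun i => ?_
  · have := sum_planeForm_pow_ne_zero (Finset.univ : Finset (Fin q))
    rw [Finset.card_univ, Fintype.card_fin] at this
    rw [coordForm_eq, smul_pow]
    exact smul_ne_zero (pow_ne_zero _ two_ne_zero) this
  · have := coordForm_pow_mul_coordCol ((idx q).symm i)
    rwa [coordCol, Equiv.apply_symm_apply] at this

theorem coordForm_pow_mul (a : Gr (Coord (2 * q))) :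
    coordForm q ^ q * a = body a • coordForm q ^ q := by
  induction a using ExteriorAlgebra.induction with
  | algebraMap r => rw [body_algebraMap, ← Algebra.commutes, ← Algebra.smul_def]
  | ι v =>
    rw [body_ι, zero_smul, ι_eq_sum, Finset.mul_sum]
    refine Finset.sum_eq_zero fun i _ => ?_
    have := coordForm_pow_mul_coordCol ((idx q).symm i)
    rw [coordCol, Equiv.apply_symm_apply] at this
    rw [mul_smul_comm, this, smul_zero]
  | mul x y hx hy => rw [← mul_assoc, hx, smul_mul_assoc, hy, smul_smul, map_mul]
  | add x y hx hy => rw [mul_add, hx, hy, map_add, add_smul]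

end CoordForm

/-! ### The action of `K` on the standard chart -/

section Action

variable {q : ℕ} {V W U : Type} [AddCommGroup V] [Module ℂ V] [AddCommGroup W] [Module ℂ W]
  [AddCommGroup U] [Module ℂ U]

/-- The superfunction `1 / √(1 - τ)`, the density of the invariant measure. -/
theorem exists_chartRootInv (q : ℕ) : ∃ b ∈ parity (Coord (2 * q)) 0,
    chartRoot q * b = 1 ∧ b * chartRoot q = 1 :=
  exists_even_inverse chartRoot_mem (by rw [body_chartRoot]; exact one_ne_zero)

/-- The superfunction `1 / √(1 - τ)`. -/
def chartRootInv (q : ℕ) : Gr (Coord (2 * q)) := (exists_chartRootInv q).choose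

theorem chartRootInv_mem : chartRootInv q ∈ parity (Coord (2 * q)) 0 :=
  (exists_chartRootInv q).choose_spec.1

theorem chartRoot_mul_inv : chartRoot q * chartRootInv q = 1 :=
  (exists_chartRootInv q).choose_spec.2.1

theorem chartRootInv_mul : chartRootInv q * chartRoot q = 1 :=
  (exists_chartRootInv q).choose_spec.2.2

/-- Homomorphisms which move the odd coordinates by multiples of a single odd element are given by a
first order differential operator. -/
theorem eq_sub_del_of_ι {ρ y : Gr W →ₐ[ℂ] Gr U} (hρ : IsSuperHom ρ) {η : Gr U}
    (hη : η ∈ parity U 1) {b : Gr W} (hb : b ∈ parity W 0) (δ : Module.Dual ℂ W)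
    (h : ∀ v, y (ExteriorAlgebra.ι ℂ v) = ρ (ExteriorAlgebra.ι ℂ v) + δ v • (η * ρ b)) (a : Gr W) :
    y a = ρ a - ρ (b * del δ (inv W a)) * η := by
  have hs : ∀ x, η * ρ x = ρ (inv W x) * η := fun x => by rw [odd_mul hη, hρ.inv_apply]
  induction a using ExteriorAlgebra.induction with
  | algebraMap r =>
    rw [AlgHom.commutes, AlgHom.commutes, AlgHom.commutes, del_algebraMap, mul_zero, map_zero,
      zero_mul, sub_zero]
  | ι v =>
    rw [h, inv_ι, map_neg, del_ι, hs, inv_even hb, mul_neg, map_neg, neg_mul, sub_neg_eq_add,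
      ← Algebra.commutes, ← Algebra.smul_def, map_smul, smul_mul_assoc]
  | mul x z hx hz =>
    have e1 : del δ (inv W (x * z)) = del δ (inv W x) * inv W z + x * del δ (inv W z) := by
      rw [map_mul, del_mul, inv_inv]
    have e2 : b * (x * del δ (inv W z)) = x * (b * del δ (inv W z)) := by
      rw [← mul_assoc, (even_commute hb x).eq, mul_assoc]
    -- This kills the term of second order in the product, so the first order formula is
    -- multiplicative.
    have e3 : ∀ u : Gr U, η * (u * η) = 0 := fun u => by
      rw [← mul_assoc, odd_mul hη, mul_assoc, odd_sq hη, mul_zero]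
    rw [map_mul, hx, hz, e1, mul_add, e2, ← mul_assoc b, map_add, map_mul ρ (b * _) (inv W z),
      map_mul ρ x, map_mul ρ x, add_mul, mul_assoc (ρ (b * _)) (ρ (inv W z)), ← hs, sub_mul,
      mul_sub, mul_sub, mul_assoc _ η (_ * η), e3]
    noncomm_ring
  | add x z hx hz => rw [map_add, hx, hz, map_add, map_add, map_add, mul_add, map_add, add_mul]; abel

/-- The standard chart, over a parameter space. -/
abbrev relChart (q : ℕ) (V : Type) [AddCommGroup V] [Module ℂ V] :
    SMat q (Gr (V × Coord (2 * q))) := (stdChart q).map (pullSnd V (Coord (2 * q)))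

theorem relChart_inl : relChart q V (inl 1) (inl 1) = pullSnd V _ (chartRoot q) :=
  congrArg _ stdChart_inl

theorem relChart_inr (i : Fin 2 × Fin q) :
    relChart q V (inr i) (inl 1) = pullSnd V _ (coordCol q i) := congrArg _ (stdChart_inr i)

theorem relChart_mem : relChart q V ∈ ptsK q (V × Coord (2 * q)) :=
  map_mem_ptsK isChart_stdChart.1 isSuperHom_pullSnd

/-- The image of the standard chart under a point of `K`. -/
abbrev movedChart (g : SMat q (Gr V)) : SMat q (Gr (V × Coord (2 * q))) :=
  g.map (pullFst V (Coord (2 * q))) * relChart q V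

theorem movedChart_apply (g : SMat q (Gr V)) (i j : Fin 2 ⊕ (Fin 2 × Fin q)) :
    movedChart g i j = ∑ k, pullFst V _ (g i k) * relChart q V k j := Matrix.mul_apply

theorem movedChart_mem {g : SMat q (Gr V)} (hg : g ∈ ptsK q V) :
    movedChart g ∈ ptsK q (V × Coord (2 * q)) :=
  mul_mem_ptsK (map_mem_ptsK hg isSuperHom_pullFst) relChart_mem

theorem movedChart_col_mem {g : SMat q (Gr V)} (hg : g ∈ ptsK q V) (i : Fin 2 × Fin q) :
    movedChart g (inr i) (inl 1) ∈ parity (V × Coord (2 * q)) 1 :=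
  (mem_ptsK_iff.mp (movedChart_mem hg)).1.1.2.2.1 i 1

/-- The images of the generators under the action of a point of `K`. -/
def actLin (g : SMat q (Gr V)) : V × Coord (2 * q) →ₗ[ℂ] Gr (V × Coord (2 * q)) :=
  (ExteriorAlgebra.ι ℂ ∘ₗ LinearMap.inl ℂ V (Coord (2 * q))).coprod
    (Fintype.linearCombination ℂ fun i => movedChart g (inr ((idx q).symm i)) (inl 1))

theorem actLin_mem {g : SMat q (Gr V)} (hg : g ∈ ptsK q V) (v : V × Coord (2 * q)) :
    actLin g v ∈ parity (V × Coord (2 * q)) 1 := by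
  rw [actLin, LinearMap.coprod_apply, Fintype.linearCombination_apply]
  exact add_mem (ι_mem_parity _)
    (sum_mem fun i _ => Submodule.smul_mem _ _ (movedChart_col_mem hg _))

/-- The action of a point of `K` on the superfunctions on `K/M`, in the standard chart. -/
def actHom (g : SMat q (Gr V)) (hg : g ∈ ptsK q V) :
    Gr (V × Coord (2 * q)) →ₐ[ℂ] Gr (V × Coord (2 * q)) :=
  ExteriorAlgebra.lift ℂ ⟨actLin g, fun v => odd_sq (actLin_mem hg v)⟩

variable {g : SMat q (Gr V)} (hg : g ∈ ptsK q V)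

theorem actHom_ι (v : V × Coord (2 * q)) : actHom g hg (ExteriorAlgebra.ι ℂ v) = actLin g v := by
  rw [actHom, ExteriorAlgebra.lift_ι_apply]

theorem isSuperHom_actHom : IsSuperHom (actHom g hg) :=
  isSuperHom_of_ι fun v => by rw [actHom_ι]; exact actLin_mem hg v

theorem actHom_pullFst (v : Gr V) :
    actHom g hg (pullFst V (Coord (2 * q)) v) = pullFst V (Coord (2 * q)) v := by
  have : (actHom g hg).comp (pullFst V (Coord (2 * q))) = pullFst V (Coord (2 * q)) := by
    ext v
    change actHom g hg (pullFst V _ (ExteriorAlgebra.ι ℂ v)) = pullFst V _ (ExteriorAlgebra.ι ℂ v)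
    rw [pullFst, ExteriorAlgebra.map_apply_ι, actHom_ι, actLin]
    simp
  exact DFunLike.congr_fun this v

theorem actHom_coordCol (i : Fin 2 × Fin q) :
    actHom g hg (pullSnd V (Coord (2 * q)) (coordCol q i)) = movedChart g (inr i) (inl 1) := by
  rw [coordCol, oddCoord, pullSnd, ExteriorAlgebra.map_apply_ι, actHom_ι, actLin,
    LinearMap.coprod_apply, Fintype.linearCombination_apply]
  rw [Finset.sum_eq_single (idx q i)]
  · simp
  · intro j _ hj; simp [hj]
  · intro h; exact absurd (Finset.mem_univ _) h

/-- The action is prescribed only on the odd entries; the even entry follows from the norm equation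
and uniqueness of the square root of value 1. -/
theorem actHom_relChart (a : Fin 2 ⊕ (Fin 2 × Fin q)) :
    actHom g hg (relChart q V a (inl 1)) = movedChart g a (inl 1) := by
  have hK := map_mem_ptsK (relChart_mem (q := q) (V := V)) (isSuperHom_actHom hg)
  have hM := movedChart_mem hg
  have hr : ∀ i, actHom g hg (relChart q V (inr i) (inl 1)) = movedChart g (inr i) (inl 1) :=
    fun i => by rw [relChart_inr, actHom_coordCol]
  obtain ⟨k1, k2, k3, -⟩ := mem_ptsK_iff.mp hK
  obtain ⟨m1, m2, m3, -⟩ := mem_ptsK_iff.mp hM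
  rcases a with a | i
  · obtain rfl | rfl := fin_two_cases a
    · exact (k2.1 (inl 1)).trans (m2.1 (inl 1)).symm
    · refine even_sqrt_unique (k1.1.1 1 1) (m1.1.1 1 1) k3 m3 ?_
      have e1 := col_norm hK
      have e2 := col_norm hM
      simp only [Matrix.map_apply (f := actHom g hg), hr] at e1
      exact add_right_cancel (e1.trans e2.symm)
  · exact hr i

theorem actHom_chartRoot :
    actHom g hg (pullSnd V (Coord (2 * q)) (chartRoot q)) = movedChart g (inl 1) (inl 1) := by
  rw [← actHom_relChart hg, relChart_inl]

theorem gr_prod_hom_ext {A : Type} [Ring A] [Algebra ℂ A]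
    {φ ψ : Gr (V × Coord (2 * q)) →ₐ[ℂ] A} (h1 : ∀ v, φ (pullFst V _ v) = ψ (pullFst V _ v))
    (h2 : ∀ i, φ (pullSnd V _ (coordCol q i)) = ψ (pullSnd V _ (coordCol q i))) : φ = ψ := by
  have h3 : φ.comp (pullSnd V (Coord (2 * q))) = ψ.comp (pullSnd V (Coord (2 * q))) :=
    coord_hom_ext fun i => by
      have := h2 ((idx q).symm i)
      rwa [coordCol, Equiv.apply_symm_apply] at this
  refine ExteriorAlgebra.hom_ext (LinearMap.ext fun v => ?_)
  change φ (ExteriorAlgebra.ι ℂ v) = ψ (ExteriorAlgebra.ι ℂ v)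
  have hv : ExteriorAlgebra.ι ℂ v = pullFst V (Coord (2 * q)) (ExteriorAlgebra.ι ℂ v.1) +
      pullSnd V (Coord (2 * q)) (ExteriorAlgebra.ι ℂ v.2) := by
    rw [pullFst, pullSnd, ExteriorAlgebra.map_apply_ι, ExteriorAlgebra.map_apply_ι, ← map_add]
    simp
  rw [hv, map_add, map_add, h1]
  congr 1
  exact DFunLike.congr_fun h3 _

theorem actHom_mul {g' : SMat q (Gr V)} (hg' : g' ∈ ptsK q V) :
    actHom (g * g') (mul_mem_ptsK hg hg') = (actHom g' hg').comp (actHom g hg) := by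
  refine gr_prod_hom_ext (fun v => ?_) fun i => ?_
  · rw [AlgHom.comp_apply, actHom_pullFst, actHom_pullFst, actHom_pullFst]
  · rw [AlgHom.comp_apply, actHom_coordCol, actHom_coordCol]
    have h1 : movedChart (g * g') = g.map (pullFst V (Coord (2 * q))) * movedChart g' := by
      rw [movedChart, Matrix.map_mul, mul_assoc]
    rw [h1, Matrix.mul_apply, movedChart_apply, map_sum]
    refine Finset.sum_congr rfl fun k _ => ?_
    rw [map_mul, actHom_relChart, Matrix.map_apply, actHom_pullFst]

/-- Invariance of the density `|Dξ| / √(1 - τ)` under a point of `K`. -/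
def FixesIntegral (g : SMat q (Gr V)) : Prop :=
  ∀ (hg : g ∈ ptsK q V) (a : Gr (V × Coord (2 * q))),
    berezinFibre V (pullSnd V _ (chartRootInv q) * actHom g hg a) =
      berezinFibre V (pullSnd V _ (chartRootInv q) * a)

theorem FixesIntegral.mul {g g' : SMat q (Gr V)} (hg : g ∈ ptsK q V) (hg' : g' ∈ ptsK q V)
    (h : FixesIntegral g) (h' : FixesIntegral g') : FixesIntegral (g * g') := by
  intro _ a
  rw [actHom_mul hg hg', AlgHom.comp_apply, h' hg', h hg]

theorem stdPt_map (φ : Gr V →ₐ[ℂ] Gr W) (b c : Gr V) (ξ : Fin 2 × Fin q → Gr V) :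
    (stdPt b c ξ).map φ = stdPt (φ b) (φ c) (fun i => φ (ξ i)) := by
  have h : ∀ k, φ (symp ξ k) = symp (fun k => φ (ξ k)) k := fun k => symp_map (φ : Gr V →+* Gr W) ξ k
  ext (a | k) (d | l)
  · fin_cases a <;> fin_cases d <;> simp [stdPt]
  · obtain rfl | rfl := fin_two_cases a <;> simp [stdPt, h]
  · obtain rfl | rfl := fin_two_cases d <;> simp [stdPt]
  · simp [h, apply_ite]

theorem elemPt_map (φ : Gr V →ₐ[ℂ] Gr W) (i : Fin 2 × Fin q) (η : Gr V) :
    (elemPt i η).map φ = elemPt i (φ η) := by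
  rw [elemPt, stdPt_map, map_one, AlgHom.commutes, elemPt]
  congr 1
  ext k
  rw [apply_ite φ, map_zero]

/-- By `eq_sub_del_of_ι` the action adds a multiple of b∂_i, up to the grading sign. The weight 1/b
cancels b and leaves a derivative times a function on the base, which integrates to zero. -/
theorem fixesIntegral_elemPt (i : Fin 2 × Fin q) {η : Gr V} (hη : η ∈ parity V 1) :
    FixesIntegral (elemPt i η) := by
  intro hg a
  have hη' := isSuperHom_pullFst (W := Coord (2 * q)) 1 η hη
  have hb := isSuperHom_pullSnd (V := V) 0 _ (chartRoot_mem (q := q))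
  have key := eq_sub_del_of_ι (ρ := AlgHom.id ℂ (Gr (V × Coord (2 * q)))) (y := actHom _ hg)
    isSuperHom_id hη' hb (fibreDual V (idx q i)) (fun v => ?_) a
  · rw [key]
    simp only [AlgHom.coe_id, id_eq]
    rw [mul_sub, ← mul_assoc, ← mul_assoc, ← map_mul, chartRootInv_mul, map_one, one_mul,
      sub_eq_add_neg, berezinFibre_add, ← neg_one_smul ℂ (_ * _), berezinFibre_smul,
      berezinFibre_mul_pullFst, berezinFibre_del, zero_mul, smul_zero, add_zero]
  · have hv : v = (v.1, 0) + ∑ l, v.2 l • (0, Pi.single l 1) := by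
      refine Prod.ext ?_ ?_
      · simp [Prod.fst_sum]
      · simp only [Prod.snd_add, zero_add, Prod.snd_sum, Prod.smul_snd]
        exact pi_eq_sum_univ' v.2
    have h1 := actHom_pullFst hg (ExteriorAlgebra.ι ℂ v.1)
    rw [pullFst, ExteriorAlgebra.map_apply_ι] at h1
    have h2 : ∀ l, actHom _ hg (ExteriorAlgebra.ι ℂ ((0, Pi.single l 1) : V × Coord (2 * q))) =
        ExteriorAlgebra.ι ℂ ((0, Pi.single l 1) : V × Coord (2 * q)) +
          if l = idx q i then pullFst V _ η * pullSnd V _ (chartRoot q) else 0 := fun l => by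
      have e1 := actHom_coordCol hg ((idx q).symm l)
      rw [movedChart, elemPt_map, elemPt_mul_inr i hη' (mem_ptsK_iff.mp relChart_mem).2.1,
        relChart_inr, relChart_inl, coordCol,
        Equiv.apply_symm_apply, oddCoord, pullSnd, ExteriorAlgebra.map_apply_ι] at e1
      refine e1.trans ?_
      congr 1
      simp only [Equiv.symm_apply_eq]
      rfl
    conv_lhs => rw [hv]
    conv_rhs => rw [hv]
    simp only [map_add, map_sum, map_smul, h2, smul_add, Finset.sum_add_distrib]
    have h1' : actHom _ hg (ExteriorAlgebra.ι ℂ (v.1, 0)) = ExteriorAlgebra.ι ℂ (v.1, 0) := h1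
    rw [h1', add_assoc]
    congr 1
    simp [Pi.single_apply]

theorem movedChart_ptsM_inl {m : SMat q (Gr V)} (hm : m ∈ ptsM q V) :
    movedChart m (inl 1) (inl 1) = pullSnd V _ (chartRoot q) := by
  rw [movedChart_apply, ← relChart_inl]
  simp only [(mem_ptsM_iff.mp hm).2.1, Matrix.one_apply]
  simp [apply_ite]

theorem movedChart_ptsM_inr {m : SMat q (Gr V)} (hm : m ∈ ptsM q V) (i : Fin 2 × Fin q) :
    movedChart m (inr i) (inl 1) =
      ∑ k, pullFst V _ (m (inr i) (inr k)) * pullSnd V _ (coordCol q k) := by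
  obtain ⟨hK, -, h1⟩ := mem_ptsM_iff.mp hm
  rw [movedChart_apply, Fintype.sum_sum_type, Fin.sum_univ_two, h1,
    (mem_ptsK_iff.mp hK).2.1.2]
  simp only [relChart_inr]
  simp

theorem inr_inr_mem {k : SMat q (Gr V)} (hk : k ∈ ptsK q V) (i j : Fin 2 × Fin q) :
    k (inr i) (inr j) ∈ parity V 0 := (mem_ptsK_iff.mp hk).1.1.2.2.2 i j

theorem sum_del_movedChart {m y : SMat q (Gr V)} (hm : m ∈ ptsM q V) (hy : y ∈ ptsK q V)
    (hmy : m * y = 1) (l i : Fin 2 × Fin q) :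
    ∑ j, pullFst V _ (y (inr j) (inr i)) *
      del (fibreDual V (idx q j)) (movedChart m (inr l) (inl 1)) = if l = i then 1 else 0 := by
  obtain ⟨hK, -, h1⟩ := mem_ptsM_iff.mp hm
  have hd : ∀ j, del (fibreDual V (idx q j)) (movedChart m (inr l) (inl 1)) =
      pullFst V _ (m (inr l) (inr j)) := fun j => by
    rw [movedChart_ptsM_inr hm, map_sum, Finset.sum_eq_single j]
    · rw [del_mul, del_pullFst, zero_mul, zero_add, del_pullSnd, coordDel_coordCol, if_pos rfl,
        map_one, mul_one, inv_even (isSuperHom_pullFst 0 _ (inr_inr_mem hK l j))]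
    · intro k _ hk
      rw [del_mul, del_pullFst, zero_mul, zero_add, del_pullSnd, coordDel_coordCol,
        if_neg hk.symm, map_zero, mul_zero]
    · intro h; exact absurd (Finset.mem_univ _) h
  have h2 := congrFun (congrFun hmy (inr l)) (inr i)
  rw [Matrix.mul_apply, Fintype.sum_sum_type, Fin.sum_univ_two, h1,
    (mem_ptsK_iff.mp hK).2.1.2] at h2
  simp only [Matrix.one_apply, reduceCtorEq, if_false, zero_mul, zero_add, inr.injEq] at h2
  simp only [hd]
  rw [← map_one (pullFst V (Coord (2 * q))), ← map_zero (pullFst V (Coord (2 * q))), ← apply_ite,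
    ← h2, map_sum]
  refine Finset.sum_congr rfl fun j _ => ?_
  rw [← map_mul, (even_commute (inr_inr_mem hy j i) _).eq]

/-- Chain rule for a linear substitution: the derivatives transform with the inverse matrix, whose
entries come from the base. Hence the fibre integral composed with the action still kills
derivatives. -/
theorem actHom_del {m y : SMat q (Gr V)} (hm : m ∈ ptsM q V) (hy : y ∈ ptsK q V)
    (hmy : m * y = 1) (i : Fin 2 × Fin q) (a : Gr (V × Coord (2 * q))) :
    actHom m hm.1 (del (fibreDual V (idx q i)) a) =
      ∑ j, pullFst V _ (y (inr j) (inr i)) * del (fibreDual V (idx q j)) (actHom m hm.1 a) := by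
  have hye : ∀ j, pullFst V (Coord (2 * q)) (y (inr j) (inr i)) ∈ parity (V × Coord (2 * q)) 0 :=
    fun j => isSuperHom_pullFst 0 _ (inr_inr_mem hy j i)
  induction a using ExteriorAlgebra.induction with
  | algebraMap r =>
    rw [del_algebraMap, map_zero, AlgHom.commutes]
    exact (Finset.sum_eq_zero fun j _ => by rw [del_algebraMap, mul_zero]).symm
  | ι v =>
    rw [del_ι, AlgHom.commutes, actHom_ι, actLin, LinearMap.coprod_apply,
      Fintype.linearCombination_apply]
    simp only [map_add, map_sum, map_smul, mul_add, Finset.mul_sum, mul_smul_comm,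
      Finset.sum_add_distrib]
    rw [Finset.sum_comm]
    simp only [← Finset.smul_sum, sum_del_movedChart hm hy hmy]
    have h0 : ∀ j, del (fibreDual V (idx q j))
        ((ExteriorAlgebra.ι ℂ ∘ₗ LinearMap.inl ℂ V (Coord (2 * q))) v.1) = 0 := fun j => by
      rw [LinearMap.comp_apply, del_ι]
      simp
    simp only [h0, mul_zero, Finset.sum_const_zero, zero_add, Equiv.symm_apply_eq]
    rw [Algebra.algebraMap_eq_smul_one]
    simp
  | mul x z hx hz =>
    rw [del_mul, map_add, map_mul, map_mul, hx, hz, map_mul, Finset.sum_mul, Finset.mul_sum,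
      ← Finset.sum_add_distrib]
    refine Finset.sum_congr rfl fun j _ => ?_
    rw [del_mul, mul_add, (isSuperHom_actHom hm.1).inv_apply, mul_assoc,
      ← mul_assoc (inv _ (actHom m hm.1 x)), ← (even_commute (hye j) _).eq, mul_assoc]
  | add x z hx hz =>
    simp only [map_add, mul_add, Finset.sum_add_distrib, hx, hz]

/-- A linear substitution multiplies the fibre integral by a function on the base, in effect its
Berezinian. Testing on τ^q, which M fixes and whose integral is non-zero, shows that this factor is
1; the weight is fixed as well. -/
theorem fixesIntegral_ptsM [FiniteDimensional ℂ V] {m : SMat q (Gr V)} (hm : m ∈ ptsM q V) :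
    FixesIntegral m := by
  intro hmK a
  obtain ⟨y, hy, hmy, -⟩ := exists_inv_mem_ptsK hmK
  have hb : actHom m hmK (pullSnd V _ (chartRoot q)) = pullSnd V _ (chartRoot q) := by
    rw [actHom_chartRoot, movedChart_ptsM_inl hm]
  have hbi : actHom m hmK (pullSnd V _ (chartRootInv q)) = pullSnd V _ (chartRootInv q) := by
    have h1 := congrArg (actHom m hmK) (congrArg (pullSnd V _) (chartRootInv_mul (q := q)))
    rw [map_mul, map_mul, map_one, map_one, hb] at h1
    have h2 := congrArg (pullSnd V _) (chartRoot_mul_inv (q := q))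
    rw [map_mul, map_one] at h2
    exact left_inv_eq_right_inv h1 h2
  have hτ : ∀ k, actHom m hmK (pullSnd V _ (coordForm q ^ k)) = pullSnd V _ (coordForm q ^ k) := by
    intro k
    have h1 : coordForm q = 1 - chartRoot q * chartRoot q := by rw [chartRoot_sq]; abel
    rw [map_pow, map_pow, h1, map_sub, map_mul, map_sub, map_mul, hb, map_one, map_one]
  have key : ∀ F, berezinFibre V (actHom m hmK F) = berezinFibre V F := by
    obtain ⟨T, hT⟩ := exists_fibre_top V (2 * q)
    have hJ := hT (berezinFibreL V (2 * q) ∘ₗ (actHom m hmK).toLinearMap) fun i a => by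
      change berezinFibre V (actHom m hmK (del (fibreDual V i) a)) = 0
      obtain ⟨i, rfl⟩ := (idx q).surjective i
      rw [actHom_del hm hy hmy]
      change berezinFibreL V (2 * q) _ = 0
      rw [map_sum]
      refine Finset.sum_eq_zero fun j _ => ?_
      rw [(even_commute (isSuperHom_pullFst 0 _ (inr_inr_mem hy j i)) _).eq]
      change berezinFibre V (_ * pullFst V _ _) = 0
      rw [berezinFibre_mul_pullFst, berezinFibre_del, zero_mul]
    have hJ' : ∀ F, berezinFibre V (actHom m hmK F) =
        berezinFibre V (actHom m hmK T) * berezinFibre V F := fun F => by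
      refine (hJ F).trans ?_
      change berezinFibre V (actHom m hmK (T * _)) = _
      rw [map_mul, actHom_pullFst, berezinFibre_mul_pullFst]
    have h1 := hJ' (pullSnd V _ (coordForm q ^ q))
    rw [hτ, berezinFibre_pullSnd, ← Algebra.commutes, ← Algebra.smul_def,
      Algebra.algebraMap_eq_smul_one] at h1
    have h2 := smul_right_injective _ (berezin_coordForm_pow_ne_zero q) h1
    intro F
    rw [hJ', ← h2, one_mul]
  have h3 : pullSnd V _ (chartRootInv q) * actHom m hmK a =
      actHom m hmK (pullSnd V _ (chartRootInv q) * a) := by rw [map_mul, hbi]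
  rw [h3, key]

theorem fixesIntegral [FiniteDimensional ℂ V] {g : SMat q (Gr V)} (hg : g ∈ ptsK q V) :
    FixesIntegral g :=
  ptsK_induction (P := FixesIntegral) (fun _ hm => fixesIntegral_ptsM hm)
    (fun i _ hη _ hk h => FixesIntegral.mul (elemPt_mem i hη) hk (fixesIntegral_elemPt i hη) h) hg

/-- The invariant density `|Dξ| / √(1 - τ)` in the standard chart. -/
def stdDensity (q : ℕ) : BerDensity q := ⟨stdChart q, isChart_stdChart, chartRootInv q⟩

theorem chartRootInv_ne_zero : chartRootInv q ≠ 0 := fun h => by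
  have := chartRoot_mul_inv (q := q)
  rw [h, mul_zero] at this
  exact zero_ne_one this

theorem isInvariant_stdDensity : (stdDensity q).IsInvariant := by
  intro V _ _ _ g hg y hy m hm h f
  -- Right multiplication by M does not change the column, so the column equation forces the
  -- morphism y.
  have hy' : y = (actHom g hg).comp (pullSnd V (Coord (2 * q))) := by
    refine coord_hom_ext fun i => ?_
    have h1 := congrFun (congrFun h (inr ((idx q).symm i))) (inl 1)
    rw [mul_ptsM_col hm] at h1
    have h2 := actHom_coordCol hg ((idx q).symm i)
    rw [coordCol, Equiv.apply_symm_apply] at h2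
    rw [AlgHom.comp_apply, h2]
    refine Eq.trans ?_ h1.symm
    change _ = y (stdChart q _ _)
    rw [stdChart_inr, coordCol, Equiv.apply_symm_apply]
  change berezinFibre V (pullSnd V _ (chartRootInv q) * y f) = algebraMap ℂ _
    (berezin (chartRootInv q * f))
  rw [hy', AlgHom.comp_apply, fixesIntegral hg hg, ← map_mul, berezinFibre_pullSnd]

end Action

/-! ### Moments of the invariant density -/

section Moments

variable {q : ℕ}

theorem sum_coordDel_coordCol_mul (F : Gr (Coord (2 * q))) :
    ∑ i, coordCol q i * coordDel i F = (2 * q : ℂ) • F - ∑ i, coordDel i (coordCol q i * F) := by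
  have h : ∀ i, coordCol q i * coordDel i F = F - coordDel i (coordCol q i * F) := fun i => by
    rw [del_mul, coordDel_coordCol, if_pos rfl, one_mul, inv_odd (coordCol_mem i)]
    noncomm_ring
  simp only [h, Finset.sum_sub_distrib, Finset.sum_const, Finset.card_univ, Fintype.card_prod,
    Fintype.card_fin]
  rw [← Nat.cast_smul_eq_nsmul ℂ]
  push_cast
  rfl

/-- The Euler operator. -/
def euler (q : ℕ) : Gr (Coord (2 * q)) →ₗ[ℂ] Gr (Coord (2 * q)) :=
  ∑ i, LinearMap.mulLeft ℂ (coordCol q i) ∘ₗ coordDel i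

theorem euler_apply (F : Gr (Coord (2 * q))) : euler q F = ∑ i, coordCol q i * coordDel i F := by
  simp [euler]

/-- Only the top coefficient is integrated, and the Euler operator multiplies it by the degree 2q.
-/
theorem berezin_euler (F : Gr (Coord (2 * q))) : berezin (euler q F) = 2 * q * berezin F := by
  rw [euler_apply, sum_coordDel_coordCol_mul]
  change berezinL (2 * q) _ = _
  rw [map_sub, map_smul, map_sum, Finset.sum_eq_zero fun i _ => ?_, sub_zero]
  · rfl
  · exact berezin_del (idx q i) _

theorem euler_mul (a b : Gr (Coord (2 * q))) : euler q (a * b) = euler q a * b + a * euler q b := by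
  simp only [euler_apply, Finset.sum_mul, Finset.mul_sum, ← Finset.sum_add_distrib]
  refine Finset.sum_congr rfl fun i _ => ?_
  rw [del_mul, mul_add, ← mul_assoc, ← mul_assoc (coordCol q i) (inv _ a),
    odd_mul (coordCol_mem i) (inv _ a), inv_inv, mul_assoc a]

theorem euler_coordCol (i : Fin 2 × Fin q) : euler q (coordCol q i) = coordCol q i := by
  rw [euler_apply]
  simp only [coordDel_coordCol]
  simp

theorem euler_coordForm : euler q (coordForm q) = (2 : ℂ) • coordForm q := by
  rw [coordForm_eq, map_smul, map_sum]
  congr 1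
  rw [Finset.smul_sum]
  refine Finset.sum_congr rfl fun j _ => ?_
  rw [planeForm, euler_mul, euler_coordCol, euler_coordCol, two_smul]

theorem euler_one : euler q 1 = 0 := by
  rw [euler_apply]
  refine Finset.sum_eq_zero fun i _ => ?_
  rw [← map_one (algebraMap ℂ _), del_algebraMap, mul_zero]

/-- Applying the Euler operator E to b² = 1 - τ gives 2b·E(b) = -2τ = 2(b² - 1). -/
theorem euler_chartRoot : euler q (chartRoot q) = chartRoot q - chartRootInv q := by
  have h1 := congrArg (euler q) (chartRoot_sq (q := q))
  rw [euler_mul, map_sub, euler_one, zero_sub, euler_coordForm,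
    ← (even_commute chartRoot_mem (euler q (chartRoot q))).eq, ← two_smul ℂ, ← smul_neg] at h1
  have h2 : chartRoot q * euler q (chartRoot q) = -coordForm q :=
    smul_right_injective _ (two_ne_zero : (2 : ℂ) ≠ 0) h1
  have h3 : coordForm q = 1 - chartRoot q * chartRoot q := by rw [chartRoot_sq]; abel
  have h4 := congrArg (chartRootInv q * ·) h2
  rw [← mul_assoc, chartRootInv_mul, one_mul, h3, mul_neg, mul_sub, ← mul_assoc, chartRootInv_mul,
    one_mul, mul_one] at h4
  rw [h4]; abel

theorem euler_sub_one_pow (j : ℕ) : euler q ((chartRoot q - 1) ^ (j + 1)) = (j + 1 : ℂ) •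
    ((chartRoot q - 1) ^ j * (chartRoot q - chartRootInv q)) := by
  induction j with
  | zero => rw [pow_one, map_sub, euler_one, euler_chartRoot, pow_zero]; simp
  | succ j ih =>
    have hc := (even_commute (sub_mem (chartRoot_mem (q := q)) one_mem_parity)
      (chartRoot q - chartRootInv q)).eq
    rw [pow_succ, euler_mul, ih, map_sub, euler_one, euler_chartRoot, sub_zero, smul_mul_assoc,
      mul_assoc, ← hc, ← mul_assoc, ← pow_succ, Nat.cast_succ]
    module

/-- The moments of the invariant density. -/
def moment (q j : ℕ) : ℂ := berezin (chartRootInv q * (chartRoot q - 1) ^ j)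

/-- With E the Euler operator, evaluate ∫ E((b - 1)^j) in two ways. By degree it is 2q(m_{j+1} +
m_j), since 1 = b⁻¹(b - 1) + b⁻¹. By the product rule it is j(m_{j+1} + 2m_j), since E(b) = b - b⁻¹
= b⁻¹(b - 1 + 2)(b - 1). -/
theorem moment_succ (j : ℕ) :
    (2 * q - j : ℂ) * moment q (j + 1) = -2 * (q - j : ℂ) * moment q j := by
  have hsplit : (chartRoot q - 1) ^ j = chartRootInv q * (chartRoot q - 1) ^ (j + 1) +
      chartRootInv q * (chartRoot q - 1) ^ j := by
    rw [← mul_add, pow_succ', ← one_mul ((chartRoot q - 1) ^ j), ← mul_assoc (chartRoot q - 1),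
      ← add_mul, mul_one, sub_add_cancel, ← mul_assoc, chartRootInv_mul]
  have h1 := berezin_euler ((chartRoot q - 1) ^ j)
  rw [hsplit] at h1
  rw [berezin_add] at h1
  rw [← hsplit] at h1
  have h2 : berezin (euler q ((chartRoot q - 1) ^ j)) = j * (moment q (j + 1) + 2 * moment q j) := by
    cases j with
    | zero => rw [pow_zero, euler_one, Nat.cast_zero, zero_mul]; exact (berezinL (2 * q)).map_zero
    | succ j =>
      rw [euler_sub_one_pow, berezin_smul, moment, moment, ← berezin_smul 2, ← berezin_add]
      push_cast
      congr 2
      have e1 : chartRoot q - chartRootInv q =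
          (chartRootInv q * ((chartRoot q - 1) + (2 : ℂ) • 1)) * (chartRoot q - 1) := by
        have e4 := chartRootInv_mul (q := q)
        rw [two_smul]
        simp only [mul_add, mul_sub, add_mul, sub_mul, mul_one, e4, one_mul]
        abel
      have hc := (even_commute (pow_mem_parity (sub_mem (chartRoot_mem (q := q)) one_mem_parity) j)
        (chartRootInv q * ((chartRoot q - 1) + (2 : ℂ) • 1))).eq
      rw [e1, ← mul_assoc, hc, mul_assoc, ← pow_succ, mul_assoc, add_mul, ← pow_succ',
        smul_one_mul, mul_add, mul_smul_comm]
  rw [h2] at h1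
  change _ = 2 * q * (moment q (j + 1) + moment q j) at h1
  linear_combination -h1

theorem sub_one_mul_add_one : (chartRoot q - 1) * (chartRoot q + 1) = -coordForm q := by
  have h3 : coordForm q = 1 - chartRoot q * chartRoot q := by rw [chartRoot_sq]; abel
  rw [h3]; noncomm_ring

/-- The factor is -1/(b + 1), from (b - 1)(b + 1) = -τ. It turns powers of b - 1 into powers of τ
times units. -/
theorem exists_sub_one_eq (q : ℕ) : ∃ d ∈ parity (Coord (2 * q)) 0, body d ≠ 0 ∧
    chartRoot q - 1 = coordForm q * d := by
  have hb2 : body (chartRoot q + 1) ≠ 0 := by rw [map_add, map_one, body_chartRoot]; norm_num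
  obtain ⟨d, hd, hd1, -⟩ := exists_even_inverse (add_mem (chartRoot_mem (q := q)) one_mem_parity) hb2
  refine ⟨-d, neg_mem hd, ?_, ?_⟩
  · intro h
    have := congrArg body hd1
    rw [map_mul, map_one, ← neg_neg d, map_neg body (-d), h] at this
    simp at this
  · rw [mul_neg, ← neg_mul, ← sub_one_mul_add_one, mul_assoc, hd1, mul_one]

theorem sub_one_pow_succ : (chartRoot q - 1) ^ (q + 1) = 0 := by
  obtain ⟨d, -, -, h⟩ := exists_sub_one_eq q
  rw [h, (even_commute coordForm_mem d).mul_pow, coordForm_pow_succ, zero_mul]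

theorem moment_self_ne_zero (q : ℕ) : moment q q ≠ 0 := by
  obtain ⟨d, -, hd, h⟩ := exists_sub_one_eq q
  have h1 : body (chartRootInv q) ≠ 0 := fun h0 => by
    have := congrArg body (chartRoot_mul_inv (q := q))
    rw [map_mul, h0, mul_zero, map_one] at this
    exact zero_ne_one this
  rw [moment, h, (even_commute coordForm_mem d).mul_pow, coordForm_pow_mul, mul_smul_comm,
    (even_commute chartRootInv_mem _).eq, coordForm_pow_mul, berezin_smul, berezin_smul]
  exact mul_ne_zero (by rw [map_pow]; exact pow_ne_zero _ hd)
    (mul_ne_zero h1 (berezin_coordForm_pow_ne_zero q))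

/-- The moments, up to a common factor. -/
theorem exists_moment_eq (q : ℕ) : ∃ c : ℂ, c ≠ 0 ∧ ∀ j ≤ q,
    moment q j = c * ((-2) ^ j * ((2 * q - j).choose q : ℂ)) := by
  have hstep : ∀ c : ℂ, moment q 0 = c * ((2 * q).choose q : ℂ) → ∀ j ≤ q,
      moment q j = c * ((-2) ^ j * ((2 * q - j).choose q : ℂ)) := by
    intro c h0 j
    induction j with
    | zero => intro _; simpa using h0
    | succ j ih =>
      intro hj
      have h1 := moment_succ (q := q) j
      rw [ih (Nat.le_of_succ_le hj)] at h1
      -- The recursion may be divided by 2q - j because j < q. With n + 1 = 2q - j the remaining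
      -- ratio is that of binom(n, q) to binom(n + 1, q), namely (n + 1 - q)/(n + 1).
      have h2 : (2 * q - j : ℂ) ≠ 0 := by
        rw [sub_ne_zero]; exact_mod_cast (by omega : 2 * q ≠ j)
      refine mul_left_cancel₀ h2 (h1.trans ?_)
      obtain ⟨n, hn⟩ : ∃ n, 2 * q - j = n + 1 := ⟨2 * q - j - 1, by omega⟩
      have h3 : 2 * q - (j + 1) = n := by omega
      have h4 : (2 * q : ℂ) - j = n + 1 := by
        have : 2 * q = n + 1 + j := by omega
        have : (2 * q : ℂ) = n + 1 + j := by exact_mod_cast this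
        rw [this]; ring
      have h5 : (q : ℂ) - j = n + 1 - q := by linear_combination h4
      have h6 := Nat.add_one_mul_choose_eq n q
      have h7 := Nat.choose_succ_right_eq (n + 1) q
      have h8 : ((n + 1).choose q : ℂ) * ((n : ℂ) + 1 - q) = (n + 1) * (n.choose q) := by
        have e1 : (n + 1).choose q * (n + 1 - q) = (n + 1) * n.choose q := by
          rw [← h7]; exact h6.symm
        have e2 : q ≤ n + 1 := by omega
        have := congrArg (Nat.cast (R := ℂ)) e1
        push_cast [Nat.cast_sub e2] at this
        exact this
      rw [hn, h3, h4, h5, pow_succ]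
      linear_combination (-2 * c * (-2) ^ j) * h8
  have hq : ((2 * q).choose q : ℂ) ≠ 0 :=
    Nat.cast_ne_zero.mpr (Nat.choose_pos (by omega)).ne'
  have h := hstep (moment q 0 / (2 * q).choose q) (by field_simp)
  -- The constant is m_0 / binom(2q, q). If it were zero, the last moment m_q would vanish too.
  refine ⟨_, fun h0 => ?_, h⟩
  have := h q le_rfl
  rw [h0, zero_mul] at this
  exact moment_self_ne_zero q this

end Moments

/-! ### Invariant densities and the spherical superfunction -/

section Spherical

variable {q : ℕ}

/-- Any chart is the standard chart after a change of coordinates. -/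
theorem IsChart.exists_surjective {s : SMat q (Gr (Coord (2 * q)))} (hs : IsChart q s) :
    ∃ φ : Gr (Coord (2 * q)) →ₐ[ℂ] Gr (Coord (2 * q)), IsSuperHom φ ∧ Function.Surjective φ ∧
      ∀ a, s a (inl 1) = φ (stdChart q a (inl 1)) := by
  obtain ⟨φ, ⟨hφ, m, hm, hsm⟩, -⟩ := isChart_stdChart.2 _ s hs.1
  obtain ⟨ψ, ⟨hψ, m', hm', hsm'⟩, -⟩ := hs.2 _ _ isChart_stdChart.1
  refine ⟨φ, hφ, ?_, fun a => ?_⟩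
  -- Each chart is expressed in the other. Both the composite and the identity represent s in its
  -- own chart, so by uniqueness they agree, and φ is surjective.
  · have hcomp : s = s.map (φ.comp ψ) * (m'.map φ * m) := by
      conv_lhs => rw [hsm, hsm', Matrix.map_mul, mul_assoc]
      rfl
    have hid : s = s.map (AlgHom.id ℂ (Gr (Coord (2 * q)))) * 1 := by
      rw [mul_one]; ext i j; rfl
    have h1 : (1 : SMat q (Gr (Coord (2 * q)))) ∈ ptsM q (Coord (2 * q)) := by
      obtain ⟨y, hy, -, hy1⟩ := exists_inv_mem_ptsK hs.1
      rw [← hy1]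
      refine mem_ptsM_of_col (mul_mem_ptsK hy hs.1) fun i => ?_
      rw [hy1, Matrix.one_apply_ne (by simp)]
    have := (hs.2 _ s hs.1).unique ⟨hφ.comp hψ, _, mul_mem_ptsM (map_mem_ptsM hm' hφ) hm, hcomp⟩
      ⟨isSuperHom_id, 1, h1, hid⟩
    exact fun a => ⟨ψ a, DFunLike.congr_fun this a⟩
  · conv_lhs => rw [hsm, mul_ptsM_col hm]
    rfl

theorem oddCoord_ne_zero {n : ℕ} (i : Fin n) : oddCoord i ≠ 0 := by
  rw [oddCoord, Ne, ExteriorAlgebra.ι_eq_zero_iff, Pi.single_eq_zero_iff]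
  exact one_ne_zero

/-- An invariant density is a multiple of the standard one. -/
theorem BerDensity.IsInvariant.eq_smul {ω : BerDensity q} (hω : ω.IsInvariant)
    (hne : ω.coeff ≠ 0) {φ : Gr (Coord (2 * q)) →ₐ[ℂ] Gr (Coord (2 * q))} (hφ : IsSuperHom φ)
    (hsurj : Function.Surjective φ) (hs : ∀ a, ω.chart a (inl 1) = φ (stdChart q a (inl 1))) :
    ∃ c : ℂ, c ≠ 0 ∧ ∀ F, berezin (ω.coeff * φ F) = c * berezin (chartRootInv q * F) := by
  have key : ∀ (i : Fin 2 × Fin q) (F : Gr (Coord (2 * q))),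
      berezin (ω.coeff * φ (chartRoot q * coordDel i F)) = 0 := by
    intro i F
    -- A free odd parameter: invariance under the elementary point over a superpoint of dimension
    -- 0|1 is a statement about the coefficient of η, namely that the integral of b∂_i F vanishes.
    set η : Gr (Coord 1) := oddCoord 0 with hη
    have hηo : η ∈ parity (Coord 1) 1 := oddCoord_mem 0
    have hη' := isSuperHom_pullFst (W := Coord (2 * q)) 1 η hηo
    have hg := elemPt_mem i hηo
    have hsK := map_mem_ptsK ω.isChart.1 (isSuperHom_pullSnd (V := Coord 1))
    obtain ⟨y, ⟨hy, m, hm, hym⟩, -⟩ := ω.isChart.2 (Coord 1 × Coord (2 * q)) _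
      (mul_mem_ptsK (map_mem_ptsK hg isSuperHom_pullFst) hsK)
    have hρ : IsSuperHom ((pullSnd (Coord 1) (Coord (2 * q))).comp φ) :=
      isSuperHom_pullSnd.comp hφ
    have hgen : ∀ l, y (φ (coordCol q l)) = pullSnd (Coord 1) _ (φ (coordCol q l)) +
        if l = i then pullFst (Coord 1) _ η * pullSnd (Coord 1) _ (φ (chartRoot q)) else 0 := by
      intro l
      have h1 := congrFun (congrFun hym (inr l)) (inl 1)
      rw [mul_ptsM_col hm, elemPt_map, elemPt_mul_inr i hη' (mem_ptsK_iff.mp hsK).2.1] at h1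
      simp only [Matrix.map_apply, hs, stdChart_inr, stdChart_inl] at h1
      exact h1.symm
    have hF := eq_sub_del_of_ι (ρ := (pullSnd (Coord 1) (Coord (2 * q))).comp φ) (y := y.comp φ) hρ
      hη' (chartRoot_mem (q := q)) (coordDual (idx q i)) (fun v => ?_) (inv _ F)
    · have h2 := hω (Coord 1) _ hg y hy m hm hym (φ (inv _ F))
      have h3 : y (φ (inv _ F)) = _ := hF
      rw [h3, inv_inv, AlgHom.comp_apply, AlgHom.comp_apply, mul_sub, ← mul_assoc, ← map_mul,
        ← map_mul, sub_eq_add_neg, ← neg_one_smul ℂ (_ * pullFst _ _ _), berezinFibre_add,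
        berezinFibre_smul, berezinFibre_mul_pullFst, berezinFibre_pullSnd, berezinFibre_pullSnd,
        add_eq_left, ← Algebra.smul_def] at h2
      have h4 := (smul_eq_zero.mp h2).resolve_left (neg_ne_zero.mpr one_ne_zero)
      exact (smul_eq_zero.mp h4).resolve_right (oddCoord_ne_zero 0)
    · rw [ι_eq_sum]
      simp only [map_sum, map_smul]
      have h5 : ∀ l, (y.comp φ) (oddCoord l) =
          ((pullSnd (Coord 1) (Coord (2 * q))).comp φ) (oddCoord l) +
            if l = idx q i then pullFst (Coord 1) _ η *
              ((pullSnd (Coord 1) (Coord (2 * q))).comp φ) (chartRoot q) else 0 := fun l => by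
        have := hgen ((idx q).symm l)
        rw [coordCol, Equiv.apply_symm_apply] at this
        simp only [Equiv.symm_apply_eq] at this
        exact this
      simp only [h5, smul_add, Finset.sum_add_distrib]
      congr 1
      simp
  -- The functional that first multiplies by b kills all derivatives, hence is a multiple of the
  -- Berezin integral. Replacing F by b⁻¹F yields the density 1/b.
  obtain ⟨c, hc⟩ := exists_eq_berezin_mul
    (berezinL (2 * q) ∘ₗ LinearMap.mulLeft ℂ (ω.coeff * φ (chartRoot q)) ∘ₗ φ.toLinearMap)
    fun i a => by
      have := key ((idx q).symm i) a
      rw [coordDel, Equiv.apply_symm_apply, map_mul, ← mul_assoc] at this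
      exact this
  have hc' : ∀ F, berezin (ω.coeff * φ F) = c * berezin (chartRootInv q * F) := fun F => by
    have h1 : berezin (ω.coeff * φ (chartRoot q) * φ (chartRootInv q * F)) = _ := hc _
    rwa [mul_assoc, ← map_mul, ← mul_assoc, chartRoot_mul_inv, one_mul] at h1
  refine ⟨c, fun h0 => ?_, hc'⟩
  obtain ⟨f, hf⟩ := exists_berezin_mul_ne_zero hne
  obtain ⟨F, rfl⟩ := hsurj f
  rw [hc', h0, zero_mul] at hf
  exact hf rfl

/-- The binomial expansion of the spherical superfunction. -/
theorem sphericalAt_eq {ω : BerDensity q} (hω : ω.IsInvariant) (hne : ω.coeff ≠ 0) :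
    ∃ c : ℂ, c ≠ 0 ∧ ∀ (lam : ℂ) (t : ℝ), sphericalAt ω lam t =
      c * (Complex.exp ((lam - (rho q : ℂ)) * t) * ∑ j ∈ Finset.range (q + 1),
        Ring.choose (lam - (rho q : ℂ)) j *
          (((1 - Complex.exp (-2 * t)) / 2) ^ j * moment q j)) := by
  obtain ⟨φ, hφ, hsurj, hs⟩ := ω.isChart.exists_surjective
  obtain ⟨c, hc, hL⟩ := hω.eq_smul hne hφ hsurj hs
  refine ⟨c, hc, fun lam t => ?_⟩
  set μ := lam - (rho q : ℂ)
  set r := (1 - Complex.exp (-2 * t)) / 2 with hr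
  have hsK := map_mem_ptsK ω.isChart.1 (isSuperHom_pullSnd (V := Coord 0))
  obtain ⟨H1, H2, H3⟩ := iwasawaH_spec hsK t
  have hk : ω.chart.map (pullSnd (Coord 0) (Coord (2 * q))) (inl 1) (inl 1) - 1 =
      pullSnd (Coord 0) (Coord (2 * q)) (φ (chartRoot q - 1)) := by
    rw [Matrix.map_apply, hs, stdChart_inl, map_sub, map_sub, map_one, map_one]
  -- Nilpotency of b - 1 terminates the binomial series for the complex power after the term of
  -- index q.
  have hX : (r • pullSnd (Coord 0) (Coord (2 * q)) (φ (chartRoot q - 1))) ^ (q + 1) = 0 := by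
    rw [smul_pow, ← map_pow, ← map_pow, sub_one_pow_succ, map_zero, map_zero, smul_zero]
  rw [hk] at H3
  have hexp := grExp_smul_eq_sum H1 H2 H3 hX μ
  have hmap : (expA q (algebraMap ℂ (Gr (Coord 0)) (t : ℂ))).map
      (pullFst (Coord 0) (Coord (2 * q))) = expA q (algebraMap ℂ _ (t : ℂ)) := by
    rw [map_expA isSuperHom_pullFst (algebraMap_mem_parity _), AlgHom.commutes]
  rw [sphericalAt, sphericalFn, hmap, hexp, mul_smul_comm, berezinFibre_smul, Finset.mul_sum]
  change body (_ • berezinFibreL (Coord 0) (2 * q) _) = _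
  rw [map_sum, map_smul, map_sum, smul_eq_mul, Finset.mul_sum, Finset.mul_sum, Finset.mul_sum]
  refine Finset.sum_congr rfl fun j _ => ?_
  change _ * body (berezinFibre (Coord 0) _) = _
  rw [mul_smul_comm, berezinFibre_smul, smul_pow, mul_smul_comm, berezinFibre_smul, ← map_pow,
    ← map_pow, ← map_mul, berezinFibre_pullSnd, hL, map_smul, map_smul, body_algebraMap,
    smul_eq_mul, smul_eq_mul, moment]
  ring

end Spherical

/-! ### The root multiplicity -/

section Root

variable {q : ℕ}

/-- The parametrisation of the root space by the first row. -/
def rootMap (q : ℕ) : (Fin 2 × Fin q → ℂ) →ₗ[ℂ] SMat q ℂ where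
  toFun w := rootMat w (symp w)
  map_add' v w := by
    ext (i | i) (j | j) <;> simp [rootMat, symp_add]
    split_ifs <;> abel
  map_smul' c w := by
    have h : symp (c • w) = c • symp w := by
      ext ⟨a, j⟩; obtain rfl | rfl := fin_two_cases a <;> simp
    ext (i | i) (j | j) <;> simp [rootMat, h]

theorem rootMap_injective : Function.Injective (rootMap q) := fun v w h => by
  ext j
  have := congrFun (congrFun h (inl 0)) (inr j)
  simpa [rootMap, rootMat] using this

theorem eq_symp_of_isOsp {w u : Fin 2 × Fin q → ℂ} (h : IsOsp (rootMat w u)) : u = symp w := by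
  have h1 : symp u = -w := by
    ext i
    have h0 := congrFun (congrFun h (inr i)) (inl 0)
    rw [Matrix.add_apply, Matrix.mul_apply, Fintype.sum_sum_type, Fin.sum_univ_two] at h0
    have h2 : (formJ q ℂ * rootMat w u) (inr i) (inl 0) =
        (formJ q ℂ).mulVec (fun k => rootMat w u k (inl 0)) (inr i) := rfl
    rw [h2, formJ_mulVec_inr] at h0
    simp [superTranspose, rootMat, Matrix.toBlocks₁₂, formJ] at h0
    exact eq_neg_of_add_eq_zero_right h0
  have h3 := symp_symp u
  rw [h1] at h3
  have h4 : symp (-w) = -symp w := by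
    ext ⟨a, j⟩; obtain rfl | rfl := fin_two_cases a <;> simp
  exact neg_injective (h3.symm.trans h4)

theorem mem_rootSpace_iff {x : SMat q ℂ} : x ∈ rootSpace q ↔ x ∈ LinearMap.range (rootMap q) := by
  constructor
  · rintro ⟨h1, h2⟩
    have h3 := eq_rootMat h2
    rw [h3] at h1
    exact ⟨_, (by rw [← eq_symp_of_isOsp h1] : rootMat _ _ = _).trans h3.symm⟩
  · rintro ⟨w, rfl⟩
    exact ⟨isOsp_rootMat w, commutator_rootMat _ _⟩

theorem rootSpace_inf_evenMat : rootSpace q ⊓ evenMat q = ⊥ := by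
  rw [eq_bot_iff]
  rintro x ⟨hx, hx'⟩
  obtain ⟨w, rfl⟩ := mem_rootSpace_iff.mp hx
  have : w = 0 := funext fun j => by simpa [rootMap, rootMat] using hx'.1 0 j
  rw [this, map_zero]
  exact zero_mem _

theorem rootSpace_inf_oddMat : rootSpace q ⊓ oddMat q = LinearMap.range (rootMap q) := by
  ext x
  rw [Submodule.mem_inf, mem_rootSpace_iff, and_iff_left_iff_imp]
  rintro ⟨w, rfl⟩
  exact ⟨fun i j => by simp [rootMap, rootMat], fun i j => by simp [rootMap, rootMat]⟩

/-- The root space is parametrised by its odd first row, so its even part is zero and its odd part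
has dimension 2q. -/
theorem rho_eq (q : ℕ) : rho q = -(q : ℝ) := by
  rw [rho, rootMult, rootSpace_inf_evenMat, rootSpace_inf_oddMat, finrank_bot,
    LinearMap.finrank_range_of_inj rootMap_injective, Module.finrank_fintype_fun_eq_card,
    Fintype.card_prod, Fintype.card_fin, Fintype.card_fin]
  push_cast
  ring

end Root

/-! ### Binomial identities -/

section Binomial

open Finset

theorem ring_choose_neg (r : ℂ) (n : ℕ) :
    Ring.choose (-r) n = (-1) ^ n * Ring.choose (r + n - 1) n := by
  rw [Ring.choose_neg, Units.smul_def, zsmul_eq_mul, Int.negOnePow_def]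
  simp

theorem ring_choose_eq_prod (a : ℂ) (n : ℕ) :
    Ring.choose a n = (n.factorial : ℂ)⁻¹ * ∏ i ∈ range n, (a - i) := by
  rw [Ring.choose_eq_smul, smul_eq_mul, ← descPochhammer_eval_eq_prod_range,
    ← Polynomial.aeval_eq_smeval, ← descPochhammer_map (Int.castRingHom ℂ) n, Polynomial.eval_map]
  rfl

/-- This is the coefficient of x^k, with q = k + n. Use binom(μ, j) binom(j, k) = binom(μ, k)
binom(μ - k, j - k), and write binom(2q - j, q) as ± binom(-(q + 1), q - j). Vandermonde's identity
then sums the series, and reversing the sign of the upper index gives the stated form. -/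
theorem sum_choose_coeff (μ : ℂ) (k n : ℕ) :
    ∑ j ∈ range (k + n + 1), Ring.choose μ j * ((-1) ^ (j - k) * (j.choose k : ℂ)) *
      ((2 * (k + n) - j).choose (k + n) : ℂ) =
    Ring.choose μ k * Ring.choose (2 * (k + n : ℕ) - μ) n := by
  rw [add_assoc, sum_range_add, sum_eq_zero fun j hj => ?_, zero_add]
  swap
  · rw [Nat.choose_eq_zero_of_lt (mem_range.mp hj)]; simp
  have hterm : ∀ i ∈ range (n + 1), Ring.choose μ (k + i) *
      ((-1) ^ (k + i - k) * ((k + i).choose k : ℂ)) *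
        ((2 * (k + n) - (k + i)).choose (k + n) : ℂ) =
      Ring.choose μ k * ((-1) ^ n *
        (Ring.choose (μ - k) i * Ring.choose (-((k : ℂ) + n + 1)) (n - i))) := by
    intro i hi
    have hin : i ≤ n := Nat.lt_succ_iff.mp (mem_range.mp hi)
    obtain ⟨m, rfl⟩ := Nat.exists_eq_add_of_le hin
    have h1 := Ring.choose_smul_choose μ (Nat.le_add_right k i)
    rw [nsmul_eq_mul, Nat.add_sub_cancel_left] at h1
    have h2 : 2 * (k + (i + m)) - (k + i) = (k + (i + m)) + m := by omega
    have h3 : ((k : ℂ) + (i + m : ℕ) + 1) + m - 1 = ((k + (i + m) + m : ℕ) : ℂ) := by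
      push_cast; ring
    rw [Nat.add_sub_cancel_left, Nat.add_sub_cancel_left, ring_choose_neg, h3, Ring.choose_natCast,
      h2, Nat.choose_symm_add (a := k + (i + m)), pow_add]
    have h4 : ((-1 : ℂ) ^ m) * (-1) ^ m = 1 := by rw [← mul_pow]; simp
    linear_combination ((-1 : ℂ) ^ i * ((k + (i + m) + m).choose m : ℂ)) * h1 -
      (Ring.choose μ k * (-1) ^ i * Ring.choose (μ - k) i *
        ((k + (i + m) + m).choose m : ℂ)) * h4
  rw [sum_congr rfl hterm, ← mul_sum, ← mul_sum]
  have hv := Ring.add_choose_eq n (Commute.all (μ - k) (-((k : ℂ) + n + 1)))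
  rw [Nat.sum_antidiagonal_eq_sum_range_succ
    (fun a b => Ring.choose (μ - k) a * Ring.choose (-((k : ℂ) + n + 1)) b)] at hv
  rw [← hv]
  have h5 : (2 * (k + n : ℕ) - μ : ℂ) = -(μ - 2 * (k + n : ℕ)) := by ring
  rw [h5, ring_choose_neg]
  congr 3
  push_cast
  ring

theorem sum_choose_identity (q : ℕ) (μ x : ℂ) :
    ∑ j ∈ range (q + 1), Ring.choose μ j * ((x - 1) ^ j * ((2 * q - j).choose q : ℂ)) =
      ∑ k ∈ range (q + 1), Ring.choose μ k * Ring.choose (2 * q - μ) (q - k) * x ^ k := by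
  have hexp : ∀ j ∈ range (q + 1), (x - 1) ^ j =
      ∑ k ∈ range (q + 1), x ^ k * ((-1) ^ (j - k) * (j.choose k : ℂ)) := by
    intro j hj
    rw [sub_eq_add_neg, add_pow]
    simp only [mul_assoc]
    refine sum_subset (range_mono (Nat.succ_le_of_lt (mem_range.mp hj))) fun k _ hk => ?_
    rw [Nat.choose_eq_zero_of_lt (by simpa using hk)]
    simp
  calc ∑ j ∈ range (q + 1), Ring.choose μ j * ((x - 1) ^ j * ((2 * q - j).choose q : ℂ))
      = ∑ j ∈ range (q + 1), ∑ k ∈ range (q + 1), Ring.choose μ j *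
          ((-1) ^ (j - k) * (j.choose k : ℂ)) * ((2 * q - j).choose q : ℂ) * x ^ k := by
        refine sum_congr rfl fun j hj => ?_
        rw [hexp j hj, sum_mul, mul_sum]
        exact sum_congr rfl fun k _ => by ring
    _ = _ := by
        rw [sum_comm]
        refine sum_congr rfl fun k hk => ?_
        obtain ⟨n, rfl⟩ := Nat.exists_eq_add_of_le (Nat.lt_succ_iff.mp (mem_range.mp hk))
        rw [← sum_mul, sum_choose_coeff, Nat.add_sub_cancel_left]

/-- For the reciprocal the functional equation holds without exceptions: at a pole `Complex.Gamma`
has the value 0, and so has its inverse. -/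
theorem inv_Gamma_sub_natCast (lam : ℂ) (n : ℕ) : (Complex.Gamma (lam - n))⁻¹ =
    (∏ i ∈ range n, (lam - 1 - i)) * (Complex.Gamma lam)⁻¹ := by
  induction n with
  | zero => simp
  | succ n ih =>
    have h := Complex.one_div_Gamma_eq_self_mul_one_div_Gamma_add_one (lam - (n + 1 : ℕ))
    have e : lam - (n + 1 : ℕ) + 1 = lam - n := by push_cast; ring
    rw [e, ih] at h
    rw [h, prod_range_succ]
    push_cast
    ring

theorem ring_choose_eq_Gamma {lam : ℂ} (h : 0 < lam.re) (q : ℕ) : Ring.choose (-lam + q) q =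
    ((-1) ^ q * (q.factorial : ℂ)⁻¹) * (Complex.Gamma lam / Complex.Gamma (lam - q)) := by
  have e1 : -lam + q = -(lam - q) := by ring
  have e2 : lam - q + q - 1 = lam - 1 := by ring
  rw [e1, ring_choose_neg, e2, ring_choose_eq_prod, div_eq_mul_inv, inv_Gamma_sub_natCast,
    mul_comm (∏ i ∈ range q, _), mul_inv_cancel_left₀ (Complex.Gamma_ne_zero_of_re_pos h), mul_assoc]

end Binomial

/-! ### Expansion of the spherical superfunction in powers of e^{-2t} -/

section Expansion

open Finset

/-- The spherical superfunction as a polynomial in `e^{-2t}`. -/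
theorem sphericalAt_eq_sum {q : ℕ} {ω : BerDensity q} (hω : ω.IsInvariant) (hne : ω.coeff ≠ 0) :
    ∃ c : ℂ, c ≠ 0 ∧ ∀ (lam : ℂ) (t : ℝ), sphericalAt ω lam t =
      c * (Complex.exp ((lam + q) * t) * ∑ k ∈ range (q + 1),
        Ring.choose (lam + q) k * Ring.choose (-lam + q) (q - k) * Complex.exp (-2 * t) ^ k) := by
  obtain ⟨c, hc, h⟩ := sphericalAt_eq hω hne
  obtain ⟨c', hc', h'⟩ := exists_moment_eq q
  refine ⟨c * c', mul_ne_zero hc hc', fun lam t => ?_⟩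
  have e1 : lam - (rho q : ℂ) = lam + q := by rw [rho_eq]; push_cast; ring
  have e2 : -lam + q = 2 * q - (lam + q) := by ring
  rw [h, e1, e2, ← sum_choose_identity]
  simp only [mul_sum]
  refine sum_congr rfl fun j hj => ?_
  -- The factor (-2)^j of the moments cancels the denominators 2^j, so that the sum runs over powers
  -- of x - 1 with x = e^{-2t}.
  have e3 : Complex.exp (-2 * t) - 1 = (1 - Complex.exp (-2 * t)) / 2 * -2 := by ring
  rw [h' j (Nat.lt_succ_iff.mp (mem_range.mp hj)), e3, mul_pow]
  ring

theorem tendsto_exp_neg_two_mul :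
    Filter.Tendsto (fun t : ℝ => Complex.exp (-2 * t)) Filter.atTop (nhds 0) := by
  have h1 : Filter.Tendsto (fun t : ℝ => Real.exp (-(2 * t))) Filter.atTop (nhds 0) :=
    Real.tendsto_exp_neg_atTop_nhds_zero.comp (Filter.tendsto_id.const_mul_atTop two_pos)
  have h2 := (Complex.continuous_ofReal.tendsto 0).comp h1
  rw [Complex.ofReal_zero] at h2
  refine h2.congr fun t => ?_
  simp [Complex.ofReal_exp]

end Expansion

end OrthoSymplectic

end

/-! ### The expansion and the c-function -/

theorem mainTheorem6 (q : ℕ) :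
    OrthoSymplectic.rho q = -(q : ℝ) ∧
    (∃ ω : OrthoSymplectic.BerDensity q, ω.coeff ≠ 0 ∧ ω.IsInvariant) ∧
    ∀ ω : OrthoSymplectic.BerDensity q, ω.coeff ≠ 0 → ω.IsInvariant →
      (∃ c₁ : ℂ, c₁ ≠ 0 ∧ ∀ (lam : ℂ) (t : ℝ),
        OrthoSymplectic.sphericalAt ω lam t =
          c₁ * Complex.exp (lam * t) *
            ∑ k ∈ Finset.range (q + 1),
              Ring.choose (lam - (OrthoSymplectic.rho q : ℂ)) k *
                Ring.choose (-lam - (OrthoSymplectic.rho q : ℂ)) (q - k) *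
                Complex.exp ((-(OrthoSymplectic.rho q : ℂ) - 2 * (k : ℂ)) * t)) ∧
      (∃ c₀ : ℂ, c₀ ≠ 0 ∧ ∀ lam : ℂ, 0 < lam.re →
        Filter.Tendsto
          (fun t : ℝ => Complex.exp (-((lam - (OrthoSymplectic.rho q : ℂ)) * t)) *
            OrthoSymplectic.sphericalAt ω lam t)
          Filter.atTop
          (nhds (c₀ * (Complex.Gamma lam /
            Complex.Gamma (lam + (OrthoSymplectic.rho q : ℂ)))))) := by
  have hρ : (OrthoSymplectic.rho q : ℂ) = -(q : ℂ) := by rw [OrthoSymplectic.rho_eq]; push_cast; ring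
  refine ⟨OrthoSymplectic.rho_eq q, ⟨OrthoSymplectic.stdDensity q,
    OrthoSymplectic.chartRootInv_ne_zero, OrthoSymplectic.isInvariant_stdDensity⟩, ?_⟩
  intro ω hne hω
  obtain ⟨c, hc, h⟩ := OrthoSymplectic.sphericalAt_eq_sum hω hne
  simp only [hρ, sub_neg_eq_add, neg_neg, ← sub_eq_add_neg (G := ℂ)]
  -- The factor (-1)^q / q! comes from writing the constant coefficient binom(q - λ, q) as a
  -- quotient of Gamma values.
  refine ⟨⟨c, hc, fun lam t => ?_⟩, c * ((-1) ^ q * (q.factorial : ℂ)⁻¹),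
    mul_ne_zero hc (mul_ne_zero (pow_ne_zero _ (neg_ne_zero.mpr one_ne_zero))
      (inv_ne_zero (Nat.cast_ne_zero.mpr q.factorial_ne_zero))), fun lam hlam => ?_⟩
  · rw [h]
    simp only [Finset.mul_sum]
    refine Finset.sum_congr rfl fun k _ => ?_
    have e : Complex.exp ((lam + q) * t) * Complex.exp (-2 * t) ^ k =
        Complex.exp (lam * t) * Complex.exp ((q - 2 * k) * t) := by
      rw [← Complex.exp_nat_mul, ← Complex.exp_add, ← Complex.exp_add]
      congr 1
      ring
    linear_combination (c * Ring.choose (lam + q) k * Ring.choose (-lam + q) (q - k)) * e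
  · have hcont : Continuous fun x : ℂ => c * ∑ k ∈ Finset.range (q + 1),
        Ring.choose (lam + q) k * Ring.choose (-lam + q) (q - k) * x ^ k := by fun_prop
    have hlim := (hcont.tendsto 0).comp OrthoSymplectic.tendsto_exp_neg_two_mul
    -- The limit is the value of the polynomial at x = 0, so only the term k = 0 remains.
    rw [Finset.sum_range_succ', Finset.sum_eq_zero fun k _ => by
      rw [pow_succ, mul_zero, mul_zero], zero_add, Ring.choose_zero_right, one_mul, pow_zero,
      mul_one, Nat.sub_zero, OrthoSymplectic.ring_choose_eq_Gamma hlam, ← mul_assoc] at hlim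
    refine hlim.congr fun t => ?_
    rw [h, mul_left_comm, ← mul_assoc (Complex.exp (-_)), ← Complex.exp_add, neg_add_cancel,
      Complex.exp_zero, one_mul]
    rfl
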